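/- **Setting.** Let $T>0$ and let $X=(X_t)_{t\in[0,T]}$ be a continuous centred Gaussian process with $X_0=0$ on a probability space $(\Omega,\mathcal F,P)$ whose $\sigma$-algebra is, up to null sets, generated by $X$; assume that the law of $X$ on $C_0([0,T])$ has full support. Let $R(s,t)=\mathrm{Cov}(X_s,X_t)$ and assume that $X$ has a covariance measure: a finite signed Borel measure $\mu$ on $[0,T]^2$, not charging the axes, with $\mu(]a,b]\times]c,d])=R(b,d)+R(a,c)-R(a,d)-R(b,c)$. Let $|\mu|$ be its total variation and $\nu(B)=|\mu|([0,T]\times B)$. Put $\|\varphi\|_{|\mathcal H|}^2=\int|\varphi(u)\varphi(v)|\,d|\mu|(u,v)$, let $L_\mu$ be the set of Borel $\varphi$ with $\|\varphi\|_{|\mathcal H|}<\infty$, and $\|K\|^2_{|\mathcal H|\otimes|\mathcal H|}=\int\|K(t_1,\cdot)\|_{|\mathcal H|}\|K(t_2,\cdot)\|_{|\mathcal H|}\,d|\mu|(t_1,t_2)$. The Wiener integral $\varphi\mapsto\int\varphi\,dX\in L^2(\Omega)$, $\varphi\in L_\mu$, is the continuous extension of $\sum a_i1_{]0,\tau_i]}\mapsto\sum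 a_iX_{\tau_i}$. $Cyl$ is the set of $F=f(\int\phi_1dX,\dots,\int\phi_ndX)$ with $f\in C_b^\infty(\mathbb R^n)$, $\phi_i\in L_\mu$, and $D_tF=\sum_i\partial_if(\int\phi_1dX,\dots,\int\phi_ndX)\,\phi_i(t)$. $Cyl(L_\mu)$ is the set of $u_t=\sum_\ell\psi_\ell(t)G_\ell$ (finite sum, $\psi_\ell\in L_\mu$, $G_\ell\in Cyl$), and $D_{t_1}u_{t_2}=\sum_\ell\psi_\ell(t_2)D_{t_1}G_\ell$. We write $F\in|\mathbb D^{1,2}|$ with derivative $DF$ if there are $F_n\in Cyl$ with $F_n\to F$ in $L^2(\Omega)$ and $E\|DF_n-DF\|^2_{|\mathcal H|}\to0$; and $u\in|\mathbb D^{1,2}(L_\mu)|$ with derivative $Du$ if there are $u_n\in Cyl(L_\mu)$ with $E\|u_n-u\|_{|\mathcal H|}^2\to0$ and $E\|Du_n-Du\|^2_{|\mathcal H|\otimes|\mathcal H|}\to0$ (here $\|u\|_{|\mathcal H|}$, $\|DF\|_{|\mathcal H|}$, $\|Du\|_{|\mathcal H|\otimes|\mathcal H|}$ are a.s. finite and the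 derivatives are measurable). A process $u$ with $E\|u\|^2_{|\mathcal H|}<\infty$ is in $Dom(\delta)$ with Skorohod integral $Z=\int_0^Tu\,\delta X$ if $Z\in L^2(\Omega)$, $EZ=0$ and $E(FZ)=E\int D_{s_1}F\,u_{s_2}\,d\mu(s_1,s_2)$ for every $F\in Cyl$ for which the right-hand side converges absolutely; $\int_0^tu\,\delta X:=\int_0^Tu1_{[0,t]}\,\delta X$. The forward integral $\int_0^tY\,d^-X$ (backward integral $\int_0^tY\,d^+X$) is the limit in probability as $\varepsilon\downarrow0$ of $\int_0^tY_s\frac{X_{s+\varepsilon}-X_s}{\varepsilon}ds$ (of $\int_0^tY_s\frac{X_s-X_{s-\varepsilon}}{\varepsilon}ds$), where $X_r=X_T$ for $r>T$ and $X_r=X_0$ for $r<0$. **Theorem.** Let $Y=(Y_t)_{t\in[0,T]}$ be a cadlag process. Consider the hypotheses: a) $\sup_{t\le T}|Y_t|$ is square integrable. b) $Y\in|\mathbb D^{1,2}(L_\mu)|$ with a jointly measurable derivative $(t,s,\omega)\mapsto D_tY_s(\omega)$ such that, for Lebesgue-almost every $s\in[0,T]$, $Y_s\in|\mathbb D^{1,2}|$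 with derivative $t\mapsto D_tY_s$. Moreover there is a square integrable random variable $Z_2$ such that, for $\nu$-almost every and for Lebesgue-almost every $s\in[0,T]$, $|D_tY_s|\le Z_2$ a.s. for $\nu$-almost every $t$. c) For $|\mu|$-almost all $(t_1,t_2)$ the limit $D_{t_1}Y_{t_2-}:=\lim_{\varepsilon\downarrow0}\frac1\varepsilon\int_{t_2-\varepsilon}^{t_2}D_{t_1}Y_s\,ds$ exists a.s.; moreover for each $s\in\,]0,T]$, for $\nu$-almost every $t$, a.s. $D_tY_{s-}$ exists and equals $D_tY_s$. c') For $|\mu|$-almost all $(t_1,t_2)$ the limit $D_{t_1}Y_{t_2+}:=\lim_{\varepsilon\downarrow0}\frac1\varepsilon\int_{t_2}^{t_2+\varepsilon}D_{t_1}Y_s\,ds$ exists a.s.; moreover for each $s\in[0,T[$, for $\nu$-almost every $t$, a.s. $D_tY_{s+}$ exists and equals $D_tY_s$. If a), b), c) hold, then for every $t\in[0,T]$: $Y1_{[0,t]}\in Dom(\delta)$ (in particular $Y\in Dom(\delta)$), the forward integral $\int_0^tY\,d^-X$ exists, $(t_1,t_2)\mapsto D_{t_1}Y_{t_2-}$ is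 a.s. $|\mu|$-integrable on $[0,T]\times[0,t]$, and $$\int_0^tY\,d^-X=\int_0^tY\,\delta X+\int_{[0,T]\times[0,t]}D_{t_1}Y_{t_2-}\,d\mu(t_1,t_2).$$ If a), b), c') hold, then the same is true for the backward integral, with $$\int_0^tY\,d^+X=\int_0^tY\,\delta X+\int_{[0,T]\times[0,t]}D_{t_1}Y_{t_2+}\,d\mu(t_1,t_2).$$ (For $t=T$ the domain is $[0,T]^2$.) -/

import Mathlib

open MeasureTheory ProbabilityTheory Filter Topology Set
open scoped ENNReal

namespace CovMalliavin

noncomputable section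

variable {Ω : Type*} [MeasurableSpace Ω]

/-- `μ` is the covariance measure of the process `X` on `[0,T]²`: on every rectangle
`]a,b] × ]c,d]` it takes the value of the planar increment of the covariance function of `X`.
The measure is extended by zero outside `]0,T]²` (for `X 0 = 0` the axes carry no mass). -/
structure IsCovarianceMeasure (P : Measure Ω) (T : ℝ) (X : ℝ → Ω → ℝ)
    (μ : SignedMeasure (ℝ × ℝ)) : Prop where
  rectangle : ∀ a b c d : ℝ, 0 ≤ a → a ≤ b → b ≤ T → 0 ≤ c → c ≤ d → d ≤ T →
    μ (Ioc a b ×ˢ Ioc c d) =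
      cov[X b, X d; P] + cov[X a, X c; P] - cov[X a, X d; P] - cov[X b, X c; P]
  carrier : μ.variation ((Ioc 0 T ×ˢ Ioc 0 T)ᶜ) = 0

/-- The standing assumptions on the integrator `X = (X_t)_{t ∈ [0,T]}` and on the underlying
probability space; only the values `X t`, `t ∈ [0,T]`, matter. -/
structure IsIntegrator (P : Measure Ω) (T : ℝ) (X : ℝ → Ω → ℝ)
    (μ : SignedMeasure (ℝ × ℝ)) : Prop where
  measurable : ∀ t ∈ Icc 0 T, Measurable (X t)
  gaussian : IsGaussianProcess (fun t : Icc (0 : ℝ) T => X t) P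
  mean_zero : ∀ t ∈ Icc 0 T, ∫ ω, X t ω ∂P = 0
  start_zero : ∀ᵐ ω ∂P, X 0 ω = 0
  continuous : ∀ᵐ ω ∂P, ContinuousOn (fun t => X t ω) (Icc 0 T)
  /-- The law of `X` on `C₀([0,T])` has full support. -/
  full_support : ∀ g : ℝ → ℝ, ContinuousOn g (Icc 0 T) → g 0 = 0 → ∀ r : ℝ, 0 < r →
    0 < P {ω | ∀ t ∈ Icc 0 T, |X t ω - g t| < r}
  /-- Up to null sets, the σ-algebra of the probability space is the one generated by `X`. -/
  generated : ∀ A : Set Ω, MeasurableSet A →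
    ∃ B : Set Ω, MeasurableSet[⨆ t : Icc (0 : ℝ) T, MeasurableSpace.comap (X t) inferInstance] B ∧
      A =ᵐ[P] B
  covariance : IsCovarianceMeasure P T X μ

/-- The marginal measure `ν(B) = |μ|([0,T] × B)` of the total variation `|μ|`. -/
def marginal (μ : SignedMeasure (ℝ × ℝ)) : Measure ℝ := μ.variation.map Prod.snd

/-- `‖φ‖²_{|𝓗|} = ∫ |φ(u)| |φ(v)| d|μ|(u,v)`, a value in `[0,∞]`. -/
def absHSq (μ : SignedMeasure (ℝ × ℝ)) (φ : ℝ → ℝ) : ℝ≥0∞ :=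
  ∫⁻ p, ‖φ p.1‖ₑ * ‖φ p.2‖ₑ ∂μ.variation

/-- Membership in `L_μ`: Borel functions with `‖φ‖_{|𝓗|} < ∞`. -/
def MemLmu (μ : SignedMeasure (ℝ × ℝ)) (φ : ℝ → ℝ) : Prop :=
  Measurable φ ∧ absHSq μ φ < ∞

/-- `‖K‖²_{|𝓗|⊗|𝓗|} = ∫ ‖K(t₁,·)‖_{|𝓗|} ‖K(t₂,·)‖_{|𝓗|} d|μ|(t₁,t₂)`. -/
def absHHSq (μ : SignedMeasure (ℝ × ℝ)) (K : ℝ → ℝ → ℝ) : ℝ≥0∞ :=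
  ∫⁻ p, absHSq μ (K p.1) ^ (1 / 2 : ℝ) * absHSq μ (K p.2) ^ (1 / 2 : ℝ) ∂μ.variation

/-- `IsWienerIntegral P T X μ φ W` says that `W` is (a version of) the Wiener integral
`∫₀ᵀ φ dX` of `φ ∈ L_μ`.  This is the continuous extension of `∑ aᵢ 1_{]0,τᵢ]} ↦ ∑ aᵢ X_{τᵢ}`
from step functions to `L_μ`.  Since `‖·‖_{|𝓗|}` need not satisfy the triangle inequality, the
extension is written as a sequential closure. -/
inductive IsWienerIntegral (P : Measure Ω) (T : ℝ) (X : ℝ → Ω → ℝ)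
    (μ : SignedMeasure (ℝ × ℝ)) : (ℝ → ℝ) → (Ω → ℝ) → Prop
  | step (n : ℕ) (a τ : Fin n → ℝ) (hτ : ∀ i, τ i ∈ Icc 0 T) :
      IsWienerIntegral P T X μ
        (fun s => ∑ i, a i * (Ioc 0 (τ i)).indicator (fun _ => (1 : ℝ)) s)
        (fun ω => ∑ i, a i * X (τ i) ω)
  | limit (φ : ℝ → ℝ) (W : Ω → ℝ) (φn : ℕ → ℝ → ℝ) (Wn : ℕ → Ω → ℝ)
      (hn : ∀ n, IsWienerIntegral P T X μ (φn n) (Wn n))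
      (hφ : MemLmu μ φ) (hW : MemLp W 2 P)
      (hφn : Tendsto (fun n => absHSq μ (fun s => φn n s - φ s)) atTop (𝓝 0))
      (hWn : Tendsto (fun n => eLpNorm (fun ω => Wn n ω - W ω) 2 P) atTop (𝓝 0)) :
      IsWienerIntegral P T X μ φ W

/-- `f ∈ C_b^∞(ℝⁿ)`: smooth, and bounded together with all its derivatives. -/
def IsCbInfty {n : ℕ} (f : (Fin n → ℝ) → ℝ) : Prop :=
  ContDiff ℝ (⊤ : ℕ∞) f ∧ ∀ k : ℕ, ∃ C : ℝ, ∀ x, ‖iteratedFDeriv ℝ k f x‖ ≤ C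

/-- `F` is a smooth cylindrical random variable `f(∫φ₁dX, …, ∫φₙdX)`, and `DF` is its
derivative `D_t F = ∑ᵢ ∂ᵢf(∫φ₁dX, …, ∫φₙdX) φᵢ(t)`, written `DF t ω`. -/
def IsCyl (P : Measure Ω) (T : ℝ) (X : ℝ → Ω → ℝ) (μ : SignedMeasure (ℝ × ℝ))
    (F : Ω → ℝ) (DF : ℝ → Ω → ℝ) : Prop :=
  ∃ (n : ℕ) (f : (Fin n → ℝ) → ℝ) (φ : Fin n → ℝ → ℝ) (W : Fin n → Ω → ℝ),
    IsCbInfty f ∧ (∀ i, MemLmu μ (φ i)) ∧ (∀ i, IsWienerIntegral P T X μ (φ i) (W i)) ∧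
    F = (fun ω => f (fun i => W i ω)) ∧
    DF = (fun t ω => ∑ i, fderiv ℝ f (fun j => W j ω) (Pi.single i 1) * φ i t)

/-- `u ∈ Cyl(L_μ)`, i.e. `u_t = ∑ ψ_ℓ(t) G_ℓ` with `ψ_ℓ ∈ L_μ` and `G_ℓ` smooth cylindrical,
and `Du t₁ t₂ = D_{t₁} u_{t₂} = ∑ ψ_ℓ(t₂) D_{t₁} G_ℓ`. -/
def IsCylProcess (P : Measure Ω) (T : ℝ) (X : ℝ → Ω → ℝ) (μ : SignedMeasure (ℝ × ℝ))
    (u : ℝ → Ω → ℝ) (Du : ℝ → ℝ → Ω → ℝ) : Prop :=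
  ∃ (n : ℕ) (ψ : Fin n → ℝ → ℝ) (G : Fin n → Ω → ℝ) (DG : Fin n → ℝ → Ω → ℝ),
    (∀ l, MemLmu μ (ψ l)) ∧ (∀ l, IsCyl P T X μ (G l) (DG l)) ∧
    u = (fun t ω => ∑ l, ψ l t * G l ω) ∧
    Du = (fun t₁ t₂ ω => ∑ l, ψ l t₂ * DG l t₁ ω)

/-- `F ∈ |𝔻^{1,2}|` with Malliavin derivative `DF` (`DF t ω` is `D_t F(ω)`). -/
structure IsAbsD12 (P : Measure Ω) (T : ℝ) (X : ℝ → Ω → ℝ) (μ : SignedMeasure (ℝ × ℝ))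
    (F : Ω → ℝ) (DF : ℝ → Ω → ℝ) : Prop where
  memLp : MemLp F 2 P
  aemeasurable : AEMeasurable (fun p : ℝ × Ω => DF p.1 p.2) ((marginal μ).prod P)
  finite : ∀ᵐ ω ∂P, absHSq μ (fun t => DF t ω) < ∞
  approx : ∃ (Fn : ℕ → Ω → ℝ) (DFn : ℕ → ℝ → Ω → ℝ), (∀ n, IsCyl P T X μ (Fn n) (DFn n)) ∧
    Tendsto (fun n => eLpNorm (fun ω => Fn n ω - F ω) 2 P) atTop (𝓝 0) ∧
    Tendsto (fun n => ∫⁻ ω, absHSq μ (fun t => DFn n t ω - DF t ω) ∂P) atTop (𝓝 0)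

/-- `u ∈ |𝔻^{1,2}(L_μ)|` with Malliavin derivative `Du` (`Du t₁ t₂ ω` is `D_{t₁}u_{t₂}(ω)`). -/
structure IsAbsD12Process (P : Measure Ω) (T : ℝ) (X : ℝ → Ω → ℝ) (μ : SignedMeasure (ℝ × ℝ))
    (u : ℝ → Ω → ℝ) (Du : ℝ → ℝ → Ω → ℝ) : Prop where
  aemeasurable : AEMeasurable (fun p : ℝ × Ω => u p.1 p.2) ((marginal μ).prod P)
  measurable_deriv : Measurable (fun p : ℝ × ℝ × Ω => Du p.1 p.2.1 p.2.2)
  finite : ∀ᵐ ω ∂P, absHSq μ (fun t => u t ω) < ∞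
  finite_deriv : ∀ᵐ ω ∂P, absHHSq μ (fun t₁ t₂ => Du t₁ t₂ ω) < ∞
  approx : ∃ (un : ℕ → ℝ → Ω → ℝ) (Dun : ℕ → ℝ → ℝ → Ω → ℝ),
    (∀ n, IsCylProcess P T X μ (un n) (Dun n)) ∧
    Tendsto (fun n => ∫⁻ ω, absHSq μ (fun t => un n t ω - u t ω) ∂P) atTop (𝓝 0) ∧
    Tendsto (fun n => ∫⁻ ω, absHHSq μ (fun t₁ t₂ => Dun n t₁ t₂ ω - Du t₁ t₂ ω) ∂P) atTop (𝓝 0)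

/-- `u ∈ Dom(δ)` and `Z = ∫₀ᵀ u δX`: the process `u` lies in `L²(Ω; L_μ)`, `Z` is centred and
square integrable, and `E(F Z) = E ∫ D_{s₁}F u_{s₂} dμ(s₁,s₂)` for every smooth cylindrical `F`
for which the right-hand side converges absolutely (as the formula presupposes). -/
structure IsSkorohodIntegral (P : Measure Ω) (T : ℝ) (X : ℝ → Ω → ℝ)
    (μ : SignedMeasure (ℝ × ℝ)) (u : ℝ → Ω → ℝ) (Z : Ω → ℝ) : Prop where
  aemeasurable : AEMeasurable (fun p : ℝ × Ω => u p.1 p.2) ((marginal μ).prod P)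
  finite : ∫⁻ ω, absHSq μ (fun t => u t ω) ∂P < ∞
  memLp : MemLp Z 2 P
  mean_zero : ∫ ω, Z ω ∂P = 0
  duality : ∀ (F : Ω → ℝ) (DF : ℝ → Ω → ℝ), IsCyl P T X μ F DF →
    ∫⁻ ω, ∫⁻ p, ‖DF p.1 ω‖ₑ * ‖u p.2 ω‖ₑ ∂μ.variation ∂P < ∞ →
    ∫ ω, F ω * Z ω ∂P = ∫ ω, (∫ᵛ p, DF p.1 ω * u p.2 ω ∂•μ) ∂P

/-- `S = ∫₀ᵗ u δX := ∫₀ᵀ u 1_{[0,t]} δX`. -/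
def IsSkorohodIntegralUpTo (P : Measure Ω) (T : ℝ) (X : ℝ → Ω → ℝ)
    (μ : SignedMeasure (ℝ × ℝ)) (u : ℝ → Ω → ℝ) (t : ℝ) (S : Ω → ℝ) : Prop :=
  IsSkorohodIntegral P T X μ (fun s ω => (Icc 0 t).indicator (fun r => u r ω) s) S

/-- The function on `ℝ` that extends `x` from `[0,T]` by the constants `x 0` and `x T`. -/
def extend (T : ℝ) (x : ℝ → ℝ) (s : ℝ) : ℝ := x (max 0 (min s T))

/-- `J` is the forward integral `∫₀ᵗ Y d⁻X`: the limit in probability, as `ε ↓ 0`, of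
`∫₀ᵗ Y_s (X_{s+ε} - X_s)/ε ds`. -/
def IsForwardIntegral (P : Measure Ω) (T : ℝ) (X Y : ℝ → Ω → ℝ) (t : ℝ) (J : Ω → ℝ) : Prop :=
  TendstoInMeasure P
    (fun (ε : ℝ) ω => ∫ s in (0 : ℝ)..t,
      Y s ω * ((extend T (fun r => X r ω) (s + ε) - extend T (fun r => X r ω) s) / ε))
    (𝓝[>] 0) J

/-- `J` is the backward integral `∫₀ᵗ Y d⁺X`: the limit in probability, as `ε ↓ 0`, of
`∫₀ᵗ Y_s (X_s - X_{s-ε})/ε ds`. -/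
def IsBackwardIntegral (P : Measure Ω) (T : ℝ) (X Y : ℝ → Ω → ℝ) (t : ℝ) (J : Ω → ℝ) : Prop :=
  TendstoInMeasure P
    (fun (ε : ℝ) ω => ∫ s in (0 : ℝ)..t,
      Y s ω * ((extend T (fun r => X r ω) s - extend T (fun r => X r ω) (s - ε)) / ε))
    (𝓝[>] 0) J

/-- `x` is right continuous on `[0,T[` and has left limits on `]0,T]`. -/
def IsCadlagOn (T : ℝ) (x : ℝ → ℝ) : Prop :=
  (∀ t ∈ Ico 0 T, Tendsto x (𝓝[>] t) (𝓝 (x t))) ∧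
  (∀ t ∈ Ioc 0 T, ∃ l : ℝ, Tendsto x (𝓝[<] t) (𝓝 l))

/-- `(1/ε) ∫_{t-ε}^t x(s) ds`. -/
def leftAvg (x : ℝ → ℝ) (t ε : ℝ) : ℝ := ε⁻¹ * ∫ s in (t - ε)..t, x s

/-- `(1/ε) ∫_t^{t+ε} x(s) ds`. -/
def rightAvg (x : ℝ → ℝ) (t ε : ℝ) : ℝ := ε⁻¹ * ∫ s in t..(t + ε), x s

/-- `x(t-)`, the limit of `leftAvg x t ε` as `ε ↓ 0` (meaningful when that limit exists). -/
def leftTrace (x : ℝ → ℝ) (t : ℝ) : ℝ := limUnder (𝓝[>] 0) (leftAvg x t)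

/-- `x(t+)`, the limit of `rightAvg x t ε` as `ε ↓ 0` (meaningful when that limit exists). -/
def rightTrace (x : ℝ → ℝ) (t : ℝ) : ℝ := limUnder (𝓝[>] 0) (rightAvg x t)

/-- For `|μ|`-almost all `(t₁,t₂)` the limit `D_{t₁}Y_{t₂-}` exists a.s., and for each `s` the set
of `t` for which `D_tY_{s-} = D_tY_s` fails is `ν`-null. -/
structure HasLeftTraces (P : Measure Ω) (T : ℝ) (μ : SignedMeasure (ℝ × ℝ))
    (DY : ℝ → ℝ → Ω → ℝ) : Prop where
  exists_limit : ∀ᵐ p ∂μ.variation, ∀ᵐ ω ∂P,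
    ∃ l : ℝ, Tendsto (leftAvg (fun s => DY p.1 s ω) p.2) (𝓝[>] 0) (𝓝 l)
  regular : ∀ s ∈ Ioc 0 T, ∀ᵐ t ∂(marginal μ), ∀ᵐ ω ∂P,
    Tendsto (leftAvg (fun r => DY t r ω) s) (𝓝[>] 0) (𝓝 (DY t s ω))

/-- For `|μ|`-almost all `(t₁,t₂)` the limit `D_{t₁}Y_{t₂+}` exists a.s., and for each `s` the set
of `t` for which `D_tY_{s+} = D_tY_s` fails is `ν`-null. -/
structure HasRightTraces (P : Measure Ω) (T : ℝ) (μ : SignedMeasure (ℝ × ℝ))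
    (DY : ℝ → ℝ → Ω → ℝ) : Prop where
  exists_limit : ∀ᵐ p ∂μ.variation, ∀ᵐ ω ∂P,
    ∃ l : ℝ, Tendsto (rightAvg (fun s => DY p.1 s ω) p.2) (𝓝[>] 0) (𝓝 l)
  regular : ∀ s ∈ Ico 0 T, ∀ᵐ t ∂(marginal μ), ∀ᵐ ω ∂P,
    Tendsto (rightAvg (fun r => DY t r ω) s) (𝓝[>] 0) (𝓝 (DY t s ω))

end

end CovMalliavin

/-! ### Signed measures, polar density and symmetry of the covariance measure -/

namespace CovMalliavin

/-! For fixed `s` and `ε` the normalized increment `(X_{s+ε} - X_s)/ε` is the Wiener integral of the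
weight `k_s = ε⁻¹ 1_{]s,s+ε]}`. Gaussian integration by parts splits the product of `Y_s` with it
into an elementary divergence `Y_s ∫ k_s dX - ⟨DY_s, k_s⟩` and the pairing `⟨DY_s, k_s⟩ = ∫
D_{p₁}Y_s k_s(p₂) dμ(p)`. After integration over `s ≤ t`, Fubini turns the pairings into `∫ A_ε(p)
dμ(p)`, where `A_ε(p)` is the average of `D_{p₁}Y` over the window `[p₂ - ε, p₂]`, cut off at time
`t`. By the first half of c) and the bound `Z₂`, dominated convergence takes this to the trace term.

The heart of the proof is the `L²` convergence of the averaged divergences. It rests on the isometry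
`E[δ(Fξ) δ(Gη)] = E[FG] ⟨ξ,η⟩ + E[D_ηF D_ξG]`, proved for functions of Gaussian vectors
(`integral_divergence_mul_divergence`) and extended to `L²` limits
(`IsGaussDiff.integral_div_mul_div`). It expresses the inner product of the averaged divergences for
two parameters `ε`, `ε'` through window averages of `Y` and `DY` alone, with no factor `1/ε` left
over (`IsDominated.integral_mean_mul_mean`). These averages are dominated by square integrable
variables. They converge almost everywhere: those of `Y` because its paths are cadlag and `ν` has no
atoms, those of `DY` by the second half of c). Hence the Gram matrix converges, and a family in a
Hilbert space whose Gram matrix converges as both indices tend to their limit independently is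
convergent. No modulus of continuity and no norm on a space of processes is needed.

The `L²` limit is the Skorohod integral because the duality with cylindrical variables holds for
elementary divergences and survives the limit (`IsDominated.integral_val_mul_limit`,
`isSkorohodIntegral_of_deriv_wint`).

Two features of the setting need care. The marginals of `|μ|` are both `ν`, so `μ` defines a bounded
form on `L²(ν)`, and the Wiener integral is built there first (`exists_isWienerMap`). Functions in
`L_μ` may lie outside `L²(ν)` and are reached by truncation (`IsWienerIntegral.tendsto_wint`). The
absence of atoms of `ν` comes from the continuity of `X` (`marginal_singleton`). The backward
formula is the same argument with the window on the other side of the point; a parameter `α`, equal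
to `0` or `-1`, covers both. -/

instance isFiniteMeasure_variation {S : Type*} [MeasurableSpace S] (μ : SignedMeasure S) :
    IsFiniteMeasure μ.variation := by
  rw [← SignedMeasure.totalVariation_eq_variation]
  unfold SignedMeasure.totalVariation
  infer_instance

instance isFiniteMeasure_marginal (μ : SignedMeasure (ℝ × ℝ)) : IsFiniteMeasure (marginal μ) := by
  unfold marginal; infer_instance

/-- Polar decomposition of a signed measure with respect to its variation. -/
theorem exists_polar_density {S : Type*} [MeasurableSpace S] (μ : SignedMeasure S) :
    ∃ h : S → ℝ, Measurable h ∧ (∀ p, |h p| = 1) ∧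
      (∀ A, MeasurableSet A → μ A = ∫ p in A, h p ∂μ.variation) ∧
      ∀ f : S → ℝ, ∫ᵛ p, f p ∂•μ = ∫ p, f p * h p ∂μ.variation := by
  classical
  obtain ⟨i, hi, hi0, hi1, hp, hn⟩ := μ.toJordanDecomposition_spec
  set j := μ.toJordanDecomposition with hj
  have hvar : μ.variation = j.posPart + j.negPart := by
    rw [← SignedMeasure.totalVariation_eq_variation]; rfl
  have hpi : j.posPart iᶜ = 0 := by
    rw [hp, SignedMeasure.toMeasureOfZeroLE_apply _ _ hi hi.compl]
    simp
  have hni : j.negPart i = 0 := by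
    rw [hn, SignedMeasure.toMeasureOfLEZero_apply _ _ hi.compl hi]
    simp
  let h : S → ℝ := fun p => if p ∈ i then 1 else -1
  have hmeas : Measurable h := Measurable.ite hi measurable_const measurable_const
  have habs : ∀ p, |h p| = 1 := fun p => by by_cases hpi : p ∈ i <;> simp [h, hpi]
  have hhp : ∀ᵐ p ∂j.posPart, h p = 1 := by
    filter_upwards [measure_eq_zero_iff_ae_notMem.1 hpi] with p hp
    simp only [mem_compl_iff, not_not] at hp
    simp [h, hp]
  have hhn : ∀ᵐ p ∂j.negPart, h p = -1 := by
    filter_upwards [measure_eq_zero_iff_ae_notMem.1 hni] with p hp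
    simp [h, hp]
  have key : ∀ f : S → ℝ, ∫ᵛ p, f p ∂•μ = ∫ p, f p * h p ∂μ.variation := by
    intro f
    by_cases hf : Integrable f μ.variation
    · have hf1 : Integrable f j.posPart := hf.mono_measure (by rw [hvar]; exact Measure.le_add_right le_rfl)
      have hf2 : Integrable f j.negPart := hf.mono_measure (by rw [hvar]; exact Measure.le_add_left le_rfl)
      have hg1 : Integrable (fun p => f p * h p) j.posPart :=
        hf1.congr (by filter_upwards [hhp] with p hp; simp [hp])
      have hg2 : Integrable (fun p => f p * h p) j.negPart :=
        hf2.neg.congr (by filter_upwards [hhn] with p hp; simp [hp])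
      rw [hvar, integral_add_measure hg1 hg2]
      have e1 : ∫ p, f p * h p ∂j.posPart = ∫ p, f p ∂j.posPart :=
        integral_congr_ae (by filter_upwards [hhp] with p hp; simp [hp])
      have e2 : ∫ p, f p * h p ∂j.negPart = - ∫ p, f p ∂j.negPart := by
        rw [← integral_neg]
        exact integral_congr_ae (by filter_upwards [hhn] with p hp; simp [hp])
      rw [e1, e2]
      have hμ : μ = j.posPart.toSignedMeasure - j.negPart.toSignedMeasure :=
        (SignedMeasure.toSignedMeasure_toJordanDecomposition μ).symm
      -- The vector-measure integral is taken along a bilinear map; over the reals scalar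
      -- multiplication is symmetric, so it equals its flip.
      have hlsmul : (ContinuousLinearMap.lsmul ℝ ℝ : ℝ →L[ℝ] ℝ →L[ℝ] ℝ)
          = (ContinuousLinearMap.lsmul ℝ ℝ).flip := by
        ext; simp
      conv_lhs => rw [hμ]
      rw [VectorMeasure.integral_sub_vectorMeasure (by simpa [VectorMeasure.Integrable] using hf1)
        (by simpa [VectorMeasure.Integrable] using hf2), hlsmul,
        VectorMeasure.integral_toSignedMeasure, VectorMeasure.integral_toSignedMeasure,
        sub_eq_add_neg]
    -- Both integrals have the default value `0` here: since `h² = 1`, integrability of `f h` would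
    -- give that of `f = (f h) h`.
    · rw [VectorMeasure.integral_undef hf, integral_undef]
      intro hfh
      apply hf
      have : f = fun p => (f p * h p) * h p := by
        ext p
        have := abs_mul_abs_self (h p)
        rw [habs] at this
        rw [mul_assoc, ← this]; ring
      rw [this]
      exact hfh.mul_bdd (c := 1) hmeas.aestronglyMeasurable (Eventually.of_forall fun p => (habs p).le)
  refine ⟨h, hmeas, habs, fun A hA => ?_, key⟩
  have hk := key (A.indicator fun _ => 1)
  have e : (fun p => A.indicator (fun _ => (1:ℝ)) p * h p) = A.indicator h := by
    ext p; by_cases hp : p ∈ A <;> simp [hp]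
  rw [e, integral_indicator hA] at hk
  rw [← hk, VectorMeasure.integral_indicator hA, VectorMeasure.integral_const]
  simp [VectorMeasure.restrict_apply _ hA]

variable {Ω : Type*} [MeasurableSpace Ω] {P : Measure Ω} {T : ℝ} {X : ℝ → Ω → ℝ}
  {μ : SignedMeasure (ℝ × ℝ)}

theorem generateFrom_Iic_prod_Iic :
    (inferInstance : MeasurableSpace (ℝ × ℝ)) =
      MeasurableSpace.generateFrom (image2 (· ×ˢ ·) (range (Iic : ℝ → Set ℝ)) (range Iic)) := by
  have hC : IsCountablySpanning (range (Iic : ℝ → Set ℝ)) :=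
    ⟨fun n : ℕ => Iic (n : ℝ), fun n => ⟨_, rfl⟩, by
      ext x; simpa using exists_nat_ge x⟩
  have hb : MeasurableSpace.generateFrom (range (Iic : ℝ → Set ℝ)) = Real.measurableSpace := by
    rw [← borel_eq_generateFrom_Iic, ← BorelSpace.measurable_eq]
  exact (generateFrom_eq_prod hb hb hC hC).symm

/-- The rectangle formula speaks only about subsets of `]0,T]²`; the carrier condition makes
everything outside negligible. -/
theorem IsCovarianceMeasure.apply_inter (hc : IsCovarianceMeasure P T X μ) {A : Set (ℝ × ℝ)}
    (hA : MeasurableSet A) : μ A = μ (A ∩ (Ioc 0 T ×ˢ Ioc 0 T)) := by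
  have hS : MeasurableSet (Ioc (0 : ℝ) T ×ˢ Ioc (0 : ℝ) T) := measurableSet_Ioc.prod measurableSet_Ioc
  have h0 : μ (A \ (Ioc 0 T ×ˢ Ioc 0 T)) = 0 := by
    have := μ.enorm_measure_le_variation (A \ (Ioc 0 T ×ˢ Ioc 0 T))
    rw [measure_mono_null (fun x hx => hx.2) hc.carrier] at this
    simpa using this
  rw [← inter_union_sdiff A (Ioc 0 T ×ˢ Ioc 0 T), VectorMeasure.of_union
    (disjoint_sdiff_inter.symm) (hA.inter hS) (hA.diff hS), h0, add_zero]
  congr 1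
  ext x; simp

/-- The covariance is symmetric, so swapping the coordinates preserves the mass of rectangles in
`]0,T]²`. Products of half-lines form a generating π-system, and each meets `]0,T]²` in such a
rectangle or not at all. -/
theorem IsCovarianceMeasure.map_swap (hc : IsCovarianceMeasure P T X μ) :
    μ.map Prod.swap = μ := by
  have hS : MeasurableSet (Ioc (0 : ℝ) T ×ˢ Ioc (0 : ℝ) T) := measurableSet_Ioc.prod measurableSet_Ioc
  have key : ∀ A B : Set ℝ, MeasurableSet A → MeasurableSet B →
      (∀ A' B' : Set ℝ, A' = A ∩ Ioc 0 T → B' = B ∩ Ioc 0 T → μ (A' ×ˢ B') = μ (B' ×ˢ A')) →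
      μ.map Prod.swap (A ×ˢ B) = μ (A ×ˢ B) := by
    intro A B hA hB h
    rw [VectorMeasure.map_apply _ measurable_swap (hA.prod hB), preimage_swap_prod,
      hc.apply_inter (hA.prod hB), hc.apply_inter (hB.prod hA), prod_inter_prod, prod_inter_prod]
    exact (h _ _ rfl rfl).symm
  refine VectorMeasure.ext_of_generateFrom _ ?_ generateFrom_Iic_prod_Iic
    (isPiSystem_Iic.prod isPiSystem_Iic) ?_
  rotate_left
  · rw [← univ_prod_univ]
    refine key _ _ .univ .univ ?_
    rintro _ _ rfl rfl
    rfl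
  · rintro _ ⟨_, ⟨b, rfl⟩, _, ⟨d, rfl⟩, rfl⟩
    refine key _ _ measurableSet_Iic measurableSet_Iic ?_
    have hI : ∀ b : ℝ, (0 ≤ min b T ∧ Iic b ∩ Ioc 0 T = Ioc 0 (min b T)) ∨
        Iic b ∩ Ioc 0 T = ∅ := by
      intro b
      rcases le_or_gt 0 (min b T) with h | h
      · left; refine ⟨h, ?_⟩
        ext x; simp only [mem_inter_iff, mem_Iic, mem_Ioc, le_min_iff]; tauto
      · right
        ext x
        simp only [mem_inter_iff, mem_Iic, mem_Ioc, mem_empty_iff_false, iff_false]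
        rintro ⟨h1, h2, h3⟩
        exact absurd (le_min h1 h3) (by linarith)
    rintro _ _ rfl rfl
    rcases hI b with ⟨hb, hb'⟩ | hb'
    · rcases hI d with ⟨hd, hd'⟩ | hd'
      · rw [hb', hd', hc.rectangle _ _ _ _ le_rfl hb (min_le_right _ _) le_rfl hd (min_le_right _ _),
          hc.rectangle _ _ _ _ le_rfl hd (min_le_right _ _) le_rfl hb (min_le_right _ _),
          covariance_comm (X (min b T)) (X (min d T)), covariance_comm (X 0) (X (min d T)),
          covariance_comm (X (min b T)) (X 0)]
        ring
      · simp [hd']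
    · simp [hb']

theorem IsCovarianceMeasure.map_swap_variation (hc : IsCovarianceMeasure P T X μ) :
    μ.variation.map Prod.swap = μ.variation := by
  have := MeasurableEmbedding.variation_map (μ := μ)
    (MeasurableEquiv.prodComm : ℝ × ℝ ≃ᵐ ℝ × ℝ).measurableEmbedding
  rw [show ⇑(MeasurableEquiv.prodComm : ℝ × ℝ ≃ᵐ ℝ × ℝ) = Prod.swap from rfl, hc.map_swap] at this
  exact this.symm

theorem measurePreserving_snd (μ : SignedMeasure (ℝ × ℝ)) :
    MeasurePreserving Prod.snd μ.variation (marginal μ) :=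
  ⟨measurable_snd, rfl⟩

/-- By symmetry the first marginal of `|μ|` is `ν` as well. This gives Cauchy–Schwarz in `L²(ν)` for
the covariance form and lets `ν`-null sets be discarded in either coordinate. -/
theorem IsCovarianceMeasure.measurePreserving_fst (hc : IsCovarianceMeasure P T X μ) :
    MeasurePreserving Prod.fst μ.variation (marginal μ) := by
  refine ⟨measurable_fst, ?_⟩
  unfold marginal
  conv_rhs => rw [← hc.map_swap_variation]
  rw [Measure.map_map measurable_snd measurable_swap]
  rfl

theorem IsCovarianceMeasure.marginal_compl (hc : IsCovarianceMeasure P T X μ) :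
    marginal μ (Ioc 0 T)ᶜ = 0 := by
  rw [marginal, Measure.map_apply measurable_snd measurableSet_Ioc.compl]
  refine measure_mono_null (fun p hp => ?_) hc.carrier
  exact fun h => hp h.2

theorem IsCovarianceMeasure.ae_marginal (hc : IsCovarianceMeasure P T X μ) :
    ∀ᵐ r ∂marginal μ, r ∈ Ioc 0 T := by
  simpa using measure_eq_zero_iff_ae_notMem.1 hc.marginal_compl

end CovMalliavin

/-! ### Gaussian integration by parts -/

namespace CovMalliavin

theorem hasDerivAt_gaussianPDFReal_zero {v : NNReal} (hv : v ≠ 0) (x : ℝ) :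
    HasDerivAt (gaussianPDFReal 0 v) (-(x / v) * gaussianPDFReal 0 v x) x := by
  have hv' : (v : ℝ) ≠ 0 := by exact_mod_cast hv
  have h1 : HasDerivAt (fun x : ℝ => -(x - 0) ^ 2 / (2 * v)) (-(x / v)) x := by
    have := ((((hasDerivAt_id x).sub_const (0:ℝ)).pow 2).neg).div_const (2 * (v:ℝ))
    refine this.congr_deriv ?_
    simp only [id, sub_zero, Nat.cast_ofNat, Nat.add_one_sub_one, pow_one, mul_one]
    field_simp
  have := (h1.exp).const_mul ((√(2 * Real.pi * v))⁻¹)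
  rw [gaussianPDFReal_def]
  refine this.congr_deriv ?_
  ring

/-- Stein's identity for a centred Gaussian measure on `ℝ`. -/
theorem stein_gaussianReal {v : NNReal} (hv : v ≠ 0) {g g' : ℝ → ℝ}
    (hg : ∀ x, HasDerivAt g (g' x) x) (i1 : Integrable g (gaussianReal 0 v))
    (i2 : Integrable (fun x => g x * x) (gaussianReal 0 v)) (i3 : Integrable g' (gaussianReal 0 v)) :
    ∫ x, g x * x ∂gaussianReal 0 v = v * ∫ x, g' x ∂gaussianReal 0 v := by
  have hv' : (v : ℝ) ≠ 0 := by exact_mod_cast hv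
  have conv : ∀ f : ℝ → ℝ, Integrable f (gaussianReal 0 v) →
      Integrable (fun x => gaussianPDFReal 0 v x * f x) := by
    intro f hf
    rw [gaussianReal_of_var_ne_zero _ hv, integrable_withDensity_iff_integrable_smul'
      (measurable_gaussianPDF 0 v) (Eventually.of_forall fun x => gaussianPDF_lt_top)] at hf
    simpa [gaussianPDF, ENNReal.toReal_ofReal (gaussianPDFReal_nonneg 0 v _)] using hf
  rw [integral_gaussianReal_eq_integral_smul hv, integral_gaussianReal_eq_integral_smul hv]
  simp only [smul_eq_mul]
  -- Integration by parts against the density, whose derivative is `-(x/v)` times itself;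
  -- integrability of all three products makes the boundary terms vanish.
  have := integral_mul_deriv_eq_deriv_mul_of_integrable (u := g) (v := gaussianPDFReal 0 v)
    (u' := g') (v' := fun x => -(x / v) * gaussianPDFReal 0 v x) (fun x _ => hg x)
    (fun x _ => hasDerivAt_gaussianPDFReal_zero hv x)
    (by
      refine ((conv _ i2).const_mul (-(v:ℝ)⁻¹)).congr (Eventually.of_forall fun x => ?_)
      simp only [Pi.mul_apply]; field_simp)
    (by
      refine (conv _ i3).congr (Eventually.of_forall fun x => ?_)
      simp only [Pi.mul_apply]; ring)
    (by
      refine (conv _ i1).congr (Eventually.of_forall fun x => ?_)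
      simp only [Pi.mul_apply]; ring)
  have e1 : ∫ x, gaussianPDFReal 0 v x * (g x * x) =
      -v * ∫ x, g x * (-(x / v) * gaussianPDFReal 0 v x) := by
    rw [← integral_const_mul]
    refine integral_congr_ae (Eventually.of_forall fun x => ?_)
    simp only; field_simp
  rw [e1, this]
  simp only [mul_neg, neg_mul, neg_neg]
  congr 2
  ext x; ring

variable {Ω : Type*} [MeasurableSpace Ω] {P : Measure Ω}

/-- Gaussian integration by parts. -/
theorem stein_hasGaussianLaw [IsProbabilityMeasure P] {E : Type*} [NormedAddCommGroup E] [NormedSpace ℝ E] [MeasurableSpace E]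
    [BorelSpace E] [SecondCountableTopology E] [CompleteSpace E] {W : Ω → E} {ξ : Ω → ℝ}
    (hG : HasGaussianLaw (fun ω => (W ω, ξ ω)) P) (hξ : ∫ ω, ξ ω ∂P = 0) {c : E}
    (hc : ∀ L : StrongDual ℝ E, cov[fun ω => L (W ω), ξ; P] = L c) {f : E → ℝ}
    (hf : ContDiff ℝ 1 f) (i1 : Integrable (fun ω => f (W ω)) P)
    (i2 : Integrable (fun ω => f (W ω) * ξ ω) P)
    (i3 : Integrable (fun ω => fderiv ℝ f (W ω) c) P) :
    ∫ ω, f (W ω) * ξ ω ∂P = ∫ ω, fderiv ℝ f (W ω) c ∂P := by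
  have hξG : HasGaussianLaw ξ P := hG.snd
  have hmap := hξG.map_eq_gaussianReal
  rw [hξ] at hmap
  set v : NNReal := (Var[ξ; P]).toNNReal with hv
  have hvar : (v : ℝ) = Var[ξ; P] := Real.coe_toNNReal _ (variance_nonneg _ _)
  -- In the degenerate case `ξ = 0` almost surely. All covariances with it vanish, and since
  -- functionals separate points `c = 0`; both sides are then zero.
  by_cases hv0 : v = 0
  · have hξ0 : ξ =ᵐ[P] 0 := by
      have h0 : Var[ξ; P] = 0 := by rw [← hvar, hv0]; rfl
      have h1 := (evariance_eq_zero_iff hξG.aemeasurable).1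
        (by rw [← ofReal_variance hξG.memLp_two, h0, ENNReal.ofReal_zero])
      filter_upwards [h1] with ω hω
      simpa [hξ] using hω
    have hc0 : c = 0 := by
      by_contra hne
      obtain ⟨L, hL⟩ := SeparatingDual.exists_eq_one (R := ℝ) hne
      have := hc L
      rw [hL, covariance_comm] at this
      have h2 : cov[ξ, fun ω => L (W ω); P] = 0 := by
        unfold covariance
        refine integral_eq_zero_of_ae ?_
        filter_upwards [hξ0] with ω hω
        simp [hω, hξ]
      linarith
    rw [hc0]
    simp only [map_zero, integral_zero]
    exact integral_eq_zero_of_ae (by filter_upwards [hξ0] with ω hω; simp [hω])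
  have hv' : (v : ℝ) ≠ 0 := by exact_mod_cast hv0
  -- The regression residual of `W` on `ξ` is uncorrelated with `ξ`, hence independent of it.
  -- Conditionally on `V` only the one-dimensional identity along the line `V + (x/v) c` is needed;
  -- the factor `1/v` from the chain rule cancels the variance.
  let V : Ω → E := fun ω => W ω - (ξ ω / v) • c
  have hVG : HasGaussianLaw (fun ω => (V ω, ξ ω)) P := by
    let A : E × ℝ →L[ℝ] E × ℝ := ((ContinuousLinearMap.fst ℝ E ℝ) -
      ((v:ℝ)⁻¹ • (ContinuousLinearMap.snd ℝ E ℝ)).smulRight c).prod (ContinuousLinearMap.snd ℝ E ℝ)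
    have := hG.map_fun A
    refine this.congr (Eventually.of_forall fun ω => ?_)
    simp [A, V, div_eq_inv_mul]
  have hind : IndepFun V ξ P := by
    refine hVG.indepFun_of_covariance_strongDual fun L₁ L₂ => ?_
    have hL2 : L₂ ∘ ξ = fun ω => L₂ 1 * ξ ω := by
      ext ω
      simp only [Function.comp]
      conv_lhs => rw [show ξ ω = ξ ω • (1:ℝ) by simp, map_smul]
      simp [mul_comm]
    have hL1 : L₁ ∘ V = (fun ω => L₁ (W ω)) - fun ω => (L₁ c / v) * ξ ω := by
      ext ω
      simp [V]; ring
    have m1 : MemLp (fun ω => L₁ (W ω)) 2 P := (hG.fst.map_fun L₁).memLp_two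
    have m2 : MemLp ξ 2 P := hξG.memLp_two
    rw [hL1, hL2, covariance_sub_left m1 (m2.const_mul _) (m2.const_mul _),
      covariance_const_mul_right, covariance_const_mul_left, covariance_const_mul_right, hc,
      covariance_self hξG.aemeasurable, ← hvar]
    field_simp
    ring
  have hprod : P.map (fun ω => (V ω, ξ ω)) = (P.map V).prod (gaussianReal 0 v) := by
    rw [← hmap]
    exact (indepFun_iff_map_prod_eq_prod_map_map hVG.fst.aemeasurable hξG.aemeasurable).1 hind
  have hVm : AEMeasurable (fun ω => (V ω, ξ ω)) P := hVG.aemeasurable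
  have hWV : ∀ ω, W ω = V ω + (ξ ω / v) • c := fun ω => by simp [V]
  have hcW : Continuous fun p : E × ℝ => p.1 + (p.2 / v) • c := by fun_prop
  have hfc : Continuous f := hf.continuous
  have hfd : Continuous fun x => fderiv ℝ f x c :=
    (hf.continuous_fderiv one_ne_zero).clm_apply continuous_const
  have _ : IsProbabilityMeasure (P.map V) := Measure.isProbabilityMeasure_map hVG.fst.aemeasurable
  have c1 : Continuous fun p : E × ℝ => f (p.1 + (p.2 / v) • c) := hfc.comp hcW
  have c2 : Continuous fun p : E × ℝ => f (p.1 + (p.2 / v) • c) * p.2 := c1.mul continuous_snd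
  have c3 : Continuous fun p : E × ℝ => fderiv ℝ f (p.1 + (p.2 / v) • c) c := hfd.comp hcW
  have j : ∀ g : E × ℝ → ℝ, Continuous g → Integrable (fun ω => g (V ω, ξ ω)) P →
      Integrable g ((P.map V).prod (gaussianReal 0 v)) := by
    intro g hg hi
    rw [← hprod]
    exact (integrable_map_measure hg.aestronglyMeasurable hVm).2 hi
  have j1 := j _ c1 (by simpa only [← hWV] using i1)
  have j2 := j _ c2 (by simpa only [← hWV] using i2)
  have j3 := j _ c3 (by simpa only [← hWV] using i3)
  have l1 : ∫ ω, f (W ω) * ξ ω ∂P =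
      ∫ p, f (p.1 + (p.2 / v) • c) * p.2 ∂((P.map V).prod (gaussianReal 0 v)) := by
    rw [← hprod, integral_map hVm c2.aestronglyMeasurable]
    simp only [← hWV]
  have l2 : ∫ ω, fderiv ℝ f (W ω) c ∂P =
      ∫ p, fderiv ℝ f (p.1 + (p.2 / v) • c) c ∂((P.map V).prod (gaussianReal 0 v)) := by
    rw [← hprod, integral_map hVm c3.aestronglyMeasurable]
    simp only [← hWV]
  rw [l1, l2, integral_prod _ j2, integral_prod _ j3]
  refine integral_congr_ae ?_
  filter_upwards [j1.prod_right_ae, j2.prod_right_ae, j3.prod_right_ae] with y k1 k2 k3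
  have hd : ∀ x : ℝ, HasDerivAt (fun x : ℝ => f (y + (x / (v : ℝ)) • c))
      ((v:ℝ)⁻¹ * fderiv ℝ f (y + (x / (v : ℝ)) • c) c) x := by
    intro x
    have h1 : HasDerivAt (fun x : ℝ => y + (x / v) • c) ((1 / (v:ℝ)) • c) x :=
      (((hasDerivAt_id x).div_const (v:ℝ)).smul_const c).const_add y
    have h2 := ((hf.differentiable one_ne_zero) (y + (x / v) • c)).hasFDerivAt.comp_hasDerivAt x h1
    refine h2.congr_deriv ?_
    simp
  have := stein_gaussianReal hv0 hd k1 k2 (k3.const_mul _)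
  rw [this, integral_const_mul]
  field_simp

end CovMalliavin

/-! ### The Gaussian space of the integrator -/

namespace CovMalliavin

variable {Ω : Type*} [MeasurableSpace Ω] {P : Measure Ω} {T : ℝ} {X : ℝ → Ω → ℝ}
  {μ : SignedMeasure (ℝ × ℝ)}

/-- The Gaussian space of `X`: the closed linear span of its values in `L²(Ω)`. -/
noncomputable def gaussSpace (P : Measure Ω) (T : ℝ) (X : ℝ → Ω → ℝ) : Submodule ℝ (Lp ℝ 2 P) :=
  (Submodule.span ℝ {f : Lp ℝ 2 P | ∃ t ∈ Icc 0 T, f =ᵐ[P] X t}).topologicalClosure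

theorem integral_norm_le_norm_Lp_two [IsProbabilityMeasure P] (f : Lp ℝ 2 P) :
    ∫ ω, ‖f ω‖ ∂P ≤ ‖f‖ := by
  have hm : MemLp f 2 P := Lp.memLp f
  rw [Lp.norm_def, integral_norm_eq_lintegral_enorm hm.aestronglyMeasurable,
    ← eLpNorm_one_eq_lintegral_enorm]
  exact ENNReal.toReal_mono hm.eLpNorm_ne_top
    (eLpNorm_le_eLpNorm_of_exponent_le (by norm_num) hm.aestronglyMeasurable)

/-- The map `x ↦ exp(itx)` is `|t|`-Lipschitz and the `L¹` norm is at most the `L²` norm. This is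
how Gaussianity passes to `L²` limits. -/
theorem continuous_charFun_Lp_two [IsProbabilityMeasure P] (t : ℝ) :
    Continuous fun f : Lp ℝ 2 P => charFun (P.map f) t := by
  have hchar : ∀ f : Lp ℝ 2 P, charFun (P.map f) t = ∫ ω, Complex.exp (t * f ω * Complex.I) ∂P := by
    intro f
    rw [charFun_apply_real, integral_map (Lp.aestronglyMeasurable f).aemeasurable
      (by fun_prop)]
  have hi : ∀ f : Lp ℝ 2 P, Integrable (fun ω => Complex.exp (t * f ω * Complex.I)) P := by
    intro f
    refine Integrable.of_bound (C := 1) ?_ (Eventually.of_forall fun ω => ?_)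
    · have : Continuous fun x : ℝ => Complex.exp (t * x * Complex.I) := by fun_prop
      exact this.comp_aestronglyMeasurable (Lp.aestronglyMeasurable f)
    · rw [← Complex.ofReal_mul, Complex.norm_exp_ofReal_mul_I]
  refine (LipschitzWith.of_dist_le_mul (K := ‖t‖₊) fun f g => ?_).continuous
  rw [hchar, hchar, dist_eq_norm, dist_eq_norm, ← integral_sub (hi f) (hi g)]
  have hfg : Integrable (fun ω => ‖(f - g) ω‖) P :=
    ((Lp.memLp (f - g)).integrable one_le_two).norm
  calc ‖∫ ω, (Complex.exp (t * f ω * Complex.I) - Complex.exp (t * g ω * Complex.I)) ∂P‖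
      ≤ ∫ ω, ‖t‖ * ‖(f - g) ω‖ ∂P := by
        refine norm_integral_le_of_norm_le (hfg.const_mul _) ?_
        filter_upwards [Lp.coeFn_sub f g] with ω hω
        rw [hω, Pi.sub_apply, ← Complex.ofReal_mul, ← Complex.ofReal_mul]
        have := Real.norm_exp_I_mul_ofReal_sub_one_le (x := t * f ω - t * g ω)
        have e : Complex.exp (↑(t * f ω) * Complex.I) - Complex.exp (↑(t * g ω) * Complex.I) =
            Complex.exp (↑(t * g ω) * Complex.I) *
              (Complex.exp (Complex.I * ↑(t * f ω - t * g ω)) - 1) := by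
          rw [mul_sub, ← Complex.exp_add]
          push_cast
          ring_nf
        rw [e, norm_mul, Complex.norm_exp_ofReal_mul_I, one_mul]
        refine this.trans (le_of_eq ?_)
        rw [← norm_mul, mul_sub]
    _ = ‖t‖ * ∫ ω, ‖(f - g) ω‖ ∂P := integral_const_mul _ _
    _ ≤ ‖t‖ * ‖f - g‖ := by gcongr; exact integral_norm_le_norm_Lp_two _

theorem norm_sq_Lp_two (f : Lp ℝ 2 P) : ‖f‖ ^ 2 = ∫ ω, f ω * f ω ∂P := by
  rw [← real_inner_self_eq_norm_sq, L2.inner_def]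
  simp [pow_two]

theorem inner_Lp_two (f g : Lp ℝ 2 P) : inner ℝ f g = ∫ ω, f ω * g ω ∂P := by
  rw [L2.inner_def]
  simp [mul_comm]

/-- Finite linear combinations of the `X_t` are centred Gaussian with variance `‖f‖²`. Stated
through characteristic functions this is a closed condition in `L²`, so it extends from the span to
its closure. -/
theorem map_eq_gaussianReal_of_mem_gaussSpace [IsProbabilityMeasure P]
    (hX : IsIntegrator P T X μ) {f : Lp ℝ 2 P} (hf : f ∈ gaussSpace P T X) :
    P.map f = gaussianReal 0 (‖f‖₊ ^ 2) := by
  have hcl : IsClosed {f : Lp ℝ 2 P | ∀ t : ℝ, charFun (P.map f) t =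
      Complex.exp (-((‖f‖ : ℂ) ^ 2 * t ^ 2 / 2))} := by
    rw [ofPred_forall]
    refine isClosed_iInter fun t => isClosed_eq (continuous_charFun_Lp_two t) ?_
    have : Continuous fun f : Lp ℝ 2 P => ((‖f‖ : ℝ) : ℂ) :=
      Complex.continuous_ofReal.comp continuous_norm
    fun_prop
  have hspan : ∀ f ∈ Submodule.span ℝ {f : Lp ℝ 2 P | ∃ t ∈ Icc 0 T, f =ᵐ[P] X t},
      ∀ t : ℝ, charFun (P.map f) t = Complex.exp (-((‖f‖ : ℂ) ^ 2 * t ^ 2 / 2)) := by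
    intro f hf t
    have hset : {f : Lp ℝ 2 P | ∃ t ∈ Icc 0 T, f =ᵐ[P] X t} =
        range fun t : Icc (0:ℝ) T => (hX.gaussian.hasGaussianLaw_eval t).memLp_two.toLp (X t) := by
      ext g
      constructor
      · rintro ⟨t, ht, h⟩
        refine ⟨⟨t, ht⟩, ?_⟩
        exact Lp.ext ((MemLp.coeFn_toLp _).trans h.symm)
      · rintro ⟨t, rfl⟩
        exact ⟨t, t.2, MemLp.coeFn_toLp _⟩
    rw [hset, Finsupp.mem_span_range_iff_exists_finsupp] at hf
    obtain ⟨c, rfl⟩ := hf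
    have hG := (hX.gaussian.smul fun t => c t).hasGaussianLaw_fun_sum (I := c.support)
    have hae : (c.sum fun i a => a • (hX.gaussian.hasGaussianLaw_eval i).memLp_two.toLp (X i) :
        Lp ℝ 2 P) =ᵐ[P] fun ω => ∑ i ∈ c.support, c i • X i ω := by
      rw [Finsupp.sum]
      refine (Lp.coeFn_finsetSum _ _).trans ?_
      have : ∀ᵐ ω ∂P, ∀ i : c.support,
          (c i • (hX.gaussian.hasGaussianLaw_eval (i : Icc (0:ℝ) T)).memLp_two.toLp (X i) : Lp ℝ 2 P) ω
            = c i • X i ω := by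
        refine ae_all_iff.2 fun i => ?_
        filter_upwards [Lp.coeFn_smul (c i)
          ((hX.gaussian.hasGaussianLaw_eval (i : Icc (0:ℝ) T)).memLp_two.toLp (X i)),
          (hX.gaussian.hasGaussianLaw_eval (i : Icc (0:ℝ) T)).memLp_two.coeFn_toLp] with ω h1 h2
        rw [h1, Pi.smul_apply, h2]
      filter_upwards [this] with ω hω
      rw [Finset.sum_apply]
      exact Finset.sum_congr rfl fun i hi => hω ⟨i, hi⟩
    set f : Lp ℝ 2 P := c.sum fun i a => a • (hX.gaussian.hasGaussianLaw_eval i).memLp_two.toLp (X i)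
      with hfdef
    have hGf : HasGaussianLaw f P := hG.congr hae.symm
    have hmean : ∫ ω, f ω ∂P = 0 := by
      rw [integral_congr_ae hae, integral_finsetSum]
      · refine Finset.sum_eq_zero fun i _ => ?_
        simp only [smul_eq_mul]
        rw [integral_const_mul, hX.mean_zero i i.2, mul_zero]
      · intro i _
        exact ((hX.gaussian.hasGaussianLaw_eval i).integrable).smul (c i)
    have hv : (Var[f; P] : ℝ) = ‖f‖ ^ 2 := by
      rw [variance_of_integral_eq_zero hGf.aemeasurable hmean, norm_sq_Lp_two]
      simp [pow_two]
    rw [hGf.map_eq_gaussianReal, charFun_gaussianReal, hmean, Real.coe_toNNReal _ (variance_nonneg _ _),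
      hv]
    simp
  have hall : ∀ t : ℝ, charFun (P.map f) t = Complex.exp (-((‖f‖ : ℂ) ^ 2 * t ^ 2 / 2)) := by
    have : closure (Submodule.span ℝ {f : Lp ℝ 2 P | ∃ t ∈ Icc 0 T, f =ᵐ[P] X t} : Set (Lp ℝ 2 P)) ⊆
        {f : Lp ℝ 2 P | ∀ t : ℝ, charFun (P.map f) t =
      Complex.exp (-((‖f‖ : ℂ) ^ 2 * t ^ 2 / 2))} := closure_minimal hspan hcl
    exact this hf
  have _ : IsProbabilityMeasure (P.map f) :=
    Measure.isProbabilityMeasure_map (Lp.aestronglyMeasurable f).aemeasurable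
  refine Measure.ext_of_charFun (funext fun t => ?_)
  rw [hall, charFun_gaussianReal]
  simp

/-- The random variable `W` belongs to the Gaussian space of `X`. -/
def InGauss (P : Measure Ω) (T : ℝ) (X : ℝ → Ω → ℝ) (W : Ω → ℝ) : Prop :=
  ∃ g ∈ gaussSpace P T X, g =ᵐ[P] W

theorem InGauss.memLp {W : Ω → ℝ} (h : InGauss P T X W) : MemLp W 2 P := by
  obtain ⟨g, -, hg⟩ := h
  exact (Lp.memLp g).ae_eq hg

theorem InGauss.add {W V : Ω → ℝ} (h : InGauss P T X W) (h' : InGauss P T X V) :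
    InGauss P T X fun ω => W ω + V ω := by
  obtain ⟨g, hg, e⟩ := h
  obtain ⟨g', hg', e'⟩ := h'
  exact ⟨g + g', add_mem hg hg', (Lp.coeFn_add g g').trans (e.add e')⟩

theorem InGauss.const_mul {W : Ω → ℝ} (h : InGauss P T X W) (c : ℝ) :
    InGauss P T X fun ω => c * W ω := by
  obtain ⟨g, hg, e⟩ := h
  refine ⟨c • g, Submodule.smul_mem _ c hg, (Lp.coeFn_smul c g).trans ?_⟩
  filter_upwards [e] with ω hω
  simp [hω]

theorem inGauss_zero : InGauss P T X fun _ => 0 :=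
  ⟨0, zero_mem _, Lp.coeFn_zero _ _ _⟩

theorem InGauss.sum {ι : Type*} (s : Finset ι) {W : ι → Ω → ℝ} (h : ∀ i, InGauss P T X (W i)) :
    InGauss P T X fun ω => ∑ i ∈ s, W i ω := by
  classical
  induction s using Finset.induction_on with
  | empty => simpa using inGauss_zero
  | insert a s ha ih => simpa [Finset.sum_insert ha] using (h a).add ih

theorem inGauss_apply (hX : IsIntegrator P T X μ) {t : ℝ} (ht : t ∈ Icc 0 T) :
    InGauss P T X (X t) := by
  refine ⟨(hX.gaussian.hasGaussianLaw_eval ⟨t, ht⟩).memLp_two.toLp (X t), ?_, MemLp.coeFn_toLp _⟩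
  exact Submodule.le_topologicalClosure _ (Submodule.subset_span ⟨t, ht, MemLp.coeFn_toLp _⟩)

theorem InGauss.map_eq [IsProbabilityMeasure P] (hX : IsIntegrator P T X μ) {W : Ω → ℝ}
    (h : InGauss P T X W) : ∃ v, P.map W = gaussianReal 0 v := by
  obtain ⟨g, hg, e⟩ := h
  exact ⟨_, (Measure.map_congr e).symm.trans (map_eq_gaussianReal_of_mem_gaussSpace hX hg)⟩

theorem InGauss.integral_eq_zero [IsProbabilityMeasure P] (hX : IsIntegrator P T X μ) {W : Ω → ℝ}
    (h : InGauss P T X W) : ∫ ω, W ω ∂P = 0 := by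
  obtain ⟨v, hv⟩ := h.map_eq hX
  have := integral_map (μ := P) (φ := W) h.memLp.aestronglyMeasurable.aemeasurable
    (f := fun x : ℝ => x) aestronglyMeasurable_id
  rw [← this, hv, integral_id_gaussianReal]

/-- All continuous linear images of the random vector `W` belong to the Gaussian space of `X`. -/
def InGaussVec {E : Type*} [NormedAddCommGroup E] [NormedSpace ℝ E] [MeasurableSpace E]
    (P : Measure Ω) (T : ℝ) (X : ℝ → Ω → ℝ) (W : Ω → E) : Prop :=
  AEMeasurable W P ∧ ∀ L : StrongDual ℝ E, InGauss P T X fun ω => L (W ω)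

/-- A vector is Gaussian as soon as all its one-dimensional images are. Joint Gaussianity thus comes
for free within the Gaussian space. -/
theorem InGaussVec.hasGaussianLaw [IsProbabilityMeasure P] {E : Type*} [NormedAddCommGroup E] [NormedSpace ℝ E]
    [MeasurableSpace E] [BorelSpace E] [SecondCountableTopology E] (hX : IsIntegrator P T X μ) {W : Ω → E}
    (h : InGaussVec P T X W) : HasGaussianLaw W P := by
  refine ⟨isGaussian_of_map_eq_gaussianReal fun L => ?_⟩
  obtain ⟨v, hv⟩ := (h.2 L).map_eq hX
  refine ⟨0, v, ?_⟩
  rw [AEMeasurable.map_map_of_aemeasurable L.continuous.measurable.aemeasurable h.1]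
  exact hv

theorem InGaussVec.prodMk {E F : Type*} [NormedAddCommGroup E] [NormedSpace ℝ E]
    [MeasurableSpace E] [NormedAddCommGroup F] [NormedSpace ℝ F] [MeasurableSpace F]
    {W : Ω → E} {V : Ω → F} (hW : InGaussVec P T X W) (hV : InGaussVec P T X V) :
    InGaussVec P T X fun ω => (W ω, V ω) := by
  refine ⟨hW.1.prodMk hV.1, fun L => ?_⟩
  have := (hW.2 (L ∘L ContinuousLinearMap.inl ℝ E F)).add (hV.2 (L ∘L ContinuousLinearMap.inr ℝ E F))
  convert this using 2 with ω
  simp [← map_add]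

theorem InGauss.vec {ξ : Ω → ℝ} (h : InGauss P T X ξ) : InGaussVec P T X ξ := by
  refine ⟨h.memLp.aestronglyMeasurable.aemeasurable, fun L => ?_⟩
  convert h.const_mul (L 1) using 2 with ω
  conv_lhs => rw [show ξ ω = ξ ω • (1:ℝ) by simp, map_smul]
  simp [mul_comm]

theorem inGaussVec_pi {n : ℕ} {W : Fin n → Ω → ℝ} (h : ∀ i, InGauss P T X (W i)) :
    InGaussVec P T X fun ω i => W i ω := by
  refine ⟨aemeasurable_pi_lambda _ fun i => (h i).memLp.aestronglyMeasurable.aemeasurable, fun L => ?_⟩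
  convert InGauss.sum Finset.univ (fun i => (h i).const_mul (L (Pi.single i 1))) using 2 with ω
  change L (fun i => W i ω) = _
  conv_lhs => rw [show (fun i => W i ω) = ∑ i, W i ω • (Pi.single i 1 : Fin n → ℝ) by
    ext j; simp [Finset.sum_apply, Pi.single_apply]]
  simp [map_sum, mul_comm]

end CovMalliavin

/-! ### The isometry for elementary divergences -/

namespace CovMalliavin

variable {Ω : Type*} [MeasurableSpace Ω] {P : Measure Ω} {T : ℝ} {X : ℝ → Ω → ℝ}
  {μ : SignedMeasure (ℝ × ℝ)}

variable {E : Type*} [NormedAddCommGroup E] [NormedSpace ℝ E]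
  {F : Type*} [NormedAddCommGroup F] [NormedSpace ℝ F]

/-- `c` is the vector of covariances of `W` with `ξ`. -/
def IsCovVec (P : Measure Ω) (W : Ω → E) (ξ : Ω → ℝ) (c : E) : Prop :=
  ∀ L : StrongDual ℝ E, ∫ ω, L (W ω) * ξ ω ∂P = L c

theorem IsCovVec.prodMk [MeasurableSpace E] [MeasurableSpace F] {W : Ω → E} {V : Ω → F} {ξ : Ω → ℝ} {c : E} {d : F}
    (hW : InGaussVec P T X W) (hV : InGaussVec P T X V) (hξ : InGauss P T X ξ)
    (hc : IsCovVec P W ξ c) (hd : IsCovVec P V ξ d) :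
    IsCovVec P (fun ω => (W ω, V ω)) ξ (c, d) := by
  intro L
  have e1 := hc (L ∘L ContinuousLinearMap.inl ℝ E F)
  have e2 := hd (L ∘L ContinuousLinearMap.inr ℝ E F)
  have hL : ∀ x y, L (x, y) = (L ∘L ContinuousLinearMap.inl ℝ E F) x +
      (L ∘L ContinuousLinearMap.inr ℝ E F) y := fun x y => by simp [← map_add]
  simp only [hL, add_mul]
  rw [integral_add, e1, e2]
  · exact (hW.2 _).memLp.integrable_mul hξ.memLp
  · exact (hV.2 _).memLp.integrable_mul hξ.memLp

theorem isCovVec_real {η ξ : Ω → ℝ} : IsCovVec P η ξ (∫ ω, η ω * ξ ω ∂P) := by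
  intro L
  have hL : ∀ x, L x = L 1 * x := fun x => by
    conv_lhs => rw [show x = x • (1:ℝ) by simp, map_smul]
    simp [mul_comm]
  rw [hL (∫ ω, η ω * ξ ω ∂P), ← integral_const_mul]
  congr 1; ext ω; rw [hL]; ring

theorem isCovVec_pi {n : ℕ} {W : Fin n → Ω → ℝ} (h : ∀ i, InGauss P T X (W i)) {ξ : Ω → ℝ}
    (hξ : InGauss P T X ξ) :
    IsCovVec P (fun ω i => W i ω) ξ fun i => ∫ ω, W i ω * ξ ω ∂P := by
  intro L
  have hL : ∀ x : Fin n → ℝ, L x = ∑ i, L (Pi.single i 1) * x i := by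
    intro x
    conv_lhs => rw [show x = ∑ i, x i • (Pi.single i 1 : Fin n → ℝ) by
      ext j; simp [Finset.sum_apply, Pi.single_apply]]
    simp [map_sum, mul_comm]
  rw [hL fun i => ∫ ω, W i ω * ξ ω ∂P]
  simp only [hL fun i => W i _, Finset.sum_mul]
  rw [integral_finsetSum]
  · refine Finset.sum_congr rfl fun i _ => ?_
    rw [← integral_const_mul]
    simp only [mul_assoc]
  · intro i _
    exact (((h i).const_mul _).memLp).integrable_mul hξ.memLp

theorem InGaussVec.stein [IsProbabilityMeasure P] [MeasurableSpace E]
    [BorelSpace E] [SecondCountableTopology E] [CompleteSpace E] (hX : IsIntegrator P T X μ) {W : Ω → E}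
    (hW : InGaussVec P T X W) {ξ : Ω → ℝ} (hξ : InGauss P T X ξ) {c : E} (hc : IsCovVec P W ξ c)
    {f : E → ℝ}
    (hf : ContDiff ℝ 1 f) (i1 : Integrable (fun ω => f (W ω)) P)
    (i2 : Integrable (fun ω => f (W ω) * ξ ω) P)
    (i3 : Integrable (fun ω => fderiv ℝ f (W ω) c) P) :
    ∫ ω, f (W ω) * ξ ω ∂P = ∫ ω, fderiv ℝ f (W ω) c ∂P := by
  refine stein_hasGaussianLaw ((hW.prodMk hξ.vec).hasGaussianLaw hX) (hξ.integral_eq_zero hX)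
    (fun L => ?_) hf i1 i2 i3
  rw [covariance_eq_sub (hW.2 L).memLp hξ.memLp, (hξ.integral_eq_zero hX), mul_zero, sub_zero]
  exact hc L

/-- `f` is of class `C²` and bounded together with its first two derivatives. -/
def IsBddC2 (f : E → ℝ) : Prop :=
  ContDiff ℝ 2 f ∧ ∃ C, ∀ x, ‖f x‖ ≤ C ∧ ‖fderiv ℝ f x‖ ≤ C ∧ ‖fderiv ℝ (fderiv ℝ f) x‖ ≤ C

theorem IsCbInfty.isBddC2 {n : ℕ} {f : (Fin n → ℝ) → ℝ} (hf : IsCbInfty f) : IsBddC2 f := by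
  obtain ⟨C0, h0⟩ := hf.2 0
  obtain ⟨C1, h1⟩ := hf.2 1
  obtain ⟨C2, h2⟩ := hf.2 2
  refine ⟨hf.1.of_le (WithTop.coe_le_coe.2 (le_top : (2 : ℕ∞) ≤ ⊤)), max C0 (max C1 C2), fun x => ⟨?_, ?_, ?_⟩⟩
  · rw [← norm_iteratedFDeriv_zero (𝕜 := ℝ)]
    exact (h0 x).trans (le_max_left _ _)
  · rw [← norm_iteratedFDeriv_one]
    exact (h1 x).trans ((le_max_left _ _).trans (le_max_right _ _))
  · rw [← norm_iteratedFDeriv_one, norm_iteratedFDeriv_fderiv]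
    exact (h2 x).trans ((le_max_right _ _).trans (le_max_right _ _))

theorem IsBddC2.hasFDerivAt {f : E → ℝ} (hf : IsBddC2 f) (x : E) :
    HasFDerivAt f (fderiv ℝ f x) x :=
  (hf.1.differentiable two_ne_zero x).hasFDerivAt

theorem IsBddC2.contDiff_fderiv_apply {f : E → ℝ} (hf : IsBddC2 f) (c : E) :
    ContDiff ℝ 1 fun x => fderiv ℝ f x c :=
  (hf.1.fderiv_right (m := 1) (by norm_num)).clm_apply contDiff_const

theorem IsBddC2.hasFDerivAt_fderiv_apply {f : E → ℝ} (hf : IsBddC2 f) (c : E) (x : E) :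
    HasFDerivAt (fun x => fderiv ℝ f x c) ((fderiv ℝ (fderiv ℝ f) x).flip c) x := by
  have h : DifferentiableAt ℝ (fderiv ℝ f) x :=
    (hf.1.fderiv_right (m := 1) (by norm_num)).differentiable one_ne_zero x
  have := (ContinuousLinearMap.apply ℝ ℝ c).hasFDerivAt.comp x h.hasFDerivAt
  refine this.congr_fderiv ?_
  ext d
  simp

theorem IsBddC2.symm {f : E → ℝ} (hf : IsBddC2 f) (x c d : E) :
    fderiv ℝ (fderiv ℝ f) x c d = fderiv ℝ (fderiv ℝ f) x d c :=
  (hf.1.contDiffAt.isSymmSndFDerivAt (by simp)) c d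

theorem IsBddC2.continuous_snd {f : E → ℝ} (hf : IsBddC2 f) (c d : E) :
    Continuous fun x => fderiv ℝ (fderiv ℝ f) x c d :=
  ((((hf.1.fderiv_right (m := 1) (by norm_num)).continuous_fderiv one_ne_zero).clm_apply
    continuous_const).clm_apply continuous_const)

theorem integral_add_add {S : Type*} [MeasurableSpace S] {θ : Measure S} {f g h : S → ℝ}
    (hf : Integrable f θ) (hg : Integrable g θ) (hh : Integrable h θ) :
    ∫ x, (f x + g x + h x) ∂θ = ∫ x, f x ∂θ + ∫ x, g x ∂θ + ∫ x, h x ∂θ := by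
  have := integral_add (hf.add hg) hh
  rw [integral_add' hf hg] at this
  exact this

theorem integral_sub_sub_add {S : Type*} [MeasurableSpace S] {θ : Measure S} {f g h k : S → ℝ}
    (hf : Integrable f θ) (hg : Integrable g θ) (hh : Integrable h θ) (hk : Integrable k θ) :
    ∫ x, (f x - g x - h x + k x) ∂θ = ∫ x, f x ∂θ - ∫ x, g x ∂θ - ∫ x, h x ∂θ + ∫ x, k x ∂θ := by
  have := integral_add ((hf.sub hg).sub hh) hk
  rw [integral_sub' (hf.sub hg) hh, integral_sub' hf hg] at this
  exact this

section Bounded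

/-- A bounded measurable random variable. -/
def IsBddRV (P : Measure Ω) (A : Ω → ℝ) : Prop := MemLp A ∞ P

theorem IsBddRV.of_comp {E : Type*} [TopologicalSpace E] [MeasurableSpace E]
    [OpensMeasurableSpace E] {W : Ω → E}
    (hW : AEMeasurable W P) {f : E → ℝ} (hf : Continuous f) {C : ℝ} (hC : ∀ x, ‖f x‖ ≤ C) :
    IsBddRV P fun ω => f (W ω) :=
  memLp_top_of_bound (hf.measurable.comp_aemeasurable hW).aestronglyMeasurable C
    (Eventually.of_forall fun _ => hC _)

theorem IsBddRV.mul {A B : Ω → ℝ} (hA : IsBddRV P A) (hB : IsBddRV P B) :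
    IsBddRV P fun ω => A ω * B ω := MemLp.mul hB hA

theorem IsBddRV.memLp_mul {A B : Ω → ℝ} (hA : IsBddRV P A) (hB : MemLp B 2 P) :
    MemLp (fun ω => A ω * B ω) 2 P := MemLp.mul hB hA

theorem IsBddRV.memLp_two [IsFiniteMeasure P] {A : Ω → ℝ} (hA : IsBddRV P A) : MemLp A 2 P :=
  MemLp.mono_exponent hA le_top

theorem IsBddRV.integrable [IsFiniteMeasure P] {A : Ω → ℝ} (hA : IsBddRV P A) : Integrable A P :=
  hA.memLp_two.integrable one_le_two

theorem IsBddC2.bdd [MeasurableSpace E] [OpensMeasurableSpace E] {f : E → ℝ} (hf : IsBddC2 f)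
    {W : Ω → E} (hW : AEMeasurable W P) : IsBddRV P fun ω => f (W ω) := by
  obtain ⟨C, hC⟩ := hf.2
  exact .of_comp hW hf.1.continuous fun x => (hC x).1

theorem IsBddC2.bdd_fderiv [MeasurableSpace E] [OpensMeasurableSpace E] {f : E → ℝ} (hf : IsBddC2 f)
    {W : Ω → E} (hW : AEMeasurable W P) (c : E) : IsBddRV P fun ω => fderiv ℝ f (W ω) c := by
  obtain ⟨C, hC⟩ := hf.2
  refine .of_comp (f := fun x => fderiv ℝ f x c) hW (hf.contDiff_fderiv_apply c).continuous
    (C := C * ‖c‖) fun x => ?_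
  exact ((fderiv ℝ f x).le_opNorm c).trans (by gcongr; exact (hC x).2.1)

theorem IsBddC2.bdd_snd [MeasurableSpace E] [OpensMeasurableSpace E] {f : E → ℝ} (hf : IsBddC2 f)
    {W : Ω → E} (hW : AEMeasurable W P) (c d : E) :
    IsBddRV P fun ω => fderiv ℝ (fderiv ℝ f) (W ω) c d := by
  obtain ⟨C, hC⟩ := hf.2
  refine .of_comp (f := fun x => fderiv ℝ (fderiv ℝ f) x c d) hW (hf.continuous_snd c d)
    (C := C * ‖c‖ * ‖d‖) fun x => ?_
  refine ((fderiv ℝ (fderiv ℝ f) x).le_opNorm₂ c d).trans ?_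
  gcongr
  exact (hC x).2.2

end Bounded

section Moments

variable [MeasurableSpace E] [BorelSpace E] [SecondCountableTopology E] [CompleteSpace E]
  [MeasurableSpace F] [BorelSpace F] [SecondCountableTopology F] [CompleteSpace F]
  [IsProbabilityMeasure P]

theorem integral_mul_mul_gauss (hX : IsIntegrator P T X μ) {f : E → ℝ} {g : F → ℝ}
    (hf : IsBddC2 f) (hg : IsBddC2 g) {W : Ω → E} {V : Ω → F} (hW : InGaussVec P T X W)
    (hV : InGaussVec P T X V) {ξ : Ω → ℝ} (hξ : InGauss P T X ξ) {c : E} {d : F}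
    (hc : IsCovVec P W ξ c) (hd : IsCovVec P V ξ d) :
    ∫ ω, f (W ω) * g (V ω) * ξ ω ∂P =
      ∫ ω, fderiv ℝ f (W ω) c * g (V ω) ∂P + ∫ ω, f (W ω) * fderiv ℝ g (V ω) d ∂P := by
  have bf := hf.bdd hW.1
  have bg := hg.bdd hV.1
  have bf' := hf.bdd_fderiv hW.1 c
  have bg' := hg.bdd_fderiv hV.1 d
  have hder : ∀ x y, fderiv ℝ (fun p : E × F => f p.1 * g p.2) (x, y) (c, d) =
      fderiv ℝ f x c * g y + f x * fderiv ℝ g y d := by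
    intro x y
    have h1 := (hf.hasFDerivAt x).comp (x, y) (hasFDerivAt_fst (𝕜 := ℝ) (E := E) (F := F) (p := (x, y)))
    have h2 := (hg.hasFDerivAt y).comp (x, y) (hasFDerivAt_snd (𝕜 := ℝ) (E := E) (F := F) (p := (x, y)))
    have h3 := (h1.mul h2).fderiv
    simp only [Function.comp_def] at h3
    erw [h3]
    simp
    ring
  have := InGaussVec.stein hX (hW.prodMk hV) hξ (hc.prodMk hW hV hξ hd)
    (f := fun p : E × F => f p.1 * g p.2)
    (((hf.1.of_le one_le_two).comp contDiff_fst).mul ((hg.1.of_le one_le_two).comp contDiff_snd))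
    (bf.mul bg).integrable ((bf.mul bg).memLp_two.integrable_mul hξ.memLp)
    (by
      simp only [hder]
      exact (bf'.mul bg).integrable.add (bf.mul bg').integrable)
  simp only [hder] at this
  rw [this, integral_add (bf'.mul bg).integrable (bf.mul bg').integrable]

/-- Here `η` is adjoined to the vector as one more Gaussian coordinate, entering the test function
linearly. The derivative in the direction of `ξ` therefore also hits `η` and leaves the factor
`E[ηξ]`. -/
theorem integral_mul_mul_mul_gauss (hX : IsIntegrator P T X μ) {f : E → ℝ} {g : F → ℝ}
    (hf : IsBddC2 f) (hg : IsBddC2 g) {W : Ω → E} {V : Ω → F} (hW : InGaussVec P T X W)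
    (hV : InGaussVec P T X V) {ξ η : Ω → ℝ} (hξ : InGauss P T X ξ) (hη : InGauss P T X η)
    {c : E} {d : F}
    (hc : IsCovVec P W ξ c) (hd : IsCovVec P V ξ d) :
    ∫ ω, f (W ω) * g (V ω) * η ω * ξ ω ∂P =
      ∫ ω, fderiv ℝ f (W ω) c * g (V ω) * η ω ∂P + ∫ ω, f (W ω) * fderiv ℝ g (V ω) d * η ω ∂P
        + (∫ ω, f (W ω) * g (V ω) ∂P) * ∫ ω, η ω * ξ ω ∂P := by
  have bf := hf.bdd hW.1
  have bg := hg.bdd hV.1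
  have bf' := hf.bdd_fderiv hW.1 c
  have bg' := hg.bdd_fderiv hV.1 d
  set e := ∫ ω, η ω * ξ ω ∂P
  have hder : ∀ x y z, fderiv ℝ (fun p : (E × F) × ℝ => f p.1.1 * g p.1.2 * p.2) ((x, y), z) ((c, d), e) =
      fderiv ℝ f x c * g y * z + f x * fderiv ℝ g y d * z + f x * g y * e := by
    intro x y z
    have h0 := hasFDerivAt_fst (𝕜 := ℝ) (E := E × F) (F := ℝ) (p := ((x, y), z))
    have h1 := (hf.hasFDerivAt x).comp ((x, y), z)
      ((hasFDerivAt_fst (𝕜 := ℝ) (E := E) (F := F) (p := (x, y))).comp ((x, y), z) h0)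
    have h2 := (hg.hasFDerivAt y).comp ((x, y), z)
      ((hasFDerivAt_snd (𝕜 := ℝ) (E := E) (F := F) (p := (x, y))).comp ((x, y), z) h0)
    have h3 := ((h1.mul h2).mul
      (hasFDerivAt_snd (𝕜 := ℝ) (E := E × F) (F := ℝ) (p := ((x, y), z)))).fderiv
    simp only [Function.comp_def] at h3
    erw [h3]
    simp
    ring
  have i1 : Integrable (fun ω => fderiv ℝ f (W ω) c * g (V ω) * η ω) P :=
    (bf'.mul bg).memLp_two.integrable_mul hη.memLp
  have i2 : Integrable (fun ω => f (W ω) * fderiv ℝ g (V ω) d * η ω) P :=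
    (bf.mul bg').memLp_two.integrable_mul hη.memLp
  have i3 : Integrable (fun ω => f (W ω) * g (V ω) * e) P := (bf.mul bg).integrable.mul_const e
  have := InGaussVec.stein hX ((hW.prodMk hV).prodMk hη.vec) hξ
    ((hc.prodMk hW hV hξ hd).prodMk (hW.prodMk hV) hη.vec hξ isCovVec_real)
    (f := fun p : (E × F) × ℝ => f p.1.1 * g p.1.2 * p.2)
    ((((hf.1.of_le one_le_two).comp (contDiff_fst.comp contDiff_fst)).mul
      ((hg.1.of_le one_le_two).comp (contDiff_snd.comp contDiff_fst))).mul contDiff_snd)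
    ((bf.mul bg).memLp_two.integrable_mul hη.memLp)
    (((bf.mul bg).memLp_mul hη.memLp).integrable_mul hξ.memLp)
    (by
      simp only [e, hder]
      exact (i1.add i2).add i3)
  simp only [e, hder] at this
  rw [this, integral_add_add i1 i2 i3, integral_mul_const]

/-- Expand the product and integrate by parts, first in `ξ`, then in the remaining `η`. The terms in
which `ξ` differentiates `f` cancel against the subtracted derivatives, and the two terms with
second derivatives of `g` cancel by symmetry. What remains pairs each derivative with the direction
of the other divergence. -/
theorem integral_divergence_mul_divergence (hX : IsIntegrator P T X μ) {f : E → ℝ} {g : F → ℝ}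
    (hf : IsBddC2 f) (hg : IsBddC2 g) {W : Ω → E} {V : Ω → F} (hW : InGaussVec P T X W)
    (hV : InGaussVec P T X V) {ξ η : Ω → ℝ} (hξ : InGauss P T X ξ) (hη : InGauss P T X η)
    {c c' : E} {d d' : F} (hc : IsCovVec P W ξ c) (hc' : IsCovVec P W η c')
    (hd : IsCovVec P V ξ d) (hd' : IsCovVec P V η d') :
    ∫ ω, (f (W ω) * ξ ω - fderiv ℝ f (W ω) c) * (g (V ω) * η ω - fderiv ℝ g (V ω) d') ∂P =
      (∫ ω, f (W ω) * g (V ω) ∂P) * (∫ ω, η ω * ξ ω ∂P) +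
        ∫ ω, fderiv ℝ f (W ω) c' * fderiv ℝ g (V ω) d ∂P := by
  have bf := hf.bdd hW.1
  have bg := hg.bdd hV.1
  have bfc := hf.bdd_fderiv hW.1 c
  have bfc' := hf.bdd_fderiv hW.1 c'
  have bgd := hg.bdd_fderiv hV.1 d
  have bgd' := hg.bdd_fderiv hV.1 d'
  -- Used twice: to remove `η` next to the derivative of `g` along `d`, and `ξ` next to its
  -- derivative along `d'`.
  have key : ∀ {ζ : Ω → ℝ} (hζ : InGauss P T X ζ) {a : E} {b : F} (_ : IsCovVec P W ζ a)
      (_ : IsCovVec P V ζ b) (b' : F), ∫ ω, f (W ω) * fderiv ℝ g (V ω) b' * ζ ω ∂P =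
      ∫ ω, fderiv ℝ f (W ω) a * fderiv ℝ g (V ω) b' ∂P +
        ∫ ω, f (W ω) * fderiv ℝ (fderiv ℝ g) (V ω) b b' ∂P := by
    intro ζ hζ a b ha hb b'
    have bfa := hf.bdd_fderiv hW.1 a
    have bgb' := hg.bdd_fderiv hV.1 b'
    have bg2 := hg.bdd_snd hV.1 b b'
    have hder : ∀ x y, fderiv ℝ (fun p : E × F => f p.1 * fderiv ℝ g p.2 b') (x, y) (a, b) =
        fderiv ℝ f x a * fderiv ℝ g y b' + f x * fderiv ℝ (fderiv ℝ g) y b b' := by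
      intro x y
      have h1 := (hf.hasFDerivAt x).comp (x, y)
        (hasFDerivAt_fst (𝕜 := ℝ) (E := E) (F := F) (p := (x, y)))
      have h2 := (hg.hasFDerivAt_fderiv_apply b' y).comp (x, y)
        (hasFDerivAt_snd (𝕜 := ℝ) (E := E) (F := F) (p := (x, y)))
      have h3 := (h1.mul h2).fderiv
      simp only [Function.comp_def] at h3
      erw [h3]
      simp
      ring
    have := InGaussVec.stein hX (hW.prodMk hV) hζ (ha.prodMk hW hV hζ hb)
      (f := fun p : E × F => f p.1 * fderiv ℝ g p.2 b')
      (((hf.1.of_le one_le_two).comp contDiff_fst).mul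
        ((hg.contDiff_fderiv_apply b').comp contDiff_snd))
      (bf.mul bgb').integrable ((bf.mul bgb').memLp_two.integrable_mul hζ.memLp)
      (by
        simp only [hder]
        exact (bfa.mul bgb').integrable.add (bf.mul bg2).integrable)
    simp only [hder] at this
    rw [this, integral_add (bfa.mul bgb').integrable (bf.mul bg2).integrable]
  have k1 := key hη hc' hd' d
  have k2 := key hξ hc hd d'
  have k3 := integral_mul_mul_mul_gauss hX hf hg hW hV hξ hη hc hd
  have i1 : Integrable (fun ω => f (W ω) * g (V ω) * η ω * ξ ω) P :=
    ((bf.mul bg).memLp_mul hη.memLp).integrable_mul hξ.memLp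
  have i2 : Integrable (fun ω => f (W ω) * fderiv ℝ g (V ω) d' * ξ ω) P :=
    (bf.mul bgd').memLp_two.integrable_mul hξ.memLp
  have i3 : Integrable (fun ω => fderiv ℝ f (W ω) c * g (V ω) * η ω) P :=
    (bfc.mul bg).memLp_two.integrable_mul hη.memLp
  have i4 : Integrable (fun ω => fderiv ℝ f (W ω) c * fderiv ℝ g (V ω) d') P :=
    (bfc.mul bgd').integrable
  have e : ∀ ω, (f (W ω) * ξ ω - fderiv ℝ f (W ω) c) * (g (V ω) * η ω - fderiv ℝ g (V ω) d') =
      f (W ω) * g (V ω) * η ω * ξ ω - f (W ω) * fderiv ℝ g (V ω) d' * ξ ω -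
        fderiv ℝ f (W ω) c * g (V ω) * η ω + fderiv ℝ f (W ω) c * fderiv ℝ g (V ω) d' :=
    fun ω => by ring
  simp only [e]
  rw [integral_sub_sub_add i1 i2 i3 i4, k3, k2, k1]
  have hs : ∀ ω, fderiv ℝ (fderiv ℝ g) (V ω) d' d = fderiv ℝ (fderiv ℝ g) (V ω) d d' :=
    fun ω => hg.symm _ _ _
  simp only [hs]
  ring

end Moments

end CovMalliavin

/-! ### The Wiener integral on `L²(ν)` -/

namespace CovMalliavin

variable {Ω : Type*} [MeasurableSpace Ω] {P : Measure Ω} {T : ℝ} {X : ℝ → Ω → ℝ}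
  {μ : SignedMeasure (ℝ × ℝ)}

/-- `h` is the density of `μ` with respect to its variation. -/
structure IsPolarDensity (μ : SignedMeasure (ℝ × ℝ)) (h : ℝ × ℝ → ℝ) : Prop where
  measurable : Measurable h
  abs_eq : ∀ p, |h p| = 1
  apply_eq : ∀ A, MeasurableSet A → μ A = ∫ p in A, h p ∂μ.variation
  integral_eq : ∀ f : ℝ × ℝ → ℝ, ∫ᵛ p, f p ∂•μ = ∫ p, f p * h p ∂μ.variation

/-- The indicator function of `]0, τ]`. -/
noncomputable def stepFn (τ : ℝ) : ℝ → ℝ := (Ioc 0 τ).indicator fun _ => (1 : ℝ)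

theorem measurable_stepFn (τ : ℝ) : Measurable (stepFn τ) :=
  measurable_const.indicator measurableSet_Ioc

theorem memLp_of_bounded {S : Type*} [MeasurableSpace S] {θ : Measure S} [IsFiniteMeasure θ]
    {g : S → ℝ} (hg : Measurable g) {C : ℝ} (hC : ∀ x, |g x| ≤ C) {p : ℝ≥0∞} : MemLp g p θ :=
  MemLp.of_bound hg.aestronglyMeasurable C (Eventually.of_forall hC)

theorem memLp_stepFn (μ : SignedMeasure (ℝ × ℝ)) (τ : ℝ) : MemLp (stepFn τ) 2 (marginal μ) :=
  memLp_of_bounded (measurable_stepFn τ) (C := 1) fun x => by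
    by_cases hx : x ∈ Ioc 0 τ <;> simp [stepFn, hx]

/-- `Φ` is the Wiener integral on `L²(ν)`. -/
structure IsWienerMap (P : Measure Ω) (T : ℝ) (X : ℝ → Ω → ℝ) (μ : SignedMeasure (ℝ × ℝ))
    (h : ℝ × ℝ → ℝ) (Φ : Lp ℝ 2 (marginal μ) →L[ℝ] Lp ℝ 2 P) : Prop where
  inner_eq : ∀ g g', inner ℝ (Φ g) (Φ g') = ∫ p, g p.1 * g' p.2 * h p ∂μ.variation
  step : ∀ τ ∈ Icc 0 T, Φ ((memLp_stepFn μ τ).toLp _) =ᵐ[P] X τ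
  mem : ∀ g, Φ g ∈ gaussSpace P T X

/-- This is density of step functions in dual form: the signed measure with density `v` vanishes on
the π-system of half-lines, hence everywhere. -/
theorem ae_eq_zero_of_integral_stepFn (hc : IsCovarianceMeasure P T X μ) (hT : 0 < T)
    {v : ℝ → ℝ} (hv : Integrable v (marginal μ))
    (h0 : ∀ τ ∈ Icc 0 T, ∫ r in Ioc 0 τ, v r ∂marginal μ = 0) : v =ᵐ[marginal μ] 0 := by
  have hS : ∀ A : Set ℝ, MeasurableSet A →
      ∫ r in A, v r ∂marginal μ = ∫ r in A ∩ Ioc 0 T, v r ∂marginal μ := by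
    intro A hA
    refine setIntegral_congr_set ?_
    filter_upwards [hc.ae_marginal] with r hr
    simp only [eq_iff_iff]
    exact ⟨fun h => ⟨h, hr⟩, fun h => h.1⟩
  have : (marginal μ).withDensityᵥ v = (marginal μ).withDensityᵥ (0 : ℝ → ℝ) := by
    refine VectorMeasure.ext_of_generateFrom (range Iic) ?_
      ((BorelSpace.measurable_eq (α := ℝ)).trans (borel_eq_generateFrom_Iic ℝ)) isPiSystem_Iic ?_
    · rintro _ ⟨b, rfl⟩
      rw [withDensityᵥ_apply hv measurableSet_Iic, hS _ measurableSet_Iic]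
      simp only [withDensityᵥ_zero, FunLike.coe_zero, Pi.zero_apply]
      rcases le_or_gt 0 (min b T) with h | h
      · refine Eq.trans ?_ (h0 (min b T) ⟨h, min_le_right _ _⟩)
        congr 2
        ext x; simp only [mem_inter_iff, mem_Iic, mem_Ioc, le_min_iff]; tauto
      · have : Iic b ∩ Ioc 0 T = ∅ := by
          ext x
          simp only [mem_inter_iff, mem_Iic, mem_Ioc, mem_empty_iff_false, iff_false]
          rintro ⟨h1, h2, h3⟩
          exact absurd (le_min h1 h3) (by linarith)
        rw [this]; simp
    · rw [withDensityᵥ_apply hv .univ, hS _ .univ, univ_inter, h0 T ⟨hT.le, le_rfl⟩]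
      simp
  exact hv.ae_eq_of_withDensityᵥ_eq (integrable_zero _ _ _) this

/-- The covariance form of `X` as a bounded bilinear form on `L²(ν)`. -/
theorem exists_bilin (hc : IsCovarianceMeasure P T X μ) {h : ℝ × ℝ → ℝ} (hh : IsPolarDensity μ h) :
    ∃ B : Lp ℝ 2 (marginal μ) →L[ℝ] Lp ℝ 2 (marginal μ) →L[ℝ] ℝ,
      ∀ g g', B g g' = ∫ p, g p.1 * g' p.2 * h p ∂μ.variation := by
  have hL : MemLp h ∞ μ.variation :=
    memLp_of_bounded hh.measurable fun p => (hh.abs_eq p).le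
  -- Pulling a function back along either coordinate is an isometry from `L²(ν)` into `L²(|μ|)`,
  -- because both marginals are `ν`. The form is the inner product of the two pullbacks, one of them
  -- multiplied by the bounded `h`.
  let A1 := (Lp.compMeasurePreservingₗᵢ ℝ (E := ℝ) (p := 2) Prod.fst hc.measurePreserving_fst).toContinuousLinearMap
  let A2 := (Lp.compMeasurePreservingₗᵢ ℝ (E := ℝ) (p := 2) Prod.snd (measurePreserving_snd μ)).toContinuousLinearMap
  let M : Lp ℝ 2 μ.variation →L[ℝ] Lp ℝ 2 μ.variation :=
    (ContinuousLinearMap.mul ℝ ℝ).holderL μ.variation ∞ 2 2 (hL.toLp h)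
  refine ⟨(innerSL ℝ).bilinearComp A1 (M ∘L A2), fun g g' => ?_⟩
  have e : ((innerSL ℝ).bilinearComp A1 (M ∘L A2)) g g' = inner ℝ (A1 g) (M (A2 g')) := rfl
  rw [e, L2.inner_def]
  refine integral_congr_ae ?_
  have a1 : (A1 g : ℝ × ℝ → ℝ) =ᵐ[μ.variation] fun p => g p.1 :=
    Lp.coeFn_compMeasurePreserving g hc.measurePreserving_fst
  have a2 : (A2 g' : ℝ × ℝ → ℝ) =ᵐ[μ.variation] fun p => g' p.2 :=
    Lp.coeFn_compMeasurePreserving g' (measurePreserving_snd μ)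
  have a3 : (M (A2 g') : ℝ × ℝ → ℝ) =ᵐ[μ.variation] _ :=
    (ContinuousLinearMap.mul ℝ ℝ).coeFn_holder (r := 2) (hL.toLp h) (A2 g')
  filter_upwards [a1, a2, a3, hL.coeFn_toLp] with p h1 h2 h3 h4
  rw [h1, h3, h2, h4]
  simp
  ring

/-- Since `X_0 = 0` almost surely, three of the four covariances in the rectangle formula on `]0,τ]
× ]0,τ']` vanish. -/
theorem integral_mul_eq_apply (hX : IsIntegrator P T X μ) {h : ℝ × ℝ → ℝ} [IsProbabilityMeasure P]
    (hh : IsPolarDensity μ h) {τ τ' : ℝ} (hτ : τ ∈ Icc 0 T) (hτ' : τ' ∈ Icc 0 T) :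
    ∫ ω, X τ ω * X τ' ω ∂P = ∫ p, stepFn τ p.1 * stepFn τ' p.2 * h p ∂μ.variation := by
  have hm := fun t (ht : t ∈ Icc 0 T) => (inGauss_apply hX ht).memLp
  have hrect := hX.covariance.rectangle 0 τ 0 τ' le_rfl hτ.1 hτ.2 le_rfl hτ'.1 hτ'.2
  have h0 : (0 : ℝ) ∈ Icc 0 T := ⟨le_rfl, hτ.1.trans hτ.2⟩
  have z1 : ∀ Z : Ω → ℝ, cov[X 0, Z; P] = 0 := by
    intro Z
    unfold covariance
    refine integral_eq_zero_of_ae ?_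
    filter_upwards [hX.start_zero] with ω hω
    simp [hω, hX.mean_zero 0 h0]
  rw [z1, z1, covariance_comm (X τ) (X 0), z1, covariance_eq_sub (hm τ hτ) (hm τ' hτ'),
    hX.mean_zero τ hτ, hh.apply_eq _ (measurableSet_Ioc.prod measurableSet_Ioc),
    ← integral_indicator (measurableSet_Ioc.prod measurableSet_Ioc)] at hrect
  have e : (Ioc 0 τ ×ˢ Ioc 0 τ').indicator h = fun p => stepFn τ p.1 * stepFn τ' p.2 * h p := by
    ext p
    by_cases h1 : p.1 ∈ Ioc 0 τ <;> by_cases h2 : p.2 ∈ Ioc 0 τ' <;>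
      simp [stepFn, h1, h2, indicator, mem_prod]
  rw [e] at hrect
  simp only [zero_mul, sub_zero, add_zero] at hrect
  rw [hrect]
  rfl

/-- Sending `1_{]0,τ]}` to `X_τ` turns the covariance form into the inner product of `L²(Ω)`. The
form is bounded on `L²(ν)` and step functions are dense there, so the map extends continuously. -/
theorem exists_isWienerMap [IsProbabilityMeasure P] (hT : 0 < T) (hX : IsIntegrator P T X μ)
    {h : ℝ × ℝ → ℝ} (hh : IsPolarDensity μ h) :
    ∃ Φ : Lp ℝ 2 (marginal μ) →L[ℝ] Lp ℝ 2 P, IsWienerMap P T X μ h Φ := by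
  obtain ⟨B, hB⟩ := exists_bilin hX.covariance hh
  have hm := fun t : Icc (0 : ℝ) T => (inGauss_apply hX t.2).memLp
  let x : Icc (0 : ℝ) T → Lp ℝ 2 P := fun t => (hm t).toLp _
  let e : Icc (0 : ℝ) T → Lp ℝ 2 (marginal μ) := fun t => (memLp_stepFn μ t).toLp _
  let lx := Finsupp.linearCombination ℝ x
  let le := Finsupp.linearCombination ℝ e
  have hbase : ∀ s t, inner ℝ (x s) (x t) = B (e s) (e t) := by
    intro s t
    rw [inner_Lp_two, hB]
    have := integral_mul_eq_apply hX hh s.2 t.2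
    convert this using 1
    · refine integral_congr_ae ?_
      filter_upwards [(hm s).coeFn_toLp, (hm t).coeFn_toLp] with ω h1 h2
      simp only [x]
      rw [h1, h2]
    · refine integral_congr_ae ?_
      filter_upwards [hX.covariance.measurePreserving_fst.quasiMeasurePreserving.ae_eq_comp
        (memLp_stepFn μ s).coeFn_toLp, (measurePreserving_snd μ).quasiMeasurePreserving.ae_eq_comp
        (memLp_stepFn μ t).coeFn_toLp] with p h1 h2
      simp only [Function.comp] at h1 h2
      simp only [e]
      rw [h1, h2]
  have hbil : ∀ c c', inner ℝ (lx c) (lx c') = B (le c) (le c') := by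
    intro c c'
    induction c using Finsupp.induction_linear with
    | zero => simp
    | add f g hf hg => simp only [map_add, inner_add_left, hf, hg, add_apply]
    | single s a =>
      induction c' using Finsupp.induction_linear with
      | zero => simp
      | add f g hf hg => simp only [map_add, inner_add_right, hf, hg]
      | single t b =>
        simp only [lx, le, Finsupp.linearCombination_single, inner_smul_left, inner_smul_right,
          hbase, map_smul, smul_apply, smul_eq_mul]
        simp
  -- This bound also gives well-definedness: step functions may be linearly dependent in `L²(ν)`,
  -- and a combination that vanishes there must have vanishing image.
  have hnorm : ∃ C, ∀ c, ‖lx c‖ ≤ C * ‖le c‖ := by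
    refine ⟨√‖B‖, fun c => ?_⟩
    have h1 : ‖lx c‖ ^ 2 ≤ (√‖B‖ * ‖le c‖) ^ 2 := by
      have hsq : √‖B‖ ^ 2 = ‖B‖ := Real.sq_sqrt B.opNorm_nonneg
      rw [← real_inner_self_eq_norm_sq, hbil, mul_pow, hsq, pow_two, ← mul_assoc]
      exact (le_abs_self _).trans (B.le_opNorm₂ _ _)
    exact le_of_sq_le_sq h1 (by positivity)
  have hdense : DenseRange le := by
    have htop : (LinearMap.range le).topologicalClosure = ⊤ := by
      rw [Submodule.topologicalClosure_eq_top_iff, Submodule.eq_bot_iff]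
      intro v hv
      rw [Submodule.mem_orthogonal] at hv
      have hv0 : (v : ℝ → ℝ) =ᵐ[marginal μ] 0 := by
        refine ae_eq_zero_of_integral_stepFn hX.covariance hT
          ((Lp.memLp v).integrable one_le_two) fun τ hτ => ?_
        have := hv (le (Finsupp.single ⟨τ, hτ⟩ 1)) ⟨_, rfl⟩
        rw [inner_Lp_two] at this
        refine Eq.trans ?_ this
        rw [← integral_indicator measurableSet_Ioc]
        refine integral_congr_ae ?_
        filter_upwards [(memLp_stepFn μ τ).coeFn_toLp] with r hr
        simp only [le, e, Finsupp.linearCombination_single, one_smul]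
        rw [hr]
        by_cases hr' : r ∈ Ioc 0 τ <;> simp [stepFn, hr']
      exact Lp.ext (hv0.trans (Lp.coeFn_zero _ _ _).symm)
    intro v
    have : v ∈ (LinearMap.range le).topologicalClosure := htop ▸ Submodule.mem_top
    exact this
  let Φ := lx.extendOfNorm le
  have hΦ : ∀ c, Φ (le c) = lx c := LinearMap.extendOfNorm_eq hdense hnorm
  refine ⟨Φ, fun g g' => ?_, fun τ hτ => ?_, fun g => ?_⟩
  · rw [← hB]
    refine hdense.induction_on₂ (p := fun g g' => inner ℝ (Φ g) (Φ g') = B g g') ?_ ?_ g g'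
    · exact isClosed_eq (by fun_prop) (by fun_prop)
    · intro c c'
      rw [hΦ, hΦ, hbil]
  · have h1 := hΦ (Finsupp.single ⟨τ, hτ⟩ 1)
    simp only [le, lx, e, x, Finsupp.linearCombination_single, one_smul] at h1
    rw [h1]
    exact MemLp.coeFn_toLp _
  · refine hdense.induction_on (p := fun g => Φ g ∈ gaussSpace P T X) g ?_ ?_
    · exact (Submodule.isClosed_topologicalClosure _).preimage Φ.continuous
    · intro c
      rw [hΦ]
      have hx : ∀ t, x t ∈ gaussSpace P T X := fun t =>
        Submodule.le_topologicalClosure _ (Submodule.subset_span ⟨t, t.2, MemLp.coeFn_toLp _⟩)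
      simp only [lx, Finsupp.linearCombination_apply]
      exact Submodule.sum_mem _ fun t _ => Submodule.smul_mem _ _ (hx t)

end CovMalliavin

/-! ### Wiener integrals of functions in `L_μ`, and absence of atoms -/

namespace CovMalliavin

variable {Ω : Type*} [MeasurableSpace Ω] {P : Measure Ω} {T : ℝ} {X : ℝ → Ω → ℝ}
  {μ : SignedMeasure (ℝ × ℝ)} {h : ℝ × ℝ → ℝ} {Φ : Lp ℝ 2 (marginal μ) →L[ℝ] Lp ℝ 2 P}

open Classical in
/-- The Wiener integral of a function, `0` unless the function is square integrable for `ν`. -/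
noncomputable def wint (Φ : Lp ℝ 2 (marginal μ) →L[ℝ] Lp ℝ 2 P) (g : ℝ → ℝ) : Lp ℝ 2 P :=
  if hg : MemLp g 2 (marginal μ) then Φ (hg.toLp g) else 0

theorem wint_eq {g : ℝ → ℝ} (hg : MemLp g 2 (marginal μ)) : wint Φ g = Φ (hg.toLp g) := dif_pos hg

theorem wint_sub {f g : ℝ → ℝ} (hf : MemLp f 2 (marginal μ)) (hg : MemLp g 2 (marginal μ)) :
    wint Φ (fun x => f x - g x) = wint Φ f - wint Φ g := by
  rw [wint_eq hf, wint_eq hg, ← map_sub, ← MemLp.toLp_sub]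
  exact wint_eq (hf.sub hg)

theorem wint_sum {ι : Type*} (s : Finset ι) (c : ι → ℝ) {f : ι → ℝ → ℝ}
    (hf : ∀ i, MemLp (f i) 2 (marginal μ)) :
    wint Φ (fun x => ∑ i ∈ s, c i * f i x) = ∑ i ∈ s, c i • wint Φ (f i) := by
  classical
  have hm : ∀ s : Finset ι, MemLp (fun x => ∑ i ∈ s, c i * f i x) 2 (marginal μ) := fun s =>
    memLp_finsetSum s fun i _ => (hf i).const_mul (c i)
  induction s using Finset.induction_on with
  | empty =>
    simp only [Finset.sum_empty]
    have h0 : MemLp (fun _ : ℝ => (0 : ℝ)) 2 (marginal μ) := MemLp.zero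
    rw [wint_eq h0]
    have : h0.toLp _ = 0 := MemLp.toLp_zero h0
    rw [this, map_zero]
  | insert a s ha ih =>
    rw [Finset.sum_insert ha, ← ih, wint_eq (hm _), wint_eq (hf a), wint_eq (hm s), ← map_smul, ← map_add,
      ← MemLp.toLp_const_smul, ← MemLp.toLp_add]
    congr 1
    refine (MemLp.toLp_eq_toLp_iff _ _).2 (Eventually.of_forall fun x => ?_)
    simp [Finset.sum_insert ha]

theorem inner_wint (hc : IsCovarianceMeasure P T X μ) (hΦ : IsWienerMap P T X μ h Φ)
    {f g : ℝ → ℝ} (hf : MemLp f 2 (marginal μ)) (hg : MemLp g 2 (marginal μ)) :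
    inner ℝ (wint Φ f) (wint Φ g) = ∫ p, f p.1 * g p.2 * h p ∂μ.variation := by
  rw [wint_eq hf, wint_eq hg, hΦ.inner_eq]
  refine integral_congr_ae ?_
  filter_upwards [hc.measurePreserving_fst.quasiMeasurePreserving.ae_eq_comp hf.coeFn_toLp,
    (measurePreserving_snd μ).quasiMeasurePreserving.ae_eq_comp hg.coeFn_toLp] with p h1 h2
  simp only [Function.comp] at h1 h2
  rw [h1, h2]

/-- As `|h| = 1`, the isometry bounds the integral by the `|𝓗|`-norm, so Wiener integrals can be
controlled in the norm of `L_μ` and not only in that of `L²(ν)`. -/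
theorem enorm_wint_le (hc : IsCovarianceMeasure P T X μ) (hh : IsPolarDensity μ h)
    (hΦ : IsWienerMap P T X μ h Φ) {f : ℝ → ℝ} (hf : MemLp f 2 (marginal μ)) :
    ‖wint Φ f‖ₑ ≤ absHSq μ f ^ (1 / 2 : ℝ) := by
  have h1 : ‖wint Φ f‖ₑ ^ 2 ≤ absHSq μ f := by
    have e : ‖wint Φ f‖ₑ ^ 2 = ‖inner ℝ (wint Φ f) (wint Φ f)‖ₑ := by
      rw [real_inner_self_eq_norm_sq, enorm_pow, enorm_norm]
    rw [e, inner_wint hc hΦ hf hf]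
    refine (enorm_integral_le_lintegral_enorm _).trans (lintegral_mono fun p => ?_)
    have hp : ‖h p‖ₑ = 1 := by rw [← enorm_norm, Real.norm_eq_abs, hh.abs_eq]; simp
    simp only [enorm_mul, hp, mul_one]
    exact le_rfl
  calc ‖wint Φ f‖ₑ = (‖wint Φ f‖ₑ ^ 2) ^ (1 / 2 : ℝ) := by
        rw [← ENNReal.rpow_natCast, ← ENNReal.rpow_mul]; norm_num
    _ ≤ _ := ENNReal.rpow_le_rpow h1 (by norm_num)

theorem wint_mem (hΦ : IsWienerMap P T X μ h Φ) (f : ℝ → ℝ) : wint Φ f ∈ gaussSpace P T X := by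
  unfold wint
  split_ifs
  · exact hΦ.mem _
  · exact zero_mem _

/-- A measurable exhaustion of the line by sets on which `φ` is bounded. -/
structure IsBddExhaustion (A : ℕ → Set ℝ) (φ : ℝ → ℝ) : Prop where
  measurableSet : ∀ m, MeasurableSet (A m)
  eventually_mem : ∀ x, ∀ᶠ m in atTop, x ∈ A m
  bdd : ∀ m, ∃ C, ∀ x ∈ A m, |φ x| ≤ C

theorem IsBddExhaustion.memLp {A : ℕ → Set ℝ} {φ : ℝ → ℝ} (hA : IsBddExhaustion A φ)
    (hφ : Measurable φ) (m : ℕ) : MemLp ((A m).indicator φ) 2 (marginal μ) := by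
  obtain ⟨C, hC⟩ := hA.bdd m
  refine memLp_of_bounded (hφ.indicator (hA.measurableSet m)) (C := max C 0) fun x => ?_
  by_cases hx : x ∈ A m
  · simp only [indicator_of_mem hx]
    exact (hC x hx).trans (le_max_left _ _)
  · simp [hx]

theorem tendsto_absHSq_indicator_compl {φ : ℝ → ℝ} (hφ : MemLmu μ φ) {A : ℕ → Set ℝ}
    (hA : ∀ m, MeasurableSet (A m)) (hev : ∀ x, ∀ᶠ m in atTop, x ∈ A m) :
    Tendsto (fun m => absHSq μ ((A m)ᶜ.indicator φ)) atTop (𝓝 0) := by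
  have h0 : ∫⁻ _ : ℝ × ℝ, (0 : ℝ≥0∞) ∂μ.variation = 0 := by simp
  rw [← h0]
  have hm : ∀ g : ℝ → ℝ, Measurable g → Measurable fun p : ℝ × ℝ => ‖g p.1‖ₑ * ‖g p.2‖ₑ :=
    fun g hg => (hg.comp measurable_fst).enorm.mul (hg.comp measurable_snd).enorm
  refine tendsto_lintegral_of_dominated_convergence (fun p => ‖φ p.1‖ₑ * ‖φ p.2‖ₑ)
    (fun m => hm _ (hφ.1.indicator (hA m).compl)) (fun m => Eventually.of_forall fun p => ?_)
    hφ.2.ne (Eventually.of_forall fun p => ?_)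
  · exact mul_le_mul' (enorm_indicator_le_enorm_self _ _) (enorm_indicator_le_enorm_self _ _)
  · refine tendsto_const_nhds.congr' ?_
    -- It suffices that the first coordinate enters `A m`: the product of the two factors is then
    -- already zero.
    filter_upwards [hev p.1] with m hm
    simp [hm]

theorem absHSq_mono {f g : ℝ → ℝ} (hfg : ∀ x, ‖f x‖ₑ ≤ ‖g x‖ₑ) : absHSq μ f ≤ absHSq μ g :=
  lintegral_mono fun p => mul_le_mul' (hfg p.1) (hfg p.2)

theorem memLmu_of_bounded {f : ℝ → ℝ} (hf : Measurable f) {C : ℝ} (hC : ∀ x, |f x| ≤ C) :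
    MemLmu μ f := by
  refine ⟨hf, ?_⟩
  calc absHSq μ f ≤ ∫⁻ _, ENNReal.ofReal C * ENNReal.ofReal C ∂μ.variation := by
        refine lintegral_mono fun p => mul_le_mul' ?_ ?_ <;>
        · rw [← ofReal_norm]; exact ENNReal.ofReal_le_ofReal (hC _)
    _ < ∞ := by
        rw [lintegral_const]
        exact ENNReal.mul_lt_top (ENNReal.mul_lt_top ENNReal.ofReal_lt_top ENNReal.ofReal_lt_top)
          (measure_lt_top _ _)

theorem enorm_sub_rpow_tendsto {a : ℕ → ℝ≥0∞} (ha : Tendsto a atTop (𝓝 0)) :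
    Tendsto (fun n => a n ^ (1 / 2 : ℝ)) atTop (𝓝 0) := by
  have := ha.ennrpow_const (1 / 2)
  simpa using this

/-- A function in `L_μ` need not be in `L²(ν)`, so its integral is recovered from bounded
truncations. Asserting convergence for every exhaustion that bounds `φ` is what carries the
induction through the sequential closure: in the limit step the exhaustion must be adapted to an
approximant. -/
theorem IsWienerIntegral.tendsto_wint (hX : IsIntegrator P T X μ) (hh : IsPolarDensity μ h)
    (hΦ : IsWienerMap P T X μ h Φ) {φ : ℝ → ℝ} {W : Ω → ℝ} (hW : IsWienerIntegral P T X μ φ W) :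
    MemLmu μ φ ∧ ∃ w ∈ gaussSpace P T X, w =ᵐ[P] W ∧ ∀ A, IsBddExhaustion A φ →
      Tendsto (fun m => wint Φ ((A m).indicator φ)) atTop (𝓝 w) := by
  have hc := hX.covariance
  induction hW with
  | step n a τ hτ =>
    have hmeas : Measurable fun s => ∑ i, a i * stepFn (τ i) s :=
      Finset.measurable_sum _ fun i _ => (measurable_stepFn _).const_mul _
    have hbd : ∀ s, |∑ i, a i * stepFn (τ i) s| ≤ ∑ i, |a i| := fun s => by
      refine (Finset.abs_sum_le_sum_abs _ _).trans (Finset.sum_le_sum fun i _ => ?_)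
      rw [abs_mul]
      refine mul_le_of_le_one_right (abs_nonneg _) ?_
      by_cases hs : s ∈ Ioc 0 (τ i) <;> simp [stepFn, hs]
    have hL : MemLmu μ fun s => ∑ i, a i * stepFn (τ i) s := memLmu_of_bounded hmeas hbd
    have hL2 : MemLp (fun s => ∑ i, a i * stepFn (τ i) s) 2 (marginal μ) :=
      memLp_of_bounded hmeas hbd
    refine ⟨hL, wint Φ (fun s => ∑ i, a i * stepFn (τ i) s), wint_mem hΦ _, ?_, fun A hA => ?_⟩
    · rw [wint_sum _ _ fun i => memLp_stepFn μ (τ i)]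
      refine (Lp.coeFn_finsetSum _ _).trans ?_
      have : ∀ᵐ ω ∂P, ∀ i, (a i • wint Φ (stepFn (τ i))) ω = a i * X (τ i) ω := by
        refine ae_all_iff.2 fun i => ?_
        filter_upwards [Lp.coeFn_smul (a i) (wint Φ (stepFn (τ i))), hΦ.step (τ i) (hτ i)] with ω h1 h2
        rw [h1, Pi.smul_apply, smul_eq_mul, wint_eq (memLp_stepFn μ (τ i)), h2]
      filter_upwards [this] with ω hω
      rw [Finset.sum_apply]
      exact Finset.sum_congr rfl fun i _ => hω i
    · rw [tendsto_iff_edist_tendsto_0]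
      refine tendsto_of_tendsto_of_tendsto_of_le_of_le tendsto_const_nhds
        (enorm_sub_rpow_tendsto (tendsto_absHSq_indicator_compl hL hA.measurableSet hA.eventually_mem))
        (fun _ => bot_le) fun m => ?_
      have hA2 := hA.memLp (μ := μ) hmeas m
      rw [edist_comm, edist_eq_enorm_sub, ← wint_sub hL2 hA2]
      refine (enorm_wint_le hc hh hΦ (hL2.sub hA2)).trans (le_of_eq ?_)
      congr 2
      ext x
      by_cases hx : x ∈ A m <;> simp [hx, stepFn]
  | limit φ W φn Wn hn hφ hW hφn hWn ih =>
    choose hL w hwG hw hlim using ih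
    have hwlim : Tendsto w atTop (𝓝 (hW.toLp W)) := by
      rw [Lp.tendsto_Lp_iff_tendsto_eLpNorm']
      refine hWn.congr fun n => eLpNorm_congr_ae ?_
      filter_upwards [hw n, hW.coeFn_toLp] with ω h1 h2
      simp [h1, h2]
    refine ⟨hφ, hW.toLp W, ?_, hW.coeFn_toLp, fun A hA => ?_⟩
    · exact (Submodule.isClosed_topologicalClosure _).mem_of_tendsto hwlim
        (Eventually.of_forall hwG)
    rw [tendsto_iff_edist_tendsto_0] at hwlim ⊢
    rw [ENNReal.tendsto_nhds_zero]
    intro ε hε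
    have hε4 : 0 < ε / 4 := ENNReal.div_pos hε.ne' (by norm_num)
    obtain ⟨n, hn1, hn2⟩ := (((ENNReal.tendsto_nhds_zero.1 hwlim) _ hε4).and
      ((ENNReal.tendsto_nhds_zero.1 (enorm_sub_rpow_tendsto hφn)) _ hε4)).exists
    -- The smaller sets bound `φ` and `φn n` simultaneously. Passing from `A` to `A'` costs at most
    -- `φ` off `A'`, and replacing `φ` by `φn n` on `A'` costs at most their distance in `L_μ`.
    let A' : ℕ → Set ℝ := fun m => A m ∩ {x | |φn n x| ≤ m}
    have hA'm : ∀ m, MeasurableSet (A' m) := fun m =>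
      (hA.measurableSet m).inter (measurableSet_le (hL n).1.abs measurable_const)
    have hA'ev : ∀ x, ∀ᶠ m in atTop, x ∈ A' m := by
      intro x
      obtain ⟨N, hN⟩ := exists_nat_ge (|φn n x|)
      filter_upwards [hA.eventually_mem x, eventually_ge_atTop N] with m h1 h2
      exact ⟨h1, hN.trans (by exact_mod_cast h2)⟩
    have hA'φ : IsBddExhaustion A' φ := ⟨hA'm, hA'ev, fun m =>
      (hA.bdd m).imp fun C hC x hx => hC x hx.1⟩
    have hA'n : IsBddExhaustion A' (φn n) := ⟨hA'm, hA'ev, fun m => ⟨m, fun x hx => hx.2⟩⟩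
    have l1 := (ENNReal.tendsto_nhds_zero.1 (tendsto_iff_edist_tendsto_0.1 (hlim n A' hA'n))) _ hε4
    have l2 := (ENNReal.tendsto_nhds_zero.1 (enorm_sub_rpow_tendsto
      (tendsto_absHSq_indicator_compl hφ hA'm hA'ev))) _ hε4
    filter_upwards [l1, l2] with m hm1 hm2
    have m1 := hA.memLp (μ := μ) hφ.1 m
    have m2 := hA'φ.memLp (μ := μ) hφ.1 m
    have m3 := hA'n.memLp (μ := μ) (hL n).1 m
    have t1 : edist (wint Φ ((A m).indicator φ)) (wint Φ ((A' m).indicator φ)) ≤ ε / 4 := by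
      rw [edist_eq_enorm_sub, ← wint_sub m1 m2]
      refine (enorm_wint_le hc hh hΦ (m1.sub m2)).trans (le_trans ?_ hm2)
      refine ENNReal.rpow_le_rpow (absHSq_mono fun x => ?_) (by norm_num)
      by_cases hx : x ∈ A' m
      · simp [hx, hx.1]
      · by_cases hx' : x ∈ A m <;> simp [hx, hx']
    have t2 : edist (wint Φ ((A' m).indicator φ)) (wint Φ ((A' m).indicator (φn n))) ≤ ε / 4 := by
      rw [edist_comm, edist_eq_enorm_sub, ← wint_sub m3 m2]
      refine (enorm_wint_le hc hh hΦ (m3.sub m2)).trans (le_trans ?_ hn2)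
      refine ENNReal.rpow_le_rpow (absHSq_mono fun x => ?_) (by norm_num)
      by_cases hx : x ∈ A' m <;> simp [hx]
    calc edist (wint Φ ((A m).indicator φ)) (hW.toLp W)
        ≤ edist (wint Φ ((A m).indicator φ)) (wint Φ ((A' m).indicator φ)) +
          edist (wint Φ ((A' m).indicator φ)) (wint Φ ((A' m).indicator (φn n))) +
          edist (wint Φ ((A' m).indicator (φn n))) (w n) + edist (w n) (hW.toLp W) :=
          (edist_triangle _ (w n) _).trans (by gcongr; exact edist_triangle4 _ _ _ _)
      _ ≤ ε / 4 + ε / 4 + ε / 4 + ε / 4 := by gcongr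
      _ = ε := by
        rw [← ENNReal.add_div, ← ENNReal.add_div, ← ENNReal.add_div]
        rw [show ε + ε + ε + ε = 4 * ε by ring, mul_div_assoc]
        exact ENNReal.mul_div_cancel (by norm_num) (by norm_num)

/-- The sublevel sets of finitely many functions. -/
def sublevel {n : ℕ} (φ : Fin n → ℝ → ℝ) (m : ℕ) : Set ℝ := {x | ∀ i, |φ i x| ≤ m}

theorem measurableSet_sublevel {n : ℕ} {φ : Fin n → ℝ → ℝ} (hφ : ∀ i, Measurable (φ i)) (m : ℕ) :
    MeasurableSet (sublevel φ m) := by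
  simp only [sublevel, ofPred_forall]
  exact MeasurableSet.iInter fun i => measurableSet_le (hφ i).abs measurable_const

theorem eventually_mem_sublevel {n : ℕ} (φ : Fin n → ℝ → ℝ) (x : ℝ) :
    ∀ᶠ m in atTop, x ∈ sublevel φ m := by
  have : ∀ i, ∀ᶠ m : ℕ in atTop, |φ i x| ≤ m := fun i => by
    obtain ⟨N, hN⟩ := exists_nat_ge (|φ i x|)
    filter_upwards [eventually_ge_atTop N] with m hm
    exact hN.trans (by exact_mod_cast hm)
  filter_upwards [eventually_all.2 this] with m hm i
  exact hm i

theorem isBddExhaustion_sublevel {n : ℕ} {φ : Fin n → ℝ → ℝ} (hφ : ∀ i, Measurable (φ i)) (i : Fin n) :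
    IsBddExhaustion (sublevel φ) (φ i) :=
  ⟨measurableSet_sublevel hφ, eventually_mem_sublevel φ, fun m => ⟨m, fun _ hx => hx i⟩⟩

theorem tendsto_wint_sublevel {n : ℕ} {φ : Fin n → ℝ → ℝ} (hφ : ∀ i, Measurable (φ i))
    {w : Fin n → Lp ℝ 2 P}
    (hw : ∀ i A, IsBddExhaustion A (φ i) →
      Tendsto (fun m => wint Φ ((A m).indicator (φ i))) atTop (𝓝 (w i))) (c : Fin n → ℝ) :
    Tendsto (fun m => wint Φ ((sublevel φ m).indicator fun x => ∑ i, c i * φ i x)) atTop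
      (𝓝 (∑ i, c i • w i)) := by
  have : ∀ m, wint Φ ((sublevel φ m).indicator fun x => ∑ i, c i * φ i x) =
      ∑ i, c i • wint Φ ((sublevel φ m).indicator (φ i)) := by
    intro m
    rw [← wint_sum _ _ fun i => (isBddExhaustion_sublevel hφ i).memLp (hφ i) m]
    congr 1
    ext x
    by_cases hx : x ∈ sublevel φ m <;> simp [hx]
  simp only [this]
  exact tendsto_finsetSum _ fun i _ => (hw i _ (isBddExhaustion_sublevel hφ i)).const_smul (c i)

theorem memLp_sublevel {n : ℕ} {φ : Fin n → ℝ → ℝ} (hφ : ∀ i, Measurable (φ i)) (c : Fin n → ℝ) (m : ℕ) :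
    MemLp ((sublevel φ m).indicator fun x => ∑ i, c i * φ i x) 2 (marginal μ) := by
  have := memLp_finsetSum (μ := marginal μ) (p := 2) Finset.univ
    fun i _ => ((isBddExhaustion_sublevel hφ i).memLp (μ := μ) (hφ i) m).const_mul (c i)
  convert this using 1
  ext x
  by_cases hx : x ∈ sublevel φ m <;> simp [hx]

/-- The `|𝓗|`-norm need not obey the triangle inequality, so the estimate is not assembled from its
terms. On each sublevel set the difference is the Wiener integral of one bounded function, to which
`enorm_wint_le` applies; the sets then grow. -/
theorem enorm_sum_sub_wint_le (hX : IsIntegrator P T X μ) (hh : IsPolarDensity μ h)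
    (hΦ : IsWienerMap P T X μ h Φ) {n : ℕ} {φ : Fin n → ℝ → ℝ} (hφ : ∀ i, Measurable (φ i))
    {w : Fin n → Lp ℝ 2 P}
    (hw : ∀ i A, IsBddExhaustion A (φ i) →
      Tendsto (fun m => wint Φ ((A m).indicator (φ i))) atTop (𝓝 (w i))) (c : Fin n → ℝ)
    {g : ℝ → ℝ} (hg : Measurable g) {C : ℝ} (hC : ∀ x, |g x| ≤ C) :
    ‖∑ i, c i • w i - wint Φ g‖ₑ ≤ absHSq μ (fun x => ∑ i, c i * φ i x - g x) ^ (1 / 2 : ℝ) := by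
  have hc := hX.covariance
  have hgL : MemLmu μ g := memLmu_of_bounded hg hC
  have hg2 : MemLp g 2 (marginal μ) := memLp_of_bounded hg hC
  have hgA : ∀ m, MemLp ((sublevel φ m).indicator g) 2 (marginal μ) :=
    fun m => hg2.indicator (measurableSet_sublevel hφ m)
  have hglim : Tendsto (fun m => wint Φ ((sublevel φ m).indicator g)) atTop (𝓝 (wint Φ g)) := by
    rw [tendsto_iff_edist_tendsto_0]
    refine tendsto_of_tendsto_of_tendsto_of_le_of_le tendsto_const_nhds
      (enorm_sub_rpow_tendsto (tendsto_absHSq_indicator_compl hgL (measurableSet_sublevel hφ)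
        (eventually_mem_sublevel φ)))
      (fun _ => bot_le) fun m => ?_
    rw [edist_comm, edist_eq_enorm_sub, ← wint_sub hg2 (hgA m)]
    refine (enorm_wint_le hc hh hΦ (hg2.sub (hgA m))).trans (le_of_eq ?_)
    congr 2
    ext x
    by_cases hx : x ∈ sublevel φ m <;> simp [hx]
  refine le_of_tendsto ((tendsto_wint_sublevel hφ hw c).sub hglim).enorm
    (Eventually.of_forall fun m => ?_)
  rw [← wint_sub (memLp_sublevel hφ c m) (hgA m)]
  refine (enorm_wint_le hc hh hΦ ((memLp_sublevel hφ c m).sub (hgA m))).trans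
    (ENNReal.rpow_le_rpow (absHSq_mono fun x => ?_) (by norm_num))
  by_cases hx : x ∈ sublevel φ m <;> simp [hx]

/-- The isometry on sublevel sets passes to the limit by dominated convergence. The finiteness
assumption is the absolute convergence that the duality formula presupposes. -/
theorem inner_sum_wint (hX : IsIntegrator P T X μ) (hh : IsPolarDensity μ h)
    (hΦ : IsWienerMap P T X μ h Φ) {n : ℕ} {φ : Fin n → ℝ → ℝ} (hφ : ∀ i, Measurable (φ i))
    {w : Fin n → Lp ℝ 2 P}
    (hw : ∀ i A, IsBddExhaustion A (φ i) →
      Tendsto (fun m => wint Φ ((A m).indicator (φ i))) atTop (𝓝 (w i))) (c : Fin n → ℝ)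
    {u : ℝ → ℝ} (hu : Measurable u) (hu2 : MemLp u 2 (marginal μ))
    (hfin : ∫⁻ p, ‖∑ i, c i * φ i p.1‖ₑ * ‖u p.2‖ₑ ∂μ.variation < ∞) :
    inner ℝ (∑ i, c i • w i) (wint Φ u) =
      ∫ p, (∑ i, c i * φ i p.1) * u p.2 * h p ∂μ.variation := by
  have hK : Measurable fun x => ∑ i, c i * φ i x :=
    Finset.measurable_sum _ fun i _ => (hφ i).const_mul _
  have l1 : Tendsto (fun m => inner ℝ
      (wint Φ ((sublevel φ m).indicator fun x => ∑ i, c i * φ i x)) (wint Φ u)) atTop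
      (𝓝 (inner ℝ (∑ i, c i • w i) (wint Φ u))) :=
    (tendsto_wint_sublevel hφ hw c).inner tendsto_const_nhds
  refine tendsto_nhds_unique l1 ?_
  simp only [inner_wint hX.covariance hΦ (memLp_sublevel hφ c _) hu2]
  refine tendsto_integral_of_dominated_convergence
    (fun p => ‖(∑ i, c i * φ i p.1) * u p.2‖) (fun m => ?_) ?_
    (fun m => Eventually.of_forall fun p => ?_) (Eventually.of_forall fun p => ?_)
  · exact ((((hK.indicator (measurableSet_sublevel hφ m)).comp measurable_fst).mul
      (hu.comp measurable_snd)).mul hh.measurable).aestronglyMeasurable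
  · refine Integrable.norm ⟨((hK.comp measurable_fst).mul
      (hu.comp measurable_snd)).aestronglyMeasurable, ?_⟩
    simpa [HasFiniteIntegral, enorm_mul] using hfin
  · rw [norm_mul, norm_mul, norm_mul, Real.norm_eq_abs (h p), hh.abs_eq, mul_one]
    gcongr
    exact norm_indicator_le_norm_self _ _
  · refine tendsto_const_nhds.congr' ?_
    filter_upwards [eventually_mem_sublevel φ p.1] with m hm
    simp [hm]

/-- The indicator function of `]a, b]`. -/
noncomputable def intervalFn (a b : ℝ) : ℝ → ℝ := (Ioc a b).indicator fun _ => (1 : ℝ)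

theorem measurable_intervalFn (a b : ℝ) : Measurable (intervalFn a b) :=
  measurable_const.indicator measurableSet_Ioc

theorem abs_intervalFn_le (a b x : ℝ) : |intervalFn a b x| ≤ 1 := by
  by_cases hx : x ∈ Ioc a b <;> simp [intervalFn, hx]

theorem memLp_intervalFn (μ : SignedMeasure (ℝ × ℝ)) (a b : ℝ) :
    MemLp (intervalFn a b) 2 (marginal μ) :=
  memLp_of_bounded (measurable_intervalFn a b) (abs_intervalFn_le a b)

theorem wint_intervalFn (hΦ : IsWienerMap P T X μ h Φ) {a b : ℝ} (ha : 0 ≤ a) (hab : a ≤ b)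
    (hb : b ≤ T) : wint Φ (intervalFn a b) =ᵐ[P] fun ω => X b ω - X a ω := by
  have e : intervalFn a b = fun x => stepFn b x - stepFn a x := by
    ext x
    by_cases h1 : x ∈ Ioc 0 a
    · have h2 : x ∈ Ioc 0 b := ⟨h1.1, h1.2.trans hab⟩
      have h3 : x ∉ Ioc a b := fun hx => absurd hx.1 (not_lt.2 h1.2)
      simp [intervalFn, stepFn, h1, h2, h3]
    · by_cases h2 : x ∈ Ioc 0 b
      · have h3 : x ∈ Ioc a b := ⟨not_le.1 fun hx => h1 ⟨h2.1, hx⟩, h2.2⟩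
        simp [intervalFn, stepFn, h1, h2, h3]
      · have h3 : x ∉ Ioc a b := fun hx => h2 ⟨ha.trans_lt hx.1, hx.2⟩
        simp [intervalFn, stepFn, h1, h2, h3]
  rw [e, wint_sub (memLp_stepFn μ b) (memLp_stepFn μ a), wint_eq (memLp_stepFn μ b),
    wint_eq (memLp_stepFn μ a)]
  filter_upwards [Lp.coeFn_sub (Φ ((memLp_stepFn μ b).toLp _)) (Φ ((memLp_stepFn μ a).toLp _)),
    hΦ.step b ⟨ha.trans hab, hb⟩, hΦ.step a ⟨ha, hab.trans hb⟩] with ω h1 h2 h3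
  rw [h1, Pi.sub_apply, h2, h3]

/-- The marginal of the variation has no atoms. -/
theorem marginal_singleton [IsProbabilityMeasure P] (hX : IsIntegrator P T X μ) (hh : IsPolarDensity μ h)
    (hΦ : IsWienerMap P T X μ h Φ) (c : ℝ) : marginal μ {c} = 0 := by
  have hc := hX.covariance
  by_cases hcT : c ∈ Ioc 0 T
  swap
  · exact measure_mono_null (singleton_subset_iff.2 hcT) hc.marginal_compl
  let s : ℕ → ℝ := fun n => c - c / (n + 1)
  have hs0 : ∀ n, 0 ≤ s n := fun n => by
    have : c / (n + 1) ≤ c := div_le_self hcT.1.le (by simp)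
    simp only [s]; linarith
  have hsc : ∀ n, s n < c := fun n => by
    have : 0 < c / (n + 1) := div_pos hcT.1 (by positivity)
    simp only [s]; linarith
  have hslim : Tendsto s atTop (𝓝 c) := by
    have : Tendsto (fun n : ℕ => c / ((n : ℝ) + 1)) atTop (𝓝 0) := by
      have := (tendsto_one_div_add_atTop_nhds_zero_nat (𝕜 := ℝ)).const_mul c
      simpa [div_eq_mul_inv] using this
    simpa using this.const_sub c
  let g : ℝ → ℝ := ({c} : Set ℝ).indicator fun _ => 1
  have hgm : Measurable g := measurable_const.indicator (measurableSet_singleton c)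
  have hgb : ∀ x, |g x| ≤ 1 := fun x => by
    simp only [g, indicator]
    split_ifs <;> simp
  have hg2 : MemLp g 2 (marginal μ) := memLp_of_bounded hgm hgb
  have hlim : Tendsto (fun n => wint Φ (intervalFn (s n) c)) atTop (𝓝 (wint Φ g)) := by
    rw [tendsto_iff_edist_tendsto_0]
    have hone : MemLmu μ fun _ => (1 : ℝ) := memLmu_of_bounded measurable_const (C := 1) (by simp)
    refine tendsto_of_tendsto_of_tendsto_of_le_of_le tendsto_const_nhds
      (enorm_sub_rpow_tendsto (tendsto_absHSq_indicator_compl hone (A := fun n => (Ioo (s n) c)ᶜ)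
        (fun n => measurableSet_Ioo.compl) fun x => ?_))
      (fun _ => bot_le) fun m => ?_
    · rcases lt_or_ge x c with hx | hx
      · filter_upwards [hslim.eventually (lt_mem_nhds hx)] with n hn
        exact fun h => absurd h.1 (not_lt.2 hn.le)
      · exact Eventually.of_forall fun n h => absurd h.2 (not_lt.2 hx)
    · rw [edist_eq_enorm_sub, ← wint_sub (memLp_intervalFn μ _ _) hg2]
      refine (enorm_wint_le hc hh hΦ ((memLp_intervalFn μ _ _).sub hg2)).trans
        (ENNReal.rpow_le_rpow (absHSq_mono fun x => ?_) (by norm_num))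
      rcases lt_trichotomy x c with hx | hx | hx
      · by_cases hxs : s m < x
        · simp [intervalFn, g, hx, hxs, hx.ne, hx.le]
        · simp [intervalFn, g, hxs, hx.ne]
      · simp [intervalFn, g, hx, hsc]
      · simp [intervalFn, g, not_le.2 hx, hx.ne']
  -- The Wiener integrals of `1_{]s n, c]}` are the increments `X c - X (s n)`, which tend to zero
  -- by path continuity.
  have hzero : wint Φ g =ᵐ[P] 0 := by
    refine tendstoInMeasure_ae_unique (tendstoInMeasure_of_tendsto_Lp hlim)
      (tendstoInMeasure_of_tendsto_ae (fun n => Lp.aestronglyMeasurable _) ?_)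
    have hall : ∀ᵐ ω ∂P, ∀ n, wint Φ (intervalFn (s n) c) ω = X c ω - X (s n) ω :=
      ae_all_iff.2 fun n => wint_intervalFn hΦ (hs0 n) (hsc n).le hcT.2
    filter_upwards [hall, hX.continuous] with ω h1 h2
    simp only [h1]
    have := (h2 c ⟨hcT.1.le, hcT.2⟩).tendsto.comp (tendsto_nhdsWithin_iff.2
      ⟨hslim, Eventually.of_forall fun n => ⟨hs0 n, (hsc n).le.trans hcT.2⟩⟩)
    simpa using this.const_sub (X c ω)
  have hz : wint Φ g = 0 := Lp.ext (hzero.trans (Lp.coeFn_zero _ _ _).symm)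
  -- Tested against this function, `h² = 1` turns the vanishing pairing into `|μ|({c} × ℝ)`, which
  -- is the mass of the atom.
  let k : ℝ → ℝ := fun v => h (c, v)
  have hkm : Measurable k := hh.measurable.comp measurable_prodMk_left
  have hk2 : MemLp k 2 (marginal μ) := memLp_of_bounded hkm (C := 1) fun x => (hh.abs_eq _).le
  have hin := inner_wint hc hΦ hg2 hk2
  rw [hz, inner_zero_left] at hin
  have e : (fun p : ℝ × ℝ => g p.1 * k p.2 * h p) = (Prod.fst ⁻¹' {c}).indicator fun _ => 1 := by
    ext p
    by_cases hp : p.1 = c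
    · have hp' : p = (c, p.2) := by ext <;> simp [hp]
      have h1 := abs_mul_abs_self (h (c, p.2))
      rw [hh.abs_eq] at h1
      rw [hp']
      simp [g, k, ← h1]
    · simp [g, hp]
  rw [e, integral_indicator (measurable_fst (measurableSet_singleton c))] at hin
  simp only [integral_const, smul_eq_mul, mul_one, measureReal_restrict_apply_univ] at hin
  rw [← hc.measurePreserving_fst.measure_preimage (measurableSet_singleton c).nullMeasurableSet]
  exact (measureReal_eq_zero_iff).1 hin.symm

end CovMalliavin

/-! ### Divergences of Malliavin differentiable variables -/

namespace CovMalliavin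

variable {Ω : Type*} [MeasurableSpace Ω] {P : Measure Ω} {T : ℝ} {X : ℝ → Ω → ℝ}
  {μ : SignedMeasure (ℝ × ℝ)} {h : ℝ × ℝ → ℝ} {Φ : Lp ℝ 2 (marginal μ) →L[ℝ] Lp ℝ 2 P}

/-- Expanding, `‖E i - E j‖²` tends to `c - 2c + c = 0`, so the family is Cauchy. The limit never
has to be known in advance. -/
theorem exists_tendsto_of_tendsto_inner {ι V : Type*} [NormedAddCommGroup V] [InnerProductSpace ℝ V]
    [CompleteSpace V] {l : Filter ι} [NeBot l] {E : ι → V} {c : ℝ}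
    (hin : Tendsto (fun p : ι × ι => inner ℝ (E p.1) (E p.2)) (l ×ˢ l) (𝓝 c)) :
    ∃ Z, Tendsto E l (𝓝 Z) := by
  have hdiag : Tendsto (fun i => inner ℝ (E i) (E i)) l (𝓝 c) :=
    hin.comp (tendsto_id.prodMk tendsto_id)
  have hsq : Tendsto (fun p : ι × ι => ‖E p.1 - E p.2‖ ^ 2) (l ×ˢ l) (𝓝 0) := by
    have := ((hdiag.comp tendsto_fst).sub (hin.const_mul 2)).add (hdiag.comp (tendsto_snd (f := l)))
    have e : c - 2 * c + c = 0 := by ring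
    rw [e] at this
    refine this.congr fun p => ?_
    rw [norm_sub_sq_real, ← real_inner_self_eq_norm_sq, ← real_inner_self_eq_norm_sq]
    rfl
  have hdist : Tendsto (fun p : ι × ι => dist (E p.1) (E p.2)) (l ×ˢ l) (𝓝 0) := by
    have h := hsq.sqrt
    rw [Real.sqrt_zero] at h
    refine h.congr fun p => ?_
    rw [Real.sqrt_sq (norm_nonneg _), dist_eq_norm]
  have hcau : Cauchy (l.map E) := by
    rw [cauchy_map_iff]
    refine ⟨inferInstance, ?_⟩
    rw [Metric.uniformity_eq_comap_nhds_zero, tendsto_comap_iff]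
    exact hdist
  exact cauchy_map_iff_exists_tendsto.1 hcau

theorem eLpNorm_mul_le_two_two {S : Type*} [MeasurableSpace S] {θ : Measure S} {f g : S → ℝ}
    (hf : AEStronglyMeasurable f θ) (hg : AEStronglyMeasurable g θ) :
    eLpNorm (fun x => f x * g x) 1 θ ≤ eLpNorm f 2 θ * eLpNorm g 2 θ := by
  have := eLpNorm_le_eLpNorm_mul_eLpNorm_of_nnnorm (p := 2) (q := 2) (r := 1) hf hg
    (fun a b => a * b) 1 (Eventually.of_forall fun x => by simp)
  simpa using this

section Lp

variable {S ι : Type*} [MeasurableSpace S] {θ : Measure S} {l : Filter ι}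

theorem tendsto_toLp {f : ι → S → ℝ} {g : S → ℝ} (hf : ∀ i, MemLp (f i) 2 θ) (hg : MemLp g 2 θ)
    (h : Tendsto (fun i => eLpNorm (fun x => f i x - g x) 2 θ) l (𝓝 0)) :
    Tendsto (fun i => (hf i).toLp (f i)) l (𝓝 (hg.toLp g)) :=
  (Lp.tendsto_Lp_iff_tendsto_eLpNorm'' f hf g hg).2 h

theorem inner_toLp {f g : S → ℝ} (hf : MemLp f 2 θ) (hg : MemLp g 2 θ) :
    inner ℝ (hf.toLp f) (hg.toLp g) = ∫ x, f x * g x ∂θ := by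
  rw [inner_Lp_two]
  refine integral_congr_ae ?_
  filter_upwards [hf.coeFn_toLp, hg.coeFn_toLp] with x h1 h2
  rw [h1, h2]

theorem tendsto_integral_mul {f f' : ι → S → ℝ} {g g' : S → ℝ} (hf : ∀ i, MemLp (f i) 2 θ)
    (hg : MemLp g 2 θ) (hf' : ∀ i, MemLp (f' i) 2 θ) (hg' : MemLp g' 2 θ)
    (h : Tendsto (fun i => eLpNorm (fun x => f i x - g x) 2 θ) l (𝓝 0))
    (h' : Tendsto (fun i => eLpNorm (fun x => f' i x - g' x) 2 θ) l (𝓝 0)) :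
    Tendsto (fun i => ∫ x, f i x * f' i x ∂θ) l (𝓝 (∫ x, g x * g' x ∂θ)) := by
  have := (tendsto_toLp hf hg h).inner (𝕜 := ℝ) (tendsto_toLp hf' hg' h')
  simpa only [inner_toLp] using this

/-- A family in `L²` whose Gram matrix converges is convergent. -/
theorem exists_tendsto_of_tendsto_integral_mul [NeBot l] {D : ι → S → ℝ}
    (hD : ∀ᶠ i in l, MemLp (D i) 2 θ) {c : ℝ}
    (hc : Tendsto (fun p : ι × ι => ∫ x, D p.1 x * D p.2 x ∂θ) (l ×ˢ l) (𝓝 c)) :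
    ∃ Z : S → ℝ, MemLp Z 2 θ ∧ Tendsto (fun i => eLpNorm (fun x => D i x - Z x) 2 θ) l (𝓝 0) := by
  classical
  let E : ι → Lp ℝ 2 θ := fun i => if hi : MemLp (D i) 2 θ then hi.toLp (D i) else 0
  have hE : ∀ i, MemLp (D i) 2 θ → E i =ᵐ[θ] D i := fun i hi => by
    simp only [E, dif_pos hi]; exact hi.coeFn_toLp
  obtain ⟨Z, hZ⟩ := exists_tendsto_of_tendsto_inner (E := E) (c := c) (hc.congr' (by
    filter_upwards [hD.prod_mk hD] with p hp
    rw [inner_Lp_two]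
    refine integral_congr_ae ?_
    filter_upwards [hE _ hp.1, hE _ hp.2] with x h1 h2
    rw [h1, h2]))
  refine ⟨Z, Lp.memLp Z, ?_⟩
  rw [Lp.tendsto_Lp_iff_tendsto_eLpNorm'] at hZ
  refine hZ.congr' ?_
  filter_upwards [hD] with i hi
  refine eLpNorm_congr_ae ?_
  filter_upwards [hE i hi] with x hx
  simp [hx]

end Lp

/-- A function of finitely many elements of the Gaussian space. -/
structure CylData (P : Measure Ω) (T : ℝ) (X : ℝ → Ω → ℝ) where
  dim : ℕ
  fn : (Fin dim → ℝ) → ℝ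
  vec : Fin dim → Lp ℝ 2 P
  bddC2 : IsBddC2 fn
  mem : ∀ i, vec i ∈ gaussSpace P T X

namespace CylData

variable (H : CylData P T X)

/-- The random vector. -/
noncomputable def rv : Ω → Fin H.dim → ℝ := fun ω i => H.vec i ω

/-- The random variable. -/
noncomputable def val (ω : Ω) : ℝ := H.fn (H.rv ω)

/-- The derivative in the direction `ξ`. -/
noncomputable def deriv (ξ : Lp ℝ 2 P) (ω : Ω) : ℝ := fderiv ℝ H.fn (H.rv ω) fun i => inner ℝ (H.vec i) ξ

theorem inGauss_vec (i : Fin H.dim) : InGauss P T X (H.vec i) := ⟨H.vec i, H.mem i, ae_eq_rfl⟩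

theorem inGaussVec_rv : InGaussVec P T X H.rv := inGaussVec_pi H.inGauss_vec

theorem isCovVec {ξ : Lp ℝ 2 P} (hξ : ξ ∈ gaussSpace P T X) :
    IsCovVec P H.rv ξ fun i => inner ℝ (H.vec i) ξ := by
  have := isCovVec_pi H.inGauss_vec (ξ := ξ) ⟨ξ, hξ, ae_eq_rfl⟩
  simp only [inner_Lp_two]
  exact this

theorem bdd_val : IsBddRV P H.val := H.bddC2.bdd H.inGaussVec_rv.1

theorem bdd_deriv (ξ : Lp ℝ 2 P) : IsBddRV P (H.deriv ξ) := H.bddC2.bdd_fderiv H.inGaussVec_rv.1 _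

theorem memLp_div [IsFiniteMeasure P] (ξ : Lp ℝ 2 P) :
    MemLp (fun ω => H.val ω * ξ ω - H.deriv ξ ω) 2 P :=
  (H.bdd_val.memLp_mul (Lp.memLp ξ)).sub (H.bdd_deriv ξ).memLp_two

theorem deriv_eq_sum (ξ : Lp ℝ 2 P) (ω : Ω) :
    H.deriv ξ ω = ∑ i, fderiv ℝ H.fn (H.rv ω) (Pi.single i 1) * inner ℝ (H.vec i) ξ := by
  rw [deriv]
  conv_lhs => rw [show (fun i => inner ℝ (H.vec i) ξ) =
    ∑ i, (inner ℝ (H.vec i) ξ) • (Pi.single i 1 : Fin H.dim → ℝ) by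
      ext j; simp [Finset.sum_apply, Pi.single_apply]]
  simp [map_sum, mul_comm]

variable [IsProbabilityMeasure P]

theorem integral_div_mul_div (hX : IsIntegrator P T X μ) (H' : CylData P T X) {ξ η : Lp ℝ 2 P}
    (hξ : ξ ∈ gaussSpace P T X) (hη : η ∈ gaussSpace P T X) :
    ∫ ω, (H.val ω * ξ ω - H.deriv ξ ω) * (H'.val ω * η ω - H'.deriv η ω) ∂P =
      (∫ ω, H.val ω * H'.val ω ∂P) * inner ℝ η ξ + ∫ ω, H.deriv η ω * H'.deriv ξ ω ∂P := by
  rw [inner_Lp_two]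
  exact integral_divergence_mul_divergence hX H.bddC2 H'.bddC2 H.inGaussVec_rv H'.inGaussVec_rv
    ⟨ξ, hξ, ae_eq_rfl⟩ ⟨η, hη, ae_eq_rfl⟩ (H.isCovVec hξ) (H.isCovVec hη) (H'.isCovVec hξ)
    (H'.isCovVec hη)

theorem integral_val_mul_div (hX : IsIntegrator P T X μ) (H' : CylData P T X) {ξ : Lp ℝ 2 P}
    (hξ : ξ ∈ gaussSpace P T X) :
    ∫ ω, H'.val ω * (H.val ω * ξ ω - H.deriv ξ ω) ∂P = ∫ ω, H.val ω * H'.deriv ξ ω ∂P := by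
  have := integral_mul_mul_gauss hX H.bddC2 H'.bddC2 H.inGaussVec_rv H'.inGaussVec_rv
    ⟨ξ, hξ, ae_eq_rfl⟩ (H.isCovVec hξ) (H'.isCovVec hξ)
  have e : ∀ ω, H'.val ω * (H.val ω * ξ ω - H.deriv ξ ω) =
      H.val ω * H'.val ω * ξ ω - H.deriv ξ ω * H'.val ω := fun ω => by ring
  simp only [e]
  rw [integral_sub]
  · simp only [val, deriv]
    rw [this]
    ring
  · exact (H.bdd_val.mul H'.bdd_val).memLp_two.integrable_mul (Lp.memLp ξ)
  · exact ((H.bdd_deriv ξ).mul H'.bdd_val).integrable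

end CylData

/-- `F` is an `L²`-limit of cylindrical variables whose derivatives in the directions `ξ` of the
set `s` converge in `L²` to `A ξ`. -/
def IsGaussDiff {κ : Type*} (P : Measure Ω) (T : ℝ) (X : ℝ → Ω → ℝ) (ξ : κ → Lp ℝ 2 P)
    (F : Ω → ℝ) (A : κ → Ω → ℝ) : Prop :=
  MemLp F 2 P ∧ (∀ k, MemLp (A k) 2 P) ∧ ∃ H : ℕ → CylData P T X,
    Tendsto (fun n => eLpNorm (fun ω => (H n).val ω - F ω) 2 P) atTop (𝓝 0) ∧
    ∀ k, Tendsto (fun n => eLpNorm (fun ω => (H n).deriv (ξ k) ω - A k ω) 2 P) atTop (𝓝 0)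

section Divergence

variable [IsProbabilityMeasure P] {κ : Type*} {ξ : κ → Lp ℝ 2 P}

/-- A priori the product `F ξ` is only integrable. The isometry makes the Gram matrix of the
approximating divergences converge, since its terms involve only quantities that converge in `L²`;
hence the divergences converge in `L²`, and their `L¹` limit identifies the limit as `F ξ - A`. -/
theorem IsGaussDiff.tendsto_div (hX : IsIntegrator P T X μ) (hξ : ∀ k, ξ k ∈ gaussSpace P T X)
    {F : Ω → ℝ} {A : κ → Ω → ℝ} (hF : MemLp F 2 P) (hA : ∀ k, MemLp (A k) 2 P)
    {H : ℕ → CylData P T X}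
    (h1 : Tendsto (fun n => eLpNorm (fun ω => (H n).val ω - F ω) 2 P) atTop (𝓝 0))
    (h2 : ∀ k, Tendsto (fun n => eLpNorm (fun ω => (H n).deriv (ξ k) ω - A k ω) 2 P) atTop (𝓝 0))
    (k : κ) : MemLp (fun ω => F ω * ξ k ω - A k ω) 2 P ∧
      Tendsto (fun n => eLpNorm (fun ω => ((H n).val ω * ξ k ω - (H n).deriv (ξ k) ω) -
        (F ω * ξ k ω - A k ω)) 2 P) atTop (𝓝 0) := by
  have hD : ∀ n, MemLp (fun ω => (H n).val ω * ξ k ω - (H n).deriv (ξ k) ω) 2 P :=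
    fun n => (H n).memLp_div (ξ k)
  have hgram : Tendsto (fun p : ℕ × ℕ =>
      ∫ ω, ((H p.1).val ω * ξ k ω - (H p.1).deriv (ξ k) ω) *
        ((H p.2).val ω * ξ k ω - (H p.2).deriv (ξ k) ω) ∂P) (atTop ×ˢ atTop)
      (𝓝 ((∫ ω, F ω * F ω ∂P) * inner ℝ (ξ k) (ξ k) + ∫ ω, A k ω * A k ω ∂P)) := by
    simp only [fun p : ℕ × ℕ => (H p.1).integral_div_mul_div hX (H p.2) (hξ k) (hξ k)]
    refine ((tendsto_integral_mul (fun p : ℕ × ℕ => (H p.1).bdd_val.memLp_two) hF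
      (fun p => (H p.2).bdd_val.memLp_two) hF (h1.comp tendsto_fst)
        (h1.comp tendsto_snd)).mul_const _).add ?_
    exact tendsto_integral_mul (fun p : ℕ × ℕ => ((H p.1).bdd_deriv _).memLp_two) (hA k)
      (fun p => ((H p.2).bdd_deriv _).memLp_two) (hA k) ((h2 k).comp tendsto_fst)
        ((h2 k).comp tendsto_snd)
  obtain ⟨Z, hZ, hlim⟩ := exists_tendsto_of_tendsto_integral_mul (Eventually.of_forall hD) hgram
  have hL1 : TendstoInMeasure P (fun n ω => (H n).val ω * ξ k ω - (H n).deriv (ξ k) ω) atTop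
      (fun ω => F ω * ξ k ω - A k ω) := by
    refine tendstoInMeasure_of_tendsto_eLpNorm (p := 1) one_ne_zero
      (fun n => (hD n).aestronglyMeasurable)
      ((hF.aestronglyMeasurable.mul (Lp.aestronglyMeasurable _)).sub (hA k).aestronglyMeasurable) ?_
    have hbound : ∀ n, eLpNorm ((fun ω => (H n).val ω * ξ k ω - (H n).deriv (ξ k) ω) -
        fun ω => F ω * ξ k ω - A k ω) 1 P ≤
        eLpNorm (fun ω => (H n).val ω - F ω) 2 P * eLpNorm (ξ k) 2 P +
          eLpNorm (fun ω => (H n).deriv (ξ k) ω - A k ω) 2 P := by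
      intro n
      have e : ((fun ω => (H n).val ω * ξ k ω - (H n).deriv (ξ k) ω) -
          fun ω => F ω * ξ k ω - A k ω) = (fun ω => ((H n).val ω - F ω) * ξ k ω) -
            fun ω => (H n).deriv (ξ k) ω - A k ω := by ext ω; simp; ring
      have m1 := ((H n).bdd_val.memLp_two.sub hF).aestronglyMeasurable
      have m2 := (((H n).bdd_deriv (ξ k)).memLp_two.sub (hA k)).aestronglyMeasurable
      rw [e]
      refine (eLpNorm_sub_le (m1.mul (Lp.aestronglyMeasurable _)) m2 le_rfl).trans
        (add_le_add ?_ ?_)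
      · exact eLpNorm_mul_le_two_two m1 (Lp.aestronglyMeasurable (ξ k))
      · exact eLpNorm_le_eLpNorm_of_exponent_le one_le_two m2
    refine tendsto_of_tendsto_of_tendsto_of_le_of_le tendsto_const_nhds ?_ (fun _ => bot_le) hbound
    have := (ENNReal.Tendsto.mul_const h1 (Or.inr (Lp.memLp (ξ k)).eLpNorm_ne_top)).add (h2 k)
    simpa using this
  have hae : Z =ᵐ[P] fun ω => F ω * ξ k ω - A k ω :=
    tendstoInMeasure_ae_unique (tendstoInMeasure_of_tendsto_eLpNorm two_ne_zero
      (fun n => (hD n).aestronglyMeasurable) hZ.aestronglyMeasurable hlim) hL1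
  refine ⟨hZ.ae_eq hae, hlim.congr fun n => eLpNorm_congr_ae ?_⟩
  filter_upwards [hae] with ω hω
  rw [hω]

theorem IsGaussDiff.memLp_div (hX : IsIntegrator P T X μ) (hξ : ∀ k, ξ k ∈ gaussSpace P T X)
    {F : Ω → ℝ} {A : κ → Ω → ℝ} (hF : IsGaussDiff P T X ξ F A) (k : κ) :
    MemLp (fun ω => F ω * ξ k ω - A k ω) 2 P := by
  obtain ⟨m1, m2, H, h1, h2⟩ := hF
  exact (tendsto_div hX hξ m1 m2 h1 h2 k).1

theorem IsGaussDiff.integral_div_mul_div (hX : IsIntegrator P T X μ)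
    (hξ : ∀ k, ξ k ∈ gaussSpace P T X) {F G : Ω → ℝ} {A B : κ → Ω → ℝ}
    (hF : IsGaussDiff P T X ξ F A) (hG : IsGaussDiff P T X ξ G B) (k j : κ) :
    ∫ ω, (F ω * ξ k ω - A k ω) * (G ω * ξ j ω - B j ω) ∂P =
      (∫ ω, F ω * G ω ∂P) * inner ℝ (ξ j) (ξ k) + ∫ ω, A j ω * B k ω ∂P := by
  obtain ⟨m1, m2, H, h1, h2⟩ := hF
  obtain ⟨m1', m2', H', h1', h2'⟩ := hG
  obtain ⟨d1, d2⟩ := tendsto_div hX hξ m1 m2 h1 h2 k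
  obtain ⟨d1', d2'⟩ := tendsto_div hX hξ m1' m2' h1' h2' j
  have l1 := tendsto_integral_mul (fun n => (H n).memLp_div (ξ k)) d1
    (fun n => (H' n).memLp_div (ξ j)) d1' d2 d2'
  simp only [fun n => (H n).integral_div_mul_div hX (H' n) (hξ k) (hξ j)] at l1
  refine tendsto_nhds_unique l1 (((tendsto_integral_mul (fun n => (H n).bdd_val.memLp_two) m1
    (fun n => (H' n).bdd_val.memLp_two) m1' h1 h1').mul_const _).add ?_)
  exact tendsto_integral_mul (fun n => ((H n).bdd_deriv _).memLp_two) (m2 j)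
    (fun n => ((H' n).bdd_deriv _).memLp_two) (m2' k) (h2 j) (h2' k)

theorem IsGaussDiff.integral_val_mul_div (hX : IsIntegrator P T X μ)
    (hξ : ∀ k, ξ k ∈ gaussSpace P T X) {F : Ω → ℝ} {A : κ → Ω → ℝ}
    (hF : IsGaussDiff P T X ξ F A) (K : CylData P T X) (k : κ) :
    ∫ ω, K.val ω * (F ω * ξ k ω - A k ω) ∂P = ∫ ω, F ω * K.deriv (ξ k) ω ∂P := by
  obtain ⟨m1, m2, H, h1, h2⟩ := hF
  obtain ⟨d1, d2⟩ := tendsto_div hX hξ m1 m2 h1 h2 k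
  have hconst : ∀ f : Ω → ℝ, Tendsto (fun _ : ℕ => eLpNorm (fun ω => f ω - f ω) 2 P) atTop (𝓝 0) :=
    fun f => by simp
  have l1 := tendsto_integral_mul (fun _ => K.bdd_val.memLp_two) K.bdd_val.memLp_two
    (fun n => (H n).memLp_div (ξ k)) d1 (hconst _) d2
  simp only [fun n => (H n).integral_val_mul_div hX K (hξ k)] at l1
  exact tendsto_nhds_unique l1 (tendsto_integral_mul (fun n => (H n).bdd_val.memLp_two) m1
    (fun n => (K.bdd_deriv _).memLp_two) (K.bdd_deriv _).memLp_two h1 (hconst _))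

end Divergence

/-- Every smooth cylindrical variable comes from `CylData`, together with a description of its
derivative. -/
theorem IsCyl.exists_cylData [IsFiniteMeasure P] (hX : IsIntegrator P T X μ) (hh : IsPolarDensity μ h)
    (hΦ : IsWienerMap P T X μ h Φ) {F : Ω → ℝ} {DF : ℝ → Ω → ℝ} (hF : IsCyl P T X μ F DF) :
    ∃ (H : CylData P T X) (φ : Fin H.dim → ℝ → ℝ), (∀ i, Measurable (φ i)) ∧ F =ᵐ[P] H.val ∧
      (∀ᵐ ω ∂P, ∀ t, DF t ω = ∑ i, fderiv ℝ H.fn (H.rv ω) (Pi.single i 1) * φ i t) ∧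
      ∀ i A, IsBddExhaustion A (φ i) →
        Tendsto (fun m => wint Φ ((A m).indicator (φ i))) atTop (𝓝 (H.vec i)) := by
  obtain ⟨n, f, φ, W, hf, hφ, hW, rfl, rfl⟩ := hF
  choose w hwG hw hlim using fun i => ((hW i).tendsto_wint hX hh hΦ).2
  have hall : ∀ᵐ ω ∂P, (fun i => w i ω) = fun i => W i ω := by
    filter_upwards [ae_all_iff.2 hw] with ω hω
    ext i; exact hω i
  refine ⟨⟨n, f, w, hf.isBddC2, hwG⟩, φ, fun i => (hφ i).1, ?_, ?_, hlim⟩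
  · filter_upwards [hall] with ω hω
    exact congrArg f hω.symm
  · filter_upwards [hall] with ω hω t
    change _ = ∑ i, fderiv ℝ f (fun i => w i ω) (Pi.single i 1) * φ i t
    rw [hω]

/-- `∫ D(p₁) g(p₂) dμ(p)`. -/
noncomputable def pairing (μ : SignedMeasure (ℝ × ℝ)) (h : ℝ × ℝ → ℝ) (D g : ℝ → ℝ) : ℝ :=
  ∫ p, D p.1 * g p.2 * h p ∂μ.variation

/-- Domination by `Z` puts the section of `DF` in `L²(ν)`, so its pairing with `g k` is an inner
product of Wiener integrals. By Cauchy–Schwarz the error is then at most the `|𝓗|`-norm of `DFn -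
DF` times the norm of the integral of `g k`. -/
theorem IsAbsD12.isGaussDiff [IsProbabilityMeasure P] (hX : IsIntegrator P T X μ)
    (hh : IsPolarDensity μ h) (hΦ : IsWienerMap P T X μ h Φ) {F : Ω → ℝ} {DF : ℝ → Ω → ℝ}
    (hF : IsAbsD12 P T X μ F DF) (hm : Measurable fun p : ℝ × Ω => DF p.1 p.2) {Z : Ω → ℝ}
    (hZ : MemLp Z 2 P) (hDZ : ∀ q ω, |DF q ω| ≤ Z ω) {κ : Type*} {g : κ → ℝ → ℝ}
    (hg : ∀ k, Measurable (g k)) (hgb : ∀ k, ∃ C, ∀ x, |g k x| ≤ C) :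
    IsGaussDiff P T X (fun k => wint Φ (g k)) F
      fun k ω => pairing μ h (fun q => DF q ω) (g k) := by
  have hc := hX.covariance
  have hDm : ∀ ω, Measurable fun q => DF q ω := fun ω => hm.comp measurable_prodMk_right
  have hA : ∀ k, StronglyMeasurable fun ω => pairing μ h (fun q => DF q ω) (g k) := fun k => by
    have hmeas : Measurable fun z : Ω × (ℝ × ℝ) => DF z.2.1 z.1 * g k z.2.2 * h z.2 :=
      ((hm.comp ((measurable_fst.comp measurable_snd).prodMk measurable_fst)).mul
        ((hg k).comp (measurable_snd.comp measurable_snd))).mul (hh.measurable.comp measurable_snd)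
    exact hmeas.stronglyMeasurable.integral_prod_right
  obtain ⟨Fn, DFn, hcyl, hFn, hDFn⟩ := hF.approx
  choose H φ hφ hval hder hlim using fun n => (hcyl n).exists_cylData hX hh hΦ
  refine ⟨hF.memLp, fun k => ?_, H, hFn.congr fun n => eLpNorm_congr_ae ?_, fun k => ?_⟩
  · obtain ⟨C, hC⟩ := hgb k
    have hC0 : 0 ≤ C := (abs_nonneg _).trans (hC 0)
    refine (hZ.mul_const (C * μ.variation.real univ)).mono' (hA k).aestronglyMeasurable
      (Eventually.of_forall fun ω => ?_)
    refine (norm_integral_le_of_norm_le_const (C := Z ω * C) (Eventually.of_forall fun p => ?_)).trans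
      (by rw [mul_assoc])
    rw [norm_mul, norm_mul, Real.norm_eq_abs (h p), hh.abs_eq, mul_one]
    exact mul_le_mul (hDZ _ _) (hC _) (norm_nonneg _) ((abs_nonneg _).trans (hDZ 0 ω))
  · filter_upwards [hval n] with ω hω
    rw [hω]
  · obtain ⟨C, hC⟩ := hgb k
    have hg2 : MemLp (g k) 2 (marginal μ) := memLp_of_bounded (hg k) hC
    have key : ∀ n, eLpNorm (fun ω => (H n).deriv (wint Φ (g k)) ω -
        pairing μ h (fun q => DF q ω) (g k)) 2 P ≤
        ((∫⁻ ω, absHSq μ (fun t => DFn n t ω - DF t ω) ∂P) * ‖wint Φ (g k)‖ₑ ^ 2) ^ (1 / 2 : ℝ) := by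
      intro n
      rw [eLpNorm_eq_lintegral_rpow_enorm_toReal two_ne_zero ENNReal.ofNat_ne_top]
      simp only [ENNReal.toReal_ofNat]
      refine ENNReal.rpow_le_rpow ?_ (by norm_num)
      rw [← lintegral_mul_const' _ _ (by simp)]
      refine lintegral_mono_ae ?_
      filter_upwards [hder n] with ω hω
      have hD2 : MemLp (fun q => DF q ω) 2 (marginal μ) := memLp_of_bounded (hDm ω) fun q => hDZ q ω
      set c : Fin (H n).dim → ℝ := fun i => fderiv ℝ (H n).fn ((H n).rv ω) (Pi.single i 1) with hcdef
      have e1 : (H n).deriv (wint Φ (g k)) ω = inner ℝ (∑ i, c i • (H n).vec i) (wint Φ (g k)) := by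
        rw [CylData.deriv_eq_sum, sum_inner]
        exact Finset.sum_congr rfl fun i _ => by rw [real_inner_smul_left]
      have e2 : pairing μ h (fun q => DF q ω) (g k) = inner ℝ (wint Φ fun q => DF q ω) (wint Φ (g k)) :=
        (inner_wint hc hΦ hD2 hg2).symm
      rw [e1, e2, ← inner_sub_left]
      have hle := enorm_sum_sub_wint_le hX hh hΦ (hφ n) (hlim n) c (hDm ω) fun q => hDZ q ω
      have hfun : (fun x => ∑ i, c i * φ n i x - DF x ω) = fun t => DFn n t ω - DF t ω := by
        ext t; rw [hω t]
      rw [hfun] at hle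
      calc ‖inner ℝ (∑ i, c i • (H n).vec i - wint Φ fun q => DF q ω) (wint Φ (g k))‖ₑ ^ (2 : ℝ)
          ≤ (‖∑ i, c i • (H n).vec i - wint Φ fun q => DF q ω‖ₑ * ‖wint Φ (g k)‖ₑ) ^ (2 : ℝ) := by
            refine ENNReal.rpow_le_rpow ?_ (by norm_num)
            rw [← ofReal_norm, ← ofReal_norm, ← ofReal_norm, ← ENNReal.ofReal_mul (norm_nonneg _)]
            exact ENNReal.ofReal_le_ofReal (norm_inner_le_norm _ _)
        _ ≤ (absHSq μ (fun t => DFn n t ω - DF t ω) ^ (1 / 2 : ℝ) * ‖wint Φ (g k)‖ₑ) ^ (2 : ℝ) := by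
            gcongr
        _ = _ := by
            rw [ENNReal.mul_rpow_of_nonneg _ _ (by norm_num), ← ENNReal.rpow_mul]
            norm_num
    refine tendsto_of_tendsto_of_tendsto_of_le_of_le tendsto_const_nhds ?_ (fun _ => bot_le) key
    refine enorm_sub_rpow_tendsto ?_
    have := ENNReal.Tendsto.mul_const hDFn (b := ‖wint Φ (g k)‖ₑ ^ 2) (Or.inr (by simp))
    simpa using this

end CovMalliavin

/-! ### Averages of divergences over time -/

namespace CovMalliavin

section Fubini

variable {S Θ : Type*} [MeasurableSpace S] [MeasurableSpace Θ] {lam : Measure S}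
  {θ : Measure Θ}

theorem enorm_integral_sq_le {f : S → ℝ} (hf : AEStronglyMeasurable f lam) :
    ‖∫ s, f s ∂lam‖ₑ ^ 2 ≤ lam univ * ∫⁻ s, ‖f s‖ₑ ^ 2 ∂lam := by
  have h1 : ‖∫ s, f s ∂lam‖ₑ ≤ eLpNorm f 1 lam := by
    rw [eLpNorm_one_eq_lintegral_enorm]
    exact enorm_integral_le_lintegral_enorm _
  have h2 := eLpNorm_le_eLpNorm_mul_rpow_measure_univ (one_le_two : (1 : ℝ≥0∞) ≤ 2) hf
  calc ‖∫ s, f s ∂lam‖ₑ ^ 2 ≤ (eLpNorm f 2 lam * lam univ ^ (1 / 2 : ℝ)) ^ 2 := by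
        refine pow_le_pow_left' (h1.trans (h2.trans (le_of_eq ?_))) 2
        norm_num
    _ = lam univ * ∫⁻ s, ‖f s‖ₑ ^ 2 ∂lam := by
        rw [eLpNorm_eq_lintegral_rpow_enorm_toReal two_ne_zero ENNReal.ofNat_ne_top, mul_pow,
          ← ENNReal.rpow_natCast, ← ENNReal.rpow_natCast, ← ENNReal.rpow_mul, ← ENNReal.rpow_mul,
          mul_comm]
        norm_num

variable [IsFiniteMeasure lam] [SFinite θ]

theorem memLp_integral_of_memLp_prod {f : S → Θ → ℝ} (hf : MemLp (fun z : S × Θ => f z.1 z.2) 2 (lam.prod θ)) :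
    MemLp (fun t => ∫ s, f s t ∂lam) 2 θ := by
  have hsw : AEStronglyMeasurable (fun z : Θ × S => f z.2 z.1) (θ.prod lam) :=
    hf.aestronglyMeasurable.prod_swap
  refine ⟨hsw.integral_prod_right', ?_⟩
  rw [eLpNorm_lt_top_iff_lintegral_rpow_enorm_lt_top two_ne_zero ENNReal.ofNat_ne_top]
  have hfin := hf.2
  rw [eLpNorm_lt_top_iff_lintegral_rpow_enorm_lt_top two_ne_zero ENNReal.ofNat_ne_top] at hfin
  simp only [ENNReal.toReal_ofNat, ENNReal.rpow_ofNat] at hfin ⊢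
  have hsec : ∀ᵐ t ∂θ, AEStronglyMeasurable (fun s => f s t) lam := hsw.prodMk_left
  calc ∫⁻ t, ‖∫ s, f s t ∂lam‖ₑ ^ 2 ∂θ ≤ ∫⁻ t, lam univ * ∫⁻ s, ‖f s t‖ₑ ^ 2 ∂lam ∂θ := by
        refine lintegral_mono_ae ?_
        filter_upwards [hsec] with t ht
        exact enorm_integral_sq_le ht
    _ = lam univ * ∫⁻ z, ‖f z.1 z.2‖ₑ ^ 2 ∂(lam.prod θ) := by
        rw [lintegral_const_mul' _ _ (measure_ne_top _ _), lintegral_prod_symm]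
        exact hf.aestronglyMeasurable.enorm.pow_const 2
    _ < ∞ := ENNReal.mul_lt_top (measure_lt_top _ _) hfin

theorem ae_memLp_section {f : S → Θ → ℝ} (hf : MemLp (fun z : S × Θ => f z.1 z.2) 2 (lam.prod θ)) :
    ∀ᵐ s ∂lam, MemLp (f s) 2 θ := by
  have hi := (memLp_two_iff_integrable_sq hf.aestronglyMeasurable).1 hf
  filter_upwards [hi.prod_right_ae, hf.aestronglyMeasurable.prodMk_left] with s h1 h2
  exact (memLp_two_iff_integrable_sq h2).2 h1

theorem integral_mul_integral_comm {f : S → Θ → ℝ} {G : Θ → ℝ}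
    (hf : MemLp (fun z : S × Θ => f z.1 z.2) 2 (lam.prod θ)) (hG : MemLp G 2 θ) :
    ∫ t, G t * (∫ s, f s t ∂lam) ∂θ = ∫ s, ∫ t, G t * f s t ∂θ ∂lam := by
  simp only [← integral_const_mul]
  rw [integral_integral_swap]
  exact ((hG.comp_snd lam).integrable_mul hf).swap

theorem integral_integral_mul_integral {f g : S → Θ → ℝ}
    (hf : MemLp (fun z : S × Θ => f z.1 z.2) 2 (lam.prod θ))
    (hg : MemLp (fun z : S × Θ => g z.1 z.2) 2 (lam.prod θ)) :
    ∫ t, (∫ s, f s t ∂lam) * (∫ s, g s t ∂lam) ∂θ = ∫ s', ∫ s, ∫ t, f s t * g s' t ∂θ ∂lam ∂lam := by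
  rw [integral_mul_integral_comm hg (memLp_integral_of_memLp_prod hf)]
  refine integral_congr_ae ?_
  filter_upwards [ae_memLp_section hg] with s' hs'
  have := integral_mul_integral_comm hf hs'
  simp only [mul_comm (g s' _)] at this
  exact this

end Fubini

variable {Ω : Type*} [MeasurableSpace Ω] {P : Measure Ω} {T : ℝ} {X : ℝ → Ω → ℝ}
  {μ : SignedMeasure (ℝ × ℝ)} {h : ℝ × ℝ → ℝ} {Φ : Lp ℝ 2 (marginal μ) →L[ℝ] Lp ℝ 2 P}
  {lam : Measure ℝ}

/-- A bounded family of weights in `s` that integrate to at most one. -/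
structure IsKernelFamily (lam : Measure ℝ) (κ : ℝ → ℝ → ℝ) : Prop where
  measurable : Measurable fun z : ℝ × ℝ => κ z.1 z.2
  nonneg : ∀ s r, 0 ≤ κ s r
  bdd : ∃ C, ∀ s r, κ s r ≤ C
  integral_le : ∀ r, ∫ s, κ s r ∂lam ≤ 1

/-- The weighted average of `f` at the point `r`. -/
noncomputable def smear (lam : Measure ℝ) (κ : ℝ → ℝ → ℝ) (f : ℝ → ℝ) (r : ℝ) : ℝ :=
  ∫ s, f s * κ s r ∂lam

theorem IsKernelFamily.integrable [IsFiniteMeasure lam] {κ : ℝ → ℝ → ℝ} (hκ : IsKernelFamily lam κ) (r : ℝ) :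
    Integrable (fun s => κ s r) lam := by
  obtain ⟨C, hC⟩ := hκ.bdd
  refine Integrable.of_bound (hκ.measurable.comp measurable_prodMk_right).aestronglyMeasurable C
    (Eventually.of_forall fun s => ?_)
  rw [Real.norm_eq_abs, abs_of_nonneg (hκ.nonneg _ _)]
  exact hC _ _

theorem IsKernelFamily.abs_smear_le [IsFiniteMeasure lam] {κ : ℝ → ℝ → ℝ} (hκ : IsKernelFamily lam κ)
    {f : ℝ → ℝ} {B : ℝ} (hf : ∀ s, |f s| ≤ B) (r : ℝ) : |smear lam κ f r| ≤ B := by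
  have hB : 0 ≤ B := (abs_nonneg _).trans (hf 0)
  calc |smear lam κ f r| ≤ ∫ s, B * κ s r ∂lam := by
        rw [smear, ← Real.norm_eq_abs]
        refine norm_integral_le_of_norm_le ((hκ.integrable r).const_mul B)
          (Eventually.of_forall fun s => ?_)
        rw [norm_mul, Real.norm_eq_abs, Real.norm_eq_abs, abs_of_nonneg (hκ.nonneg s r)]
        exact mul_le_mul_of_nonneg_right (hf s) (hκ.nonneg s r)
    _ = B * ∫ s, κ s r ∂lam := integral_const_mul _ _
    _ ≤ B := mul_le_of_le_one_right hB (hκ.integral_le r)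

/-- The standing assumptions on the integrand and its derivative, after modification on null sets. -/
structure IsDominated (P : Measure Ω) (T : ℝ) (X : ℝ → Ω → ℝ) (μ : SignedMeasure (ℝ × ℝ))
    (lam : Measure ℝ) (Y : ℝ → Ω → ℝ) (D : ℝ → ℝ → Ω → ℝ) (M Z : Ω → ℝ) : Prop where
  measurable : Measurable fun z : ℝ × Ω => Y z.1 z.2
  measurable_deriv : Measurable fun z : ℝ × ℝ × Ω => D z.1 z.2.1 z.2.2
  memLp : MemLp M 2 P
  memLp_deriv : MemLp Z 2 P
  abs_le : ∀ s ω, |Y s ω| ≤ M ω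
  abs_deriv_le : ∀ q s ω, |D q s ω| ≤ Z ω
  differentiable : ∀ᵐ s ∂lam, IsAbsD12 P T X μ (Y s) fun q ω => D q s ω

/-- The integrand of the averaged divergence. -/
noncomputable def divg (μ : SignedMeasure (ℝ × ℝ)) (h : ℝ × ℝ → ℝ) (κ : ℝ → ℝ → ℝ) (Ξ Y : ℝ → Ω → ℝ)
    (D : ℝ → ℝ → Ω → ℝ) (s : ℝ) (ω : Ω) : ℝ :=
  Y s ω * Ξ s ω - pairing μ h (fun q => D q s ω) (κ s)

/-- `Ξ s` is the Wiener integral of the weight `κ s`. -/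
structure IsWienerFamily (lam : Measure ℝ) (P : Measure Ω) (Φ : Lp ℝ 2 (marginal μ) →L[ℝ] Lp ℝ 2 P)
    (κ : ℝ → ℝ → ℝ) (Ξ : ℝ → Ω → ℝ) : Prop where
  measurable : Measurable fun z : ℝ × Ω => Ξ z.1 z.2
  ae_eq : ∀ᵐ s ∂lam, Ξ s =ᵐ[P] wint Φ (κ s)

/-- Bounded measurable functions on the line. -/
abbrev BddMeas := {g : ℝ → ℝ // Measurable g ∧ ∃ C, ∀ x, |g x| ≤ C}

/-- The weights at `s` as a bounded measurable function. -/
def IsKernelFamily.section {κ : ℝ → ℝ → ℝ} (hκ : IsKernelFamily lam κ) (s : ℝ) : BddMeas :=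
  ⟨κ s, hκ.measurable.comp measurable_prodMk_left, hκ.bdd.imp fun C hC r => by
    rw [abs_of_nonneg (hκ.nonneg s r)]; exact hC s r⟩

theorem BddMeas.memLp (g : BddMeas) : MemLp g.1 2 (marginal μ) := by
  obtain ⟨C, hC⟩ := g.2.2
  exact memLp_of_bounded g.2.1 hC

section Gram

variable {Y : ℝ → Ω → ℝ} {D : ℝ → ℝ → Ω → ℝ}
  {M Z : Ω → ℝ} {κ κ' : ℝ → ℝ → ℝ} {Ξ Ξ' : ℝ → Ω → ℝ}

/-- All bounded directions share one approximating sequence. This matters because the isometry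
differentiates `Y_s` in the direction belonging to another time. -/
theorem IsDominated.isGaussDiff [IsProbabilityMeasure P] (hX : IsIntegrator P T X μ) (hh : IsPolarDensity μ h)
    (hΦ : IsWienerMap P T X μ h Φ) (hY : IsDominated P T X μ lam Y D M Z) :
    ∀ᵐ s ∂lam, IsGaussDiff P T X (fun g : BddMeas => wint Φ g.1) (Y s)
      fun g ω => pairing μ h (fun q => D q s ω) g.1 := by
  filter_upwards [hY.differentiable] with s hs
  exact hs.isGaussDiff hX hh hΦ
    (hY.measurable_deriv.comp (measurable_fst.prodMk (measurable_const.prodMk measurable_snd)))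
    hY.memLp_deriv (fun q ω => hY.abs_deriv_le q s ω) (fun g => g.2.1) fun g => g.2.2

theorem IsDominated.measurable_pairing (hh : IsPolarDensity μ h)
    (hY : IsDominated P T X μ lam Y D M Z) (hκ : IsKernelFamily lam κ) :
    Measurable fun z : ℝ × Ω => pairing μ h (fun q => D q z.1 z.2) (κ z.1) := by
  have h1 : Measurable fun z : (ℝ × Ω) × (ℝ × ℝ) => D z.2.1 z.1.1 z.1.2 :=
    hY.measurable_deriv.comp (by fun_prop : Measurable fun z : (ℝ × Ω) × (ℝ × ℝ) =>
      (z.2.1, z.1.1, z.1.2))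
  have h2 : Measurable fun z : (ℝ × Ω) × (ℝ × ℝ) => κ z.1.1 z.2.2 :=
    hκ.measurable.comp (by fun_prop : Measurable fun z : (ℝ × Ω) × (ℝ × ℝ) => (z.1.1, z.2.2))
  have h3 : Measurable fun z : (ℝ × Ω) × (ℝ × ℝ) => D z.2.1 z.1.1 z.1.2 * κ z.1.1 z.2.2 * h z.2 :=
    (h1.mul h2).mul (hh.measurable.comp measurable_snd)
  exact h3.stronglyMeasurable.integral_prod_right.measurable

theorem abs_pairing_le (hh : IsPolarDensity μ h) {d g : ℝ → ℝ} {B C : ℝ} (hd : ∀ q, |d q| ≤ B)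
    (hg : ∀ r, |g r| ≤ C) : |pairing μ h d g| ≤ B * (C * μ.variation.real univ) := by
  rw [pairing, ← Real.norm_eq_abs]
  refine (norm_integral_le_of_norm_le_const (C := B * C) (Eventually.of_forall fun p => ?_)).trans
    (by rw [mul_assoc])
  rw [norm_mul, norm_mul, Real.norm_eq_abs (h p), hh.abs_eq, mul_one]
  exact mul_le_mul (hd _) (hg _) (norm_nonneg _) ((abs_nonneg _).trans (hd 0))

variable [IsProbabilityMeasure P] [IsFiniteMeasure lam]

/-- At equal times the isometry bounds the second moment of the divergence uniformly in `s`, by `E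
M²`, `E Z²` and the supremum of the weights. -/
theorem IsDominated.memLp_divg (hX : IsIntegrator P T X μ) (hh : IsPolarDensity μ h)
    (hΦ : IsWienerMap P T X μ h Φ) (hY : IsDominated P T X μ lam Y D M Z)
    (hκ : IsKernelFamily lam κ) (hΞ : IsWienerFamily lam P Φ κ Ξ) :
    MemLp (fun z : ℝ × Ω => divg μ h κ Ξ Y D z.1 z.2) 2 (lam.prod P) := by
  have hm : Measurable fun z : ℝ × Ω => divg μ h κ Ξ Y D z.1 z.2 :=
    (hY.measurable.mul hΞ.measurable).sub (hY.measurable_pairing hh hκ)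
  have hs : StronglyMeasurable fun z : ℝ × Ω => divg μ h κ Ξ Y D z.1 z.2 ^ 2 :=
    (hm.pow_const 2).stronglyMeasurable
  rw [memLp_two_iff_integrable_sq hm.aestronglyMeasurable,
    integrable_prod_iff hs.aestronglyMeasurable]
  obtain ⟨C, hC⟩ := hκ.bdd
  have hCa : ∀ s r, |κ s r| ≤ C := fun s r => by rw [abs_of_nonneg (hκ.nonneg s r)]; exact hC s r
  have hC0 : 0 ≤ C := (abs_nonneg _).trans (hCa 0 0)
  have hξ : ∀ g : BddMeas, wint Φ g.1 ∈ gaussSpace P T X := fun g => wint_mem hΦ _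
  have hsec : ∀ᵐ s ∂lam, MemLp (divg μ h κ Ξ Y D s) 2 P ∧ ∫ ω, divg μ h κ Ξ Y D s ω ^ 2 ∂P ≤
      (∫ ω, M ω ^ 2 ∂P) * (C * C * μ.variation.real univ) +
        (∫ ω, Z ω ^ 2 ∂P) * (C * μ.variation.real univ) ^ 2 := by
    filter_upwards [hY.isGaussDiff hX hh hΦ, hΞ.ae_eq] with s hs hΞs
    have hae : divg μ h κ Ξ Y D s =ᵐ[P] fun ω => Y s ω * wint Φ (hκ.section s).1 ω -
        pairing μ h (fun q => D q s ω) (hκ.section s).1 := by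
      filter_upwards [hΞs] with ω hω
      simp only [divg, hω, IsKernelFamily.section]
    refine ⟨(hs.memLp_div hX hξ (hκ.section s)).ae_eq hae.symm, ?_⟩
    have e : ∫ ω, divg μ h κ Ξ Y D s ω ^ 2 ∂P = _ :=
      (integral_congr_ae (hae.mono fun ω hω => by rw [pow_two, hω])).trans
        (hs.integral_div_mul_div hX hξ hs (hκ.section s) (hκ.section s))
    rw [e, inner_wint hX.covariance hΦ (hκ.section s).memLp (hκ.section s).memLp]
    refine add_le_add (mul_le_mul ?_ ?_ ?_ (by positivity)) ?_
    · refine integral_mono (hs.1.integrable_mul hs.1) hY.memLp.integrable_sq fun ω => ?_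
      calc Y s ω * Y s ω = |Y s ω| ^ 2 := by rw [sq_abs]; ring
        _ ≤ M ω ^ 2 := pow_le_pow_left₀ (abs_nonneg _) (hY.abs_le s ω) 2
    · exact (le_abs_self _).trans ((abs_pairing_le hh (hCa s) (hCa s)).trans (by rw [mul_assoc]))
    · rw [← inner_wint hX.covariance hΦ (hκ.section s).memLp (hκ.section s).memLp]
      exact real_inner_self_nonneg
    · rw [← integral_mul_const]
      refine integral_mono ((hs.2.1 (hκ.section s)).integrable_mul (hs.2.1 (hκ.section s)))
        (hY.memLp_deriv.integrable_sq.mul_const _) fun ω => ?_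
      have := abs_pairing_le hh (fun q => hY.abs_deriv_le q s ω) (hCa s)
      calc _ = |pairing μ h (fun q => D q s ω) (κ s)| ^ 2 := by
            rw [sq_abs, pow_two]; rfl
        _ ≤ (Z ω * (C * μ.variation.real univ)) ^ 2 := pow_le_pow_left₀ (abs_nonneg _) this 2
        _ = _ := mul_pow _ _ _
  refine ⟨hsec.mono fun s hs => hs.1.integrable_sq, ?_⟩
  refine Integrable.of_bound (C := (∫ ω, M ω ^ 2 ∂P) * (C * C * μ.variation.real univ) +
        (∫ ω, Z ω ^ 2 ∂P) * (C * μ.variation.real univ) ^ 2)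
    hs.norm.integral_prod_right.aestronglyMeasurable (hsec.mono fun s hs => ?_)
  rw [Real.norm_eq_abs, abs_of_nonneg (integral_nonneg fun ω => norm_nonneg _)]
  refine le_trans (le_of_eq ?_) hs.2
  congr 1
  ext ω
  rw [Real.norm_eq_abs, abs_of_nonneg (sq_nonneg _)]

end Gram

end CovMalliavin

/-! ### The Gram matrix of the averaged divergences -/

namespace CovMalliavin

section Fubini

variable {S Θ : Type*} [MeasurableSpace S] [MeasurableSpace Θ] {lam : Measure S}
  {θ : Measure Θ} [IsFiniteMeasure lam] [SFinite θ] {f g : S → Θ → ℝ}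

theorem ae_integrable_integral_mul (hf : MemLp (fun z : S × Θ => f z.1 z.2) 2 (lam.prod θ))
    (hg : MemLp (fun z : S × Θ => g z.1 z.2) 2 (lam.prod θ)) :
    ∀ᵐ s' ∂lam, Integrable (fun s => ∫ t, f s t * g s' t ∂θ) lam := by
  filter_upwards [ae_memLp_section hg] with s' hs'
  exact (hf.integrable_mul (hs'.comp_snd lam)).integral_prod_left

theorem integrable_integral_integral_mul (hf : MemLp (fun z : S × Θ => f z.1 z.2) 2 (lam.prod θ))
    (hg : MemLp (fun z : S × Θ => g z.1 z.2) 2 (lam.prod θ)) :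
    Integrable (fun s' => ∫ s, ∫ t, f s t * g s' t ∂θ ∂lam) lam := by
  refine (((memLp_integral_of_memLp_prod hf).comp_snd lam).integrable_mul hg).integral_prod_left.congr ?_
  filter_upwards [ae_memLp_section hg] with s' hs'
  have := integral_mul_integral_comm hf hs'
  simp only [mul_comm (g s' _)] at this
  exact this

end Fubini

variable {Ω : Type*} [MeasurableSpace Ω] {P : Measure Ω} {T : ℝ} {X : ℝ → Ω → ℝ}
  {μ : SignedMeasure (ℝ × ℝ)} {h : ℝ × ℝ → ℝ} {Φ : Lp ℝ 2 (marginal μ) →L[ℝ] Lp ℝ 2 P}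
  {lam : Measure ℝ} {Y : ℝ → Ω → ℝ} {D : ℝ → ℝ → Ω → ℝ}
  {M Z : Ω → ℝ} {κ κ' : ℝ → ℝ → ℝ} {Ξ Ξ' : ℝ → Ω → ℝ}

theorem IsKernelFamily.measurable_smear [SFinite lam] (hκ : IsKernelFamily lam κ) {A : Type*}
    [MeasurableSpace A] {f : A → ℝ → ℝ} (hf : Measurable fun z : A × ℝ => f z.1 z.2) {r : A → ℝ}
    (hr : Measurable r) : Measurable fun a => smear lam κ (f a) (r a) := by
  have : Measurable fun z : A × ℝ => f z.1 z.2 * κ z.2 (r z.1) :=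
    hf.mul (hκ.measurable.comp (measurable_snd.prodMk (hr.comp measurable_fst)))
  exact this.stronglyMeasurable.integral_prod_right.measurable

theorem IsDominated.measurable_smear [SFinite lam] (hY : IsDominated P T X μ lam Y D M Z)
    (hκ : IsKernelFamily lam κ) {A : Type*} [MeasurableSpace A] {r : A → ℝ} {w : A → Ω}
    (hr : Measurable r) (hw : Measurable w) :
    Measurable fun a => smear lam κ (fun s => Y s (w a)) (r a) :=
  hκ.measurable_smear (f := fun a s => Y s (w a))
    (hY.measurable.comp (measurable_snd.prodMk (hw.comp measurable_fst))) hr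

theorem IsDominated.measurable_smear_deriv [SFinite lam] (hY : IsDominated P T X μ lam Y D M Z)
    (hκ : IsKernelFamily lam κ) {A : Type*} [MeasurableSpace A] {q r : A → ℝ} {w : A → Ω}
    (hq : Measurable q) (hr : Measurable r) (hw : Measurable w) :
    Measurable fun a => smear lam κ (fun s => D (q a) s (w a)) (r a) :=
  hκ.measurable_smear (f := fun a s => D (q a) s (w a))
    (hY.measurable_deriv.comp
      ((hq.comp measurable_fst).prodMk (measurable_snd.prodMk (hw.comp measurable_fst)))) hr

theorem IsKernelFamily.exists_abs_le (hκ : IsKernelFamily lam κ) :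
    ∃ C, 0 ≤ C ∧ ∀ s r, |κ s r| ≤ C := by
  obtain ⟨C, hC⟩ := hκ.bdd
  exact ⟨C, (hκ.nonneg 0 0).trans (hC 0 0), fun s r => by
    rw [abs_of_nonneg (hκ.nonneg s r)]; exact hC s r⟩

section Gram

variable [IsProbabilityMeasure P] [IsFiniteMeasure lam]

theorem IsDominated.memLp_mul_kernel (hY : IsDominated P T X μ lam Y D M Z)
    (hκ : IsKernelFamily lam κ) {A : Type*} [MeasurableSpace A] {η : Measure A} [IsFiniteMeasure η]
    {r k : A → ℝ} (hr : Measurable r) (hk : Measurable k) (hk1 : ∀ a, |k a| = 1) :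
    MemLp (fun z : ℝ × (Ω × A) => Y z.1 z.2.1 * κ z.1 (r z.2.2) * k z.2.2) 2
      (lam.prod (P.prod η)) := by
  obtain ⟨C, hC0, hC⟩ := hκ.exists_abs_le
  refine (((hY.memLp.comp_fst η).comp_snd lam).mul_const C).mono' ?_
    (Eventually.of_forall fun z => ?_)
  · exact (((hY.measurable.comp (by fun_prop : Measurable fun z : ℝ × (Ω × A) => (z.1, z.2.1))).mul
      (hκ.measurable.comp (by fun_prop : Measurable fun z : ℝ × (Ω × A) => (z.1, r z.2.2)))).mul
      (hk.comp (measurable_snd.comp measurable_snd))).aestronglyMeasurable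
  · rw [norm_mul, norm_mul, Real.norm_eq_abs, Real.norm_eq_abs, Real.norm_eq_abs, hk1, mul_one]
    exact mul_le_mul (hY.abs_le _ _) (hC _ _) (abs_nonneg _) ((abs_nonneg _).trans (hY.abs_le 0 _))

theorem IsDominated.memLp_deriv_mul_kernel (hY : IsDominated P T X μ lam Y D M Z)
    (hκ : IsKernelFamily lam κ) {A : Type*} [MeasurableSpace A] {η : Measure A} [IsFiniteMeasure η]
    {q r k : A → ℝ} (hq : Measurable q) (hr : Measurable r) (hk : Measurable k) (hk1 : ∀ a, |k a| = 1) :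
    MemLp (fun z : ℝ × (Ω × A) => D (q z.2.2) z.1 z.2.1 * κ z.1 (r z.2.2) * k z.2.2) 2
      (lam.prod (P.prod η)) := by
  obtain ⟨C, hC0, hC⟩ := hκ.exists_abs_le
  refine (((hY.memLp_deriv.comp_fst η).comp_snd lam).mul_const C).mono' ?_
    (Eventually.of_forall fun z => ?_)
  · exact (((hY.measurable_deriv.comp
      (by fun_prop : Measurable fun z : ℝ × (Ω × A) => (q z.2.2, z.1, z.2.1))).mul
      (hκ.measurable.comp (by fun_prop : Measurable fun z : ℝ × (Ω × A) => (z.1, r z.2.2)))).mul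
      (hk.comp (measurable_snd.comp measurable_snd))).aestronglyMeasurable
  · rw [norm_mul, norm_mul, Real.norm_eq_abs, Real.norm_eq_abs, Real.norm_eq_abs, hk1, mul_one]
    exact mul_le_mul (hY.abs_deriv_le _ _ _) (hC _ _) (abs_nonneg _)
      ((abs_nonneg _).trans (hY.abs_deriv_le 0 0 _))

/-- The isometry at two times, written over product spaces so that the time integrals can later be
moved inside. The derivative term lives on two copies of `μ`: each derivative takes its argument
from one copy and its weight from the other. The density is attached to one factor only, whence the
trailing `1` in the other. -/
theorem IsDominated.integral_divg_mul_divg (hX : IsIntegrator P T X μ) (hh : IsPolarDensity μ h)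
    (hΦ : IsWienerMap P T X μ h Φ) (hY : IsDominated P T X μ lam Y D M Z)
    (hκ : IsKernelFamily lam κ) (hΞ : IsWienerFamily lam P Φ κ Ξ)
    (hκ' : IsKernelFamily lam κ') (hΞ' : IsWienerFamily lam P Φ κ' Ξ') :
    ∀ᵐ s' ∂lam, ∀ᵐ s ∂lam, ∫ ω, divg μ h κ Ξ Y D s ω * divg μ h κ' Ξ' Y D s' ω ∂P =
      ∫ z : Ω × (ℝ × ℝ), (Y s z.1 * κ s z.2.2 * h z.2) * (Y s' z.1 * κ' s' z.2.1 * 1)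
        ∂(P.prod μ.variation) +
      ∫ z : Ω × ((ℝ × ℝ) × (ℝ × ℝ)), (D z.2.1.1 s z.1 * κ s z.2.2.2 * (h z.2.1 * h z.2.2)) *
        (D z.2.2.1 s' z.1 * κ' s' z.2.1.2 * 1) ∂(P.prod (μ.variation.prod μ.variation)) := by
  have hξ : ∀ g : BddMeas, wint Φ g.1 ∈ gaussSpace P T X := fun g => wint_mem hΦ _
  have hh1 : ∀ a : (ℝ × ℝ) × (ℝ × ℝ), |h a.1 * h a.2| = 1 := fun a => by
    rw [abs_mul, hh.abs_eq, hh.abs_eq, one_mul]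
  have hhm : Measurable fun a : (ℝ × ℝ) × (ℝ × ℝ) => h a.1 * h a.2 :=
    (hh.measurable.comp measurable_fst).mul (hh.measurable.comp measurable_snd)
  have m3 := ae_memLp_section (θ := P.prod (μ.variation.prod μ.variation))
    (f := fun s (z : Ω × ((ℝ × ℝ) × (ℝ × ℝ))) =>
    D z.2.1.1 s z.1 * κ s z.2.2.2 * (h z.2.1 * h z.2.2))
    (hY.memLp_deriv_mul_kernel hκ (η := μ.variation.prod μ.variation)
      (measurable_fst.comp measurable_fst) (measurable_snd.comp measurable_snd) hhm hh1)
  have m4 := ae_memLp_section (θ := P.prod (μ.variation.prod μ.variation))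
    (f := fun s (z : Ω × ((ℝ × ℝ) × (ℝ × ℝ))) => D z.2.2.1 s z.1 * κ' s z.2.1.2 * 1)
    (hY.memLp_deriv_mul_kernel hκ' (η := μ.variation.prod μ.variation) (k := fun _ => 1)
      (measurable_fst.comp measurable_snd) (measurable_snd.comp measurable_fst) measurable_const
      (by simp))
  filter_upwards [hY.isGaussDiff hX hh hΦ, hΞ'.ae_eq, m4] with s' hs' hΞs' hm4
  filter_upwards [hY.isGaussDiff hX hh hΦ, hΞ.ae_eq, m3] with s hs hΞs hm3
  have e : ∫ ω, divg μ h κ Ξ Y D s ω * divg μ h κ' Ξ' Y D s' ω ∂P = _ :=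
    (integral_congr_ae (by
      filter_upwards [hΞs, hΞs'] with ω h1 h2
      simp only [divg, h1, h2]; rfl)).trans
      (hs.integral_div_mul_div hX hξ hs' (hκ.section s) (hκ'.section s'))
  rw [e]
  congr 1
  · rw [inner_wint hX.covariance hΦ (hκ'.section s').memLp (hκ.section s).memLp, ← integral_prod_mul]
    refine integral_congr_ae (Eventually.of_forall fun z => ?_)
    simp only [IsKernelFamily.section]
    ring
  · refine Eq.trans ?_ (integral_prod _ (hm3.integrable_mul hm4)).symm
    refine integral_congr_ae (Eventually.of_forall fun ω => ?_)
    simp only [pairing, IsKernelFamily.section, ← integral_prod_mul]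
    refine integral_congr_ae (Eventually.of_forall fun z => ?_)
    simp only [Pi.mul_apply]
    ring

/-- Fubini lets each time integral act on its own weight, so only smeared values of `Y` and `D`
remain. The weights, which blow up as the windows shrink, no longer occur outside an average. -/
theorem IsDominated.integral_mean_mul_mean (hX : IsIntegrator P T X μ) (hh : IsPolarDensity μ h)
    (hΦ : IsWienerMap P T X μ h Φ) (hY : IsDominated P T X μ lam Y D M Z)
    (hκ : IsKernelFamily lam κ) (hΞ : IsWienerFamily lam P Φ κ Ξ)
    (hκ' : IsKernelFamily lam κ') (hΞ' : IsWienerFamily lam P Φ κ' Ξ') :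
    ∫ ω, (∫ s, divg μ h κ Ξ Y D s ω ∂lam) * (∫ s, divg μ h κ' Ξ' Y D s ω ∂lam) ∂P =
      ∫ z : Ω × (ℝ × ℝ), smear lam κ (fun s => Y s z.1) z.2.2 * h z.2 *
        smear lam κ' (fun s => Y s z.1) z.2.1 ∂(P.prod μ.variation) +
      ∫ z : Ω × ((ℝ × ℝ) × (ℝ × ℝ)), smear lam κ (fun s => D z.2.1.1 s z.1) z.2.2.2 *
        (h z.2.1 * h z.2.2) * smear lam κ' (fun s => D z.2.2.1 s z.1) z.2.1.2
        ∂(P.prod (μ.variation.prod μ.variation)) := by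
  have hh1 : ∀ a : (ℝ × ℝ) × (ℝ × ℝ), |h a.1 * h a.2| = 1 := fun a => by
    rw [abs_mul, hh.abs_eq, hh.abs_eq, one_mul]
  have hhm : Measurable fun a : (ℝ × ℝ) × (ℝ × ℝ) => h a.1 * h a.2 :=
    (hh.measurable.comp measurable_fst).mul (hh.measurable.comp measurable_snd)
  have m1 := hY.memLp_mul_kernel hκ (η := μ.variation) measurable_snd hh.measurable hh.abs_eq
  have m2 := hY.memLp_mul_kernel hκ' (η := μ.variation) (k := fun _ => 1) measurable_fst
    measurable_const (by simp)
  have m3 := hY.memLp_deriv_mul_kernel hκ (η := μ.variation.prod μ.variation)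
    (measurable_fst.comp measurable_fst) (measurable_snd.comp measurable_snd) hhm hh1
  have m4 := hY.memLp_deriv_mul_kernel hκ' (η := μ.variation.prod μ.variation) (k := fun _ => 1)
      (measurable_fst.comp measurable_snd) (measurable_snd.comp measurable_fst) measurable_const
      (by simp)
  rw [integral_integral_mul_integral (hY.memLp_divg hX hh hΦ hκ hΞ) (hY.memLp_divg hX hh hΦ hκ' hΞ')]
  have e1 := integral_integral_mul_integral (θ := P.prod μ.variation)
    (f := fun s (z : Ω × (ℝ × ℝ)) => Y s z.1 * κ s z.2.2 * h z.2)
    (g := fun s (z : Ω × (ℝ × ℝ)) => Y s z.1 * κ' s z.2.1 * 1) m1 m2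
  have e2 := integral_integral_mul_integral (θ := P.prod (μ.variation.prod μ.variation))
    (f := fun s (z : Ω × ((ℝ × ℝ) × (ℝ × ℝ))) => D z.2.1.1 s z.1 * κ s z.2.2.2 * (h z.2.1 * h z.2.2))
    (g := fun s (z : Ω × ((ℝ × ℝ) × (ℝ × ℝ))) => D z.2.2.1 s z.1 * κ' s z.2.1.2 * 1) m3 m4
  have i1 := integrable_integral_integral_mul (θ := P.prod μ.variation)
    (f := fun s (z : Ω × (ℝ × ℝ)) => Y s z.1 * κ s z.2.2 * h z.2)
    (g := fun s (z : Ω × (ℝ × ℝ)) => Y s z.1 * κ' s z.2.1 * 1) m1 m2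
  have i2 := integrable_integral_integral_mul (θ := P.prod (μ.variation.prod μ.variation))
    (f := fun s (z : Ω × ((ℝ × ℝ) × (ℝ × ℝ))) => D z.2.1.1 s z.1 * κ s z.2.2.2 * (h z.2.1 * h z.2.2))
    (g := fun s (z : Ω × ((ℝ × ℝ) × (ℝ × ℝ))) => D z.2.2.1 s z.1 * κ' s z.2.1.2 * 1) m3 m4
  have j1 := ae_integrable_integral_mul (θ := P.prod μ.variation)
    (f := fun s (z : Ω × (ℝ × ℝ)) => Y s z.1 * κ s z.2.2 * h z.2)
    (g := fun s (z : Ω × (ℝ × ℝ)) => Y s z.1 * κ' s z.2.1 * 1) m1 m2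
  have j2 := ae_integrable_integral_mul (θ := P.prod (μ.variation.prod μ.variation))
    (f := fun s (z : Ω × ((ℝ × ℝ) × (ℝ × ℝ))) => D z.2.1.1 s z.1 * κ s z.2.2.2 * (h z.2.1 * h z.2.2))
    (g := fun s (z : Ω × ((ℝ × ℝ) × (ℝ × ℝ))) => D z.2.2.1 s z.1 * κ' s z.2.1.2 * 1) m3 m4
  have e3 := integral_add i1 i2
  rw [← e1, ← e2] at e3
  simp only [integral_mul_const, mul_one] at e3
  simp only [smear]
  rw [← e3]
  refine integral_congr_ae ?_
  filter_upwards [hY.integral_divg_mul_divg hX hh hΦ hκ hΞ hκ' hΞ', j1, j2] with s' hs' hj1 hj2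
  rw [integral_congr_ae hs', integral_add hj1 hj2]
  simp only [mul_one]

end Gram

/-! ### Limits of the averaged divergences and of the trace terms -/

section Limit

variable [IsProbabilityMeasure P] [IsFiniteMeasure lam] {l : Filter ℝ} [l.IsCountablyGenerated]
  {k : ℝ → ℝ → ℝ → ℝ} {W : ℝ → ℝ → Ω → ℝ} {u : Ω → ℝ → ℝ} {K : Ω → ℝ × ℝ → ℝ}

theorem ae_prod_snd {p : Ω × ℝ → Prop} (hp : ∀ᵐ z ∂(P.prod (marginal μ)), p z) :
    ∀ᵐ z : Ω × (ℝ × ℝ) ∂(P.prod μ.variation), p (z.1, z.2.2) :=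
  ((MeasurePreserving.id P).prod (measurePreserving_snd μ)).quasiMeasurePreserving.ae hp

theorem ae_prod_fst (hc : IsCovarianceMeasure P T X μ) {p : Ω × ℝ → Prop}
    (hp : ∀ᵐ z ∂(P.prod (marginal μ)), p z) :
    ∀ᵐ z : Ω × (ℝ × ℝ) ∂(P.prod μ.variation), p (z.1, z.2.1) :=
  ((MeasurePreserving.id P).prod hc.measurePreserving_fst).quasiMeasurePreserving.ae hp

/-- Coordinates taken from two independent copies of `|μ|` are distributed according to `ν ⊗ ν`;
hence the crossed derivative term sees the regularity of `DY` only up to `ν ⊗ ν`-null sets. -/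
theorem ae_prod_fst_snd (hc : IsCovarianceMeasure P T X μ) {p : Ω × (ℝ × ℝ) → Prop}
    (hp : ∀ᵐ z ∂(P.prod ((marginal μ).prod (marginal μ))), p z) :
    ∀ᵐ z : Ω × ((ℝ × ℝ) × (ℝ × ℝ)) ∂(P.prod (μ.variation.prod μ.variation)),
      p (z.1, (z.2.1.1, z.2.2.2)) :=
  ((MeasurePreserving.id P).prod
    (hc.measurePreserving_fst.prod (measurePreserving_snd μ))).quasiMeasurePreserving.ae hp

theorem ae_prod_snd_fst (hc : IsCovarianceMeasure P T X μ) {p : Ω × (ℝ × ℝ) → Prop}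
    (hp : ∀ᵐ z ∂(P.prod ((marginal μ).prod (marginal μ))), p z) :
    ∀ᵐ z : Ω × ((ℝ × ℝ) × (ℝ × ℝ)) ∂(P.prod (μ.variation.prod μ.variation)),
      p (z.1, (z.2.2.1, z.2.1.2)) :=
  ((MeasurePreserving.id P).prod (Measure.measurePreserving_swap (μ := μ.variation)
    (ν := μ.variation))).quasiMeasurePreserving.ae (ae_prod_fst_snd hc hp)

theorem abs_mul_mul_le {a b c B : ℝ} (ha : |a| ≤ B) (hb : |b| = 1) (hc : |c| ≤ B) :
    ‖a * b * c‖ ≤ B ^ 2 := by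
  rw [norm_mul, norm_mul, Real.norm_eq_abs, Real.norm_eq_abs, Real.norm_eq_abs, hb, mul_one, pow_two]
  exact mul_le_mul ha hc (abs_nonneg _) ((abs_nonneg _).trans ha)

/-- The averaged divergences converge in `L²`. -/
theorem IsDominated.exists_tendsto_mean [NeBot l] (hX : IsIntegrator P T X μ) (hh : IsPolarDensity μ h)
    (hΦ : IsWienerMap P T X μ h Φ) (hY : IsDominated P T X μ lam Y D M Z)
    (hk : ∀ i, IsKernelFamily lam (k i)) (hW : ∀ i, IsWienerFamily lam P Φ (k i) (W i))
    (hu : ∀ᵐ z ∂(P.prod (marginal μ)),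
      Tendsto (fun i => smear lam (k i) (fun s => Y s z.1) z.2) l (𝓝 (u z.1 z.2)))
    (hK : ∀ᵐ z ∂(P.prod ((marginal μ).prod (marginal μ))),
      Tendsto (fun i => smear lam (k i) (fun s => D z.2.1 s z.1) z.2.2) l (𝓝 (K z.1 z.2))) :
    ∃ S : Ω → ℝ, MemLp S 2 P ∧ Tendsto (fun i => eLpNorm (fun ω =>
      (∫ s, divg μ h (k i) (W i) Y D s ω ∂lam) - S ω) 2 P) l (𝓝 0) := by
  have hc := hX.covariance
  -- Smearing does not increase the bounds `M` and `Z`, so the two parts of the Gram matrix converge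
  -- by dominated convergence with `M²` and `Z²`.
  refine exists_tendsto_of_tendsto_integral_mul (Eventually.of_forall fun i =>
    memLp_integral_of_memLp_prod (hY.memLp_divg hX hh hΦ (hk i) (hW i)))
    (c := ∫ z : Ω × (ℝ × ℝ), u z.1 z.2.2 * h z.2 * u z.1 z.2.1 ∂(P.prod μ.variation) +
      ∫ z : Ω × ((ℝ × ℝ) × (ℝ × ℝ)), K z.1 (z.2.1.1, z.2.2.2) *
        (h z.2.1 * h z.2.2) * K z.1 (z.2.2.1, z.2.1.2)
        ∂(P.prod (μ.variation.prod μ.variation))) ?_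
  simp only [fun p : ℝ × ℝ => hY.integral_mean_mul_mean hX hh hΦ (hk p.1) (hW p.1) (hk p.2) (hW p.2)]
  have hhm : Measurable fun a : Ω × ((ℝ × ℝ) × (ℝ × ℝ)) => h a.2.1 * h a.2.2 :=
    (hh.measurable.comp (by fun_prop)).mul (hh.measurable.comp (by fun_prop))
  refine Tendsto.add ?_ ?_
  · refine tendsto_integral_filter_of_dominated_convergence (fun z => M z.1 ^ 2)
      (Eventually.of_forall fun p => ?_) (Eventually.of_forall fun p => Eventually.of_forall fun z => ?_)
      (hY.memLp.integrable_sq.comp_fst _) ?_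
    · exact (((hY.measurable_smear (hk _) (by fun_prop) (by fun_prop)).mul
        (hh.measurable.comp measurable_snd)).mul
        (hY.measurable_smear (hk _) (by fun_prop) (by fun_prop))).aestronglyMeasurable
    · exact abs_mul_mul_le ((hk _).abs_smear_le (fun s => hY.abs_le s z.1) _) (hh.abs_eq _)
        ((hk _).abs_smear_le (fun s => hY.abs_le s z.1) _)
    · filter_upwards [ae_prod_fst hc hu, ae_prod_snd hu] with z h1 h2
      exact ((h2.comp tendsto_fst).mul_const _).mul (h1.comp tendsto_snd)
  · refine tendsto_integral_filter_of_dominated_convergence (fun z => Z z.1 ^ 2)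
      (Eventually.of_forall fun p => ?_) (Eventually.of_forall fun p => Eventually.of_forall fun z => ?_)
      (hY.memLp_deriv.integrable_sq.comp_fst _) ?_
    · exact (((hY.measurable_smear_deriv (hk _) (by fun_prop) (by fun_prop) (by fun_prop)).mul hhm).mul
        (hY.measurable_smear_deriv (hk _) (by fun_prop) (by fun_prop)
          (by fun_prop))).aestronglyMeasurable
    · refine abs_mul_mul_le ((hk _).abs_smear_le (fun s => hY.abs_deriv_le _ s z.1) _) ?_
        ((hk _).abs_smear_le (fun s => hY.abs_deriv_le _ s z.1) _)
      rw [abs_mul, hh.abs_eq, hh.abs_eq, one_mul]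
    · filter_upwards [ae_prod_fst_snd hc hK, ae_prod_snd_fst hc hK] with z h1 h2
      exact ((h1.comp tendsto_fst).mul_const _).mul (h2.comp tendsto_snd)

/-- Convergence of the trace terms. -/
theorem IsDominated.tendsto_trace (hh : IsPolarDensity μ h)
    (hY : IsDominated P T X μ lam Y D M Z) (hk : ∀ i, IsKernelFamily lam (k i))
    {L : Ω → ℝ × ℝ → ℝ} (hLm : Measurable fun z : Ω × (ℝ × ℝ) => L z.1 z.2)
    (hLb : ∀ ω p, |L ω p| ≤ Z ω)
    (hL : ∀ᵐ z ∂(P.prod μ.variation),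
      Tendsto (fun i => smear lam (k i) (fun s => D z.2.1 s z.1) z.2.2) l (𝓝 (L z.1 z.2))) :
    TendstoInMeasure P (fun i ω => ∫ p, smear lam (k i) (fun s => D p.1 s ω) p.2 * h p ∂μ.variation) l
      fun ω => ∫ p, L ω p * h p ∂μ.variation := by
  have mS : ∀ i, Measurable fun z : Ω × (ℝ × ℝ) => smear lam (k i) (fun s => D z.2.1 s z.1) z.2.2 :=
    fun i => hY.measurable_smear_deriv (hk i) (by fun_prop) (by fun_prop) (by fun_prop)
  have mh : Measurable fun z : Ω × (ℝ × ℝ) => h z.2 := hh.measurable.comp measurable_snd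
  have mI : ∀ i, StronglyMeasurable fun ω =>
      ∫ p, smear lam (k i) (fun s => D p.1 s ω) p.2 * h p ∂μ.variation :=
    fun i => ((mS i).mul mh).stronglyMeasurable.integral_prod_right
  have mL : StronglyMeasurable fun ω => ∫ p, L ω p * h p ∂μ.variation :=
    (hLm.mul mh).stronglyMeasurable.integral_prod_right
  refine tendstoInMeasure_of_tendsto_eLpNorm (p := 1) one_ne_zero
    (fun i => (mI i).aestronglyMeasurable) mL.aestronglyMeasurable ?_
  -- Convergence in `L¹(P ⊗ |μ|)`, dominated by `2Z`, is stronger than what is needed: integrating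
  -- out `p` gives `L¹(P)` convergence, hence convergence in measure.
  have hlim : Tendsto (fun i => ∫⁻ z : Ω × (ℝ × ℝ),
      ‖smear lam (k i) (fun s => D z.2.1 s z.1) z.2.2 - L z.1 z.2‖ₑ ∂(P.prod μ.variation)) l (𝓝 0) := by
    have h0 : ∫⁻ _ : Ω × (ℝ × ℝ), (0 : ℝ≥0∞) ∂(P.prod μ.variation) = 0 := by simp
    rw [← h0]
    have hint : Integrable (fun z : Ω × (ℝ × ℝ) => Z z.1 + Z z.1) (P.prod μ.variation) :=
      ((hY.memLp_deriv.integrable one_le_two).comp_fst _).add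
        ((hY.memLp_deriv.integrable one_le_two).comp_fst _)
    refine tendsto_lintegral_filter_of_dominated_convergence (fun z => ‖Z z.1 + Z z.1‖ₑ)
      (Eventually.of_forall fun i => ((mS i).sub hLm).enorm)
      (Eventually.of_forall fun i => Eventually.of_forall fun z => ?_) hint.2.ne ?_
    · rw [← ofReal_norm, ← ofReal_norm]
      refine ENNReal.ofReal_le_ofReal ((norm_sub_le _ _).trans (le_trans ?_ (le_abs_self _)))
      exact add_le_add ((hk i).abs_smear_le (fun s => hY.abs_deriv_le _ s z.1) _) (hLb _ _)
    · filter_upwards [hL] with z hz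
      have := (hz.sub_const (L z.1 z.2)).enorm
      simpa using this
  refine tendsto_of_tendsto_of_tendsto_of_le_of_le tendsto_const_nhds hlim (fun _ => bot_le) fun i => ?_
  rw [eLpNorm_one_eq_lintegral_enorm]
  refine le_of_le_of_eq ?_ (lintegral_prod (fun z : Ω × (ℝ × ℝ) =>
    ‖smear lam (k i) (fun s => D z.2.1 s z.1) z.2.2 - L z.1 z.2‖ₑ)
    ((mS i).sub hLm).enorm.aemeasurable).symm
  refine lintegral_mono fun ω => ?_
  have hsec : ∀ {f : Ω × (ℝ × ℝ) → ℝ}, Measurable f → (∀ z, |f z| ≤ Z z.1) →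
      Integrable (fun p => f (ω, p) * h p) μ.variation := fun hf hb =>
    Integrable.of_bound ((hf.comp measurable_prodMk_left).mul hh.measurable).aestronglyMeasurable (Z ω)
      (Eventually.of_forall fun p => by
        rw [norm_mul, Real.norm_eq_abs, Real.norm_eq_abs, hh.abs_eq, mul_one]; exact hb (ω, p))
  simp only [Pi.sub_apply]
  rw [← integral_sub (hsec (mS i) fun z => (hk i).abs_smear_le (fun s => hY.abs_deriv_le _ s z.1) _)
    (hsec hLm fun z => hLb _ _)]
  refine (enorm_integral_le_lintegral_enorm _).trans (lintegral_mono fun p => ?_)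
  rw [← sub_mul, enorm_mul]
  have hp : ‖h p‖ₑ = 1 := by rw [← enorm_norm, Real.norm_eq_abs, hh.abs_eq]; simp
  rw [hp, mul_one]

end Limit

end CovMalliavin

/-! ### Duality and identification of the limit -/

namespace CovMalliavin

variable {Ω : Type*} [MeasurableSpace Ω] {P : Measure Ω} {T : ℝ} {X : ℝ → Ω → ℝ}
  {μ : SignedMeasure (ℝ × ℝ)} {h : ℝ × ℝ → ℝ} {Φ : Lp ℝ 2 (marginal μ) →L[ℝ] Lp ℝ 2 P}
  {lam : Measure ℝ} {Y : ℝ → Ω → ℝ} {D : ℝ → ℝ → Ω → ℝ}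
  {M Z : Ω → ℝ} {κ : ℝ → ℝ → ℝ} {Ξ : ℝ → Ω → ℝ}

namespace CylData

/-- The derivative of the cylindrical variable, as represented in `L²(ν)`. -/
noncomputable def density (H : CylData P T X) (Φ : Lp ℝ 2 (marginal μ) →L[ℝ] Lp ℝ 2 P) (ω : Ω) (r : ℝ) : ℝ :=
  ∑ j, fderiv ℝ H.fn (H.rv ω) (Pi.single j 1) * ContinuousLinearMap.adjoint Φ (H.vec j) r

/-- The adjoint of `Φ` represents each covariance as an integral against `ν`. The directional
derivative thereby becomes an integral in `r`, to which Fubini applies even when the direction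
depends on `ω`. -/
theorem deriv_wint (H : CylData P T X) {g : ℝ → ℝ} (hg : MemLp g 2 (marginal μ)) (ω : Ω) :
    H.deriv (wint Φ g) ω = ∫ r, H.density Φ ω r * g r ∂(marginal μ) := by
  have hj : ∀ j, inner ℝ (H.vec j) (wint Φ g) =
      ∫ r, ContinuousLinearMap.adjoint Φ (H.vec j) r * g r ∂(marginal μ) := fun j => by
    rw [wint_eq hg, ← ContinuousLinearMap.adjoint_inner_left, inner_Lp_two]
    refine integral_congr_ae ?_
    filter_upwards [hg.coeFn_toLp] with r hr
    rw [hr]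
  rw [deriv_eq_sum]
  simp only [hj, density, Finset.sum_mul, mul_assoc]
  rw [integral_finsetSum]
  · simp only [integral_const_mul]
  · intro j _
    exact ((Lp.memLp _).integrable_mul hg).const_mul _

theorem measurable_rv (H : CylData P T X) : Measurable H.rv :=
  measurable_pi_lambda _ fun i => (Lp.stronglyMeasurable (H.vec i)).measurable

theorem measurable_fderiv (H : CylData P T X) (c : Fin H.dim → ℝ) :
    Measurable fun ω => fderiv ℝ H.fn (H.rv ω) c :=
  (H.bddC2.contDiff_fderiv_apply c).continuous.measurable.comp H.measurable_rv

theorem memLp_density [IsFiniteMeasure P] (H : CylData P T X) :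
    MemLp (fun z : Ω × ℝ => H.density Φ z.1 z.2) 2 (P.prod (marginal μ)) := by
  refine memLp_finsetSum _ fun j _ => ?_
  have h1 : MemLp (fun ω => fderiv ℝ H.fn (H.rv ω) (Pi.single j 1)) ∞ P :=
    H.bddC2.bdd_fderiv H.inGaussVec_rv.1 _
  exact MemLp.mul ((Lp.memLp (ContinuousLinearMap.adjoint Φ (H.vec j))).comp_snd P)
    (h1.comp_fst (marginal μ))

end CylData

variable [IsProbabilityMeasure P] [IsFiniteMeasure lam]

/-- The elementary duality holds at almost every time; exchanging the time integral with the one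
over `(ω, r)` collects the weights into a smeared `Y`. -/
theorem IsDominated.integral_val_mul_mean (hX : IsIntegrator P T X μ) (hh : IsPolarDensity μ h)
    (hΦ : IsWienerMap P T X μ h Φ) (hY : IsDominated P T X μ lam Y D M Z)
    (hκ : IsKernelFamily lam κ) (hΞ : IsWienerFamily lam P Φ κ Ξ) (H : CylData P T X) :
    ∫ ω, H.val ω * (∫ s, divg μ h κ Ξ Y D s ω ∂lam) ∂P =
      ∫ z : Ω × ℝ, H.density Φ z.1 z.2 * smear lam κ (fun s => Y s z.1) z.2 ∂(P.prod (marginal μ)) := by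
  have hξ : ∀ g : BddMeas, wint Φ g.1 ∈ gaussSpace P T X := fun g => wint_mem hΦ _
  have m1 : MemLp (fun z : ℝ × (Ω × ℝ) => Y z.1 z.2.1 * κ z.1 z.2.2) 2
      (lam.prod (P.prod (marginal μ))) := by
    have := hY.memLp_mul_kernel hκ (η := marginal μ) (k := fun _ => 1) measurable_id
      measurable_const (by simp)
    simpa using this
  rw [integral_mul_integral_comm (hY.memLp_divg hX hh hΦ hκ hΞ) H.bdd_val.memLp_two]
  unfold smear
  rw [integral_mul_integral_comm (f := fun s (z : Ω × ℝ) => Y s z.1 * κ s z.2) m1 H.memLp_density]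
  refine integral_congr_ae ?_
  filter_upwards [hY.isGaussDiff hX hh hΦ, hΞ.ae_eq, ae_memLp_section
    (f := fun s (z : Ω × ℝ) => Y s z.1 * κ s z.2) m1] with s hs hΞs hm
  have e : ∫ ω, H.val ω * divg μ h κ Ξ Y D s ω ∂P = _ :=
    (integral_congr_ae (by
      filter_upwards [hΞs] with ω h1
      simp only [divg, h1]; rfl)).trans (hs.integral_val_mul_div hX hξ H (hκ.section s))
  refine e.trans (Eq.trans ?_ (integral_prod _ (H.memLp_density.integrable_mul hm)).symm)
  refine integral_congr_ae (Eventually.of_forall fun ω => ?_)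
  simp only [Pi.mul_apply]
  rw [H.deriv_wint (hκ.section s).memLp, ← integral_const_mul]
  refine integral_congr_ae (Eventually.of_forall fun r => ?_)
  simp only [IsKernelFamily.section]
  ring

/-- The left side passes to the limit by `L²` convergence, the right side by domination with `M`
times the density. For fixed `ω` the limit `u ω` is bounded, so it is again an admissible direction.
-/
theorem IsDominated.integral_val_mul_limit {l : Filter ℝ} [l.IsCountablyGenerated] [NeBot l]
    {k : ℝ → ℝ → ℝ → ℝ} {W : ℝ → ℝ → Ω → ℝ} {u : Ω → ℝ → ℝ} (hX : IsIntegrator P T X μ)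
    (hh : IsPolarDensity μ h)
    (hΦ : IsWienerMap P T X μ h Φ) (hY : IsDominated P T X μ lam Y D M Z)
    (hk : ∀ i, IsKernelFamily lam (k i)) (hW : ∀ i, IsWienerFamily lam P Φ (k i) (W i))
    (hum : Measurable fun z : Ω × ℝ => u z.1 z.2) (hub : ∀ ω r, |u ω r| ≤ M ω)
    (hu : ∀ᵐ z ∂(P.prod (marginal μ)),
      Tendsto (fun i => smear lam (k i) (fun s => Y s z.1) z.2) l (𝓝 (u z.1 z.2)))
    {S : Ω → ℝ} (hS : MemLp S 2 P) (hlim : Tendsto (fun i => eLpNorm (fun ω =>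
      (∫ s, divg μ h (k i) (W i) Y D s ω ∂lam) - S ω) 2 P) l (𝓝 0)) (H : CylData P T X) :
    ∫ ω, H.val ω * S ω ∂P = ∫ ω, H.deriv (wint Φ (u ω)) ω ∂P := by
  have l1 : Tendsto (fun i => ∫ ω, H.val ω * (∫ s, divg μ h (k i) (W i) Y D s ω ∂lam) ∂P) l
      (𝓝 (∫ ω, H.val ω * S ω ∂P)) :=
    tendsto_integral_mul (fun _ => H.bdd_val.memLp_two) H.bdd_val.memLp_two
      (fun i => memLp_integral_of_memLp_prod (hY.memLp_divg hX hh hΦ (hk i) (hW i))) hS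
      (by simp) hlim
  simp only [fun i => hY.integral_val_mul_mean hX hh hΦ (hk i) (hW i) H] at l1
  have hM : MemLp (fun z : Ω × ℝ => M z.1) 2 (P.prod (marginal μ)) := hY.memLp.comp_fst _
  have l2 : Tendsto (fun i => ∫ z : Ω × ℝ, H.density Φ z.1 z.2 *
      smear lam (k i) (fun s => Y s z.1) z.2 ∂(P.prod (marginal μ))) l
      (𝓝 (∫ z : Ω × ℝ, H.density Φ z.1 z.2 * u z.1 z.2 ∂(P.prod (marginal μ)))) := by
    refine tendsto_integral_filter_of_dominated_convergence
      (fun z => ‖H.density Φ z.1 z.2‖ * M z.1) (Eventually.of_forall fun i => ?_)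
      (Eventually.of_forall fun i => Eventually.of_forall fun z => ?_)
      (H.memLp_density.norm.integrable_mul hM) ?_
    · exact H.memLp_density.aestronglyMeasurable.mul
        (hY.measurable_smear (hk i) measurable_snd measurable_fst).aestronglyMeasurable
    · rw [norm_mul]
      exact mul_le_mul_of_nonneg_left ((hk i).abs_smear_le (fun s => hY.abs_le s z.1) _)
        (norm_nonneg _)
    · filter_upwards [hu] with z hz
      exact hz.const_mul _
  rw [tendsto_nhds_unique l1 l2]
  have hu2 : MemLp (fun z : Ω × ℝ => u z.1 z.2) 2 (P.prod (marginal μ)) :=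
    hM.mono' hum.aestronglyMeasurable (Eventually.of_forall fun z => hub _ _)
  refine (integral_prod _ (H.memLp_density.integrable_mul hu2)).trans ?_
  refine integral_congr_ae (Eventually.of_forall fun ω => ?_)
  have hg : MemLp (u ω) 2 (marginal μ) :=
    memLp_of_bounded (hum.comp measurable_prodMk_left) (hub ω)
  simp only [Pi.mul_apply]
  rw [H.deriv_wint hg]

/-- The limit of the averaged divergences is the Skorohod integral of the limiting integrand. -/
theorem isSkorohodIntegral_of_deriv_wint (hX : IsIntegrator P T X μ) (hh : IsPolarDensity μ h)
    (hΦ : IsWienerMap P T X μ h Φ) {u : Ω → ℝ → ℝ}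
    (hum : Measurable fun z : Ω × ℝ => u z.1 z.2) (hM : MemLp M 2 P) (hub : ∀ ω r, |u ω r| ≤ M ω)
    {S : Ω → ℝ} (hS : MemLp S 2 P)
    (hdual : ∀ H : CylData P T X, ∫ ω, H.val ω * S ω ∂P = ∫ ω, H.deriv (wint Φ (u ω)) ω ∂P) :
    IsSkorohodIntegral P T X μ (fun r ω => u ω r) S := by
  have humω : ∀ ω, Measurable (u ω) := fun ω => hum.comp measurable_prodMk_left
  refine ⟨(hum.comp measurable_swap).aemeasurable, ?_, hS, ?_, ?_⟩
  · have hb : ∀ ω, absHSq μ (fun t => u ω t) ≤ ‖M ω‖ₑ ^ 2 * μ.variation univ := fun ω => by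
      rw [← lintegral_const]
      refine lintegral_mono fun p => ?_
      rw [pow_two]
      have hle : ∀ r, ‖u ω r‖ₑ ≤ ‖M ω‖ₑ := fun r => by
        rw [← ofReal_norm, ← ofReal_norm]
        exact ENNReal.ofReal_le_ofReal ((hub ω r).trans (le_abs_self _))
      exact mul_le_mul' (hle _) (hle _)
    refine (lintegral_mono hb).trans_lt ?_
    rw [lintegral_mul_const' _ _ (measure_ne_top _ _)]
    refine ENNReal.mul_lt_top ?_ (measure_lt_top _ _)
    have := hM.2
    rw [eLpNorm_lt_top_iff_lintegral_rpow_enorm_lt_top two_ne_zero ENNReal.ofNat_ne_top] at this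
    simpa using this
  -- Centredness is duality with the constant `1`, a cylindrical variable of dimension zero whose
  -- derivative is an empty sum.
  · have hB : IsBddC2 (fun _ : Fin 0 → ℝ => (1 : ℝ)) := ⟨contDiff_const, 1, fun x => by
      simp⟩
    have := hdual ⟨0, fun _ => 1, Fin.elim0, hB, fun i => i.elim0⟩
    simp only [CylData.deriv_eq_sum, CylData.val, one_mul] at this
    rw [this]
    exact (integral_congr_ae (Eventually.of_forall fun ω => Finset.sum_of_isEmpty _)).trans
      (integral_zero _ _)
  · intro F DF hF hfin
    obtain ⟨H, φ, hφ, hval, hder, hw⟩ := hF.exists_cylData hX hh hΦ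
    rw [integral_congr_ae (hval.mono fun ω hω => by rw [hω]), hdual H]
    have hmeas : Measurable fun z : Ω × (ℝ × ℝ) =>
        ‖∑ i, fderiv ℝ H.fn (H.rv z.1) (Pi.single i 1) * φ i z.2.1‖ₑ * ‖u z.1 z.2.2‖ₑ := by
      refine (Finset.measurable_sum _ fun i _ => ?_).enorm.mul (hum.comp (by fun_prop :
        Measurable fun z : Ω × (ℝ × ℝ) => (z.1, z.2.2))).enorm
      exact ((H.measurable_fderiv _).comp measurable_fst).mul ((hφ i).comp (by fun_prop))
    -- Absolute convergence of the expected pairing gives it for almost every `ω`, as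
    -- `inner_sum_wint` requires pathwise.
    have hlt : ∀ᵐ ω ∂P, ∫⁻ p, ‖∑ i, fderiv ℝ H.fn (H.rv ω) (Pi.single i 1) * φ i p.1‖ₑ *
        ‖u ω p.2‖ₑ ∂μ.variation < ∞ := by
      refine ae_lt_top hmeas.lintegral_prod_right' (ne_of_lt (lt_of_le_of_lt (le_of_eq ?_) hfin))
      refine lintegral_congr_ae (hder.mono fun ω hω => ?_)
      simp only [hω]
    refine integral_congr_ae ?_
    filter_upwards [hder, hlt] with ω h1 h2
    rw [hh.integral_eq]
    simp only [h1]
    rw [← inner_sum_wint hX hh hΦ hφ hw _ (humω ω) (memLp_of_bounded (humω ω) (hub ω)) h2,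
      CylData.deriv_eq_sum, sum_inner]
    exact Finset.sum_congr rfl fun i _ => by rw [real_inner_smul_left]

/-- The averaged divergence is the averaged increment minus a trace term. -/
theorem IsDominated.integral_divg (hX : IsIntegrator P T X μ) (hh : IsPolarDensity μ h)
    (hΦ : IsWienerMap P T X μ h Φ) (hY : IsDominated P T X μ lam Y D M Z)
    (hκ : IsKernelFamily lam κ) (hΞ : IsWienerFamily lam P Φ κ Ξ) :
    ∀ᵐ ω ∂P, ∫ s, Y s ω * Ξ s ω ∂lam = (∫ s, divg μ h κ Ξ Y D s ω ∂lam) +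
      ∫ p, smear lam κ (fun s => D p.1 s ω) p.2 * h p ∂μ.variation := by
  have hint := ((hY.memLp_divg hX hh hΦ hκ hΞ).integrable one_le_two).swap.prod_right_ae
  obtain ⟨C, hC0, hC⟩ := hκ.exists_abs_le
  filter_upwards [hint] with ω hω
  simp only [Function.comp_def, Prod.swap] at hω
  have hp : Measurable fun z : ℝ × (ℝ × ℝ) => D z.2.1 z.1 ω * κ z.1 z.2.2 * h z.2 :=
    ((hY.measurable_deriv.comp (by fun_prop : Measurable fun z : ℝ × (ℝ × ℝ) => (z.2.1, z.1, ω))).mul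
      (hκ.measurable.comp (by fun_prop : Measurable fun z : ℝ × (ℝ × ℝ) => (z.1, z.2.2)))).mul
      (hh.measurable.comp measurable_snd)
  have hi : Integrable (fun z : ℝ × (ℝ × ℝ) => D z.2.1 z.1 ω * κ z.1 z.2.2 * h z.2)
      (lam.prod μ.variation) := by
    refine Integrable.of_bound hp.aestronglyMeasurable (Z ω * C) (Eventually.of_forall fun z => ?_)
    rw [norm_mul, norm_mul, Real.norm_eq_abs (h z.2), hh.abs_eq, mul_one]
    exact mul_le_mul (hY.abs_deriv_le _ _ _) (hC _ _) (norm_nonneg _)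
      ((abs_nonneg _).trans (hY.abs_deriv_le 0 0 ω))
  have e1 : ∫ p, smear lam κ (fun s => D p.1 s ω) p.2 * h p ∂μ.variation =
      ∫ s, pairing μ h (fun q => D q s ω) (κ s) ∂lam := by
    simp only [smear, pairing, ← integral_mul_const]
    exact (integral_integral_swap hi).symm
  rw [e1]
  refine Eq.trans ?_ (integral_add hω hi.integral_prod_left)
  refine integral_congr_ae (Eventually.of_forall fun s => ?_)
  simp only [divg, pairing]
  ring

end CovMalliavin

/-! ### Averages over moving windows -/

namespace CovMalliavin

/-- The average of `f` over the window from `r - (α + 1) ε` to `r - α ε`. -/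
noncomputable def shiftAvg (α : ℝ) (f : ℝ → ℝ) (r ε : ℝ) : ℝ :=
  ε⁻¹ * ∫ s in (r - (α + 1) * ε)..(r - α * ε), f s

theorem shiftAvg_zero (f : ℝ → ℝ) (r : ℝ) : shiftAvg 0 f r = leftAvg f r := by
  ext ε; simp [shiftAvg, leftAvg]

theorem shiftAvg_neg_one (f : ℝ → ℝ) (r : ℝ) : shiftAvg (-1) f r = rightAvg f r := by
  ext ε; simp [shiftAvg, rightAvg]

/-- The substitution `s = r - ε v` fixes the domain of integration, which makes bounds and joint
measurability immediate. -/
theorem shiftAvg_eq (α : ℝ) (f : ℝ → ℝ) (r : ℝ) {ε : ℝ} (hε : ε ≠ 0) :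
    shiftAvg α f r ε = ∫ v in α..(α + 1), f (r - ε * v) := by
  rw [intervalIntegral.integral_comp_sub_mul f hε, smul_eq_mul, shiftAvg, mul_comm ε, mul_comm ε]

theorem abs_shiftAvg_le {α : ℝ} {f : ℝ → ℝ} {C : ℝ} (hf : ∀ s, |f s| ≤ C) (r : ℝ) {ε : ℝ} (hε : ε ≠ 0) :
    |shiftAvg α f r ε| ≤ C := by
  rw [shiftAvg_eq α f r hε]
  have := intervalIntegral.norm_integral_le_of_norm_le_const (a := α) (b := α + 1)
    (f := fun v => f (r - ε * v)) (C := C) fun v _ => hf _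
  simpa using this

theorem intervalIntegrable_of_bounded {f : ℝ → ℝ} (hf : Measurable f) {C : ℝ} (hC : ∀ s, |f s| ≤ C)
    (a b : ℝ) : IntervalIntegrable f volume a b :=
  (intervalIntegrable_const (c := C)).mono_fun hf.aestronglyMeasurable
    (Eventually.of_forall fun s => (hC s).trans (le_abs_self C))

theorem continuousOn_shiftAvg (α : ℝ) {f : ℝ → ℝ} (hf : Measurable f) {C : ℝ} (hC : ∀ s, |f s| ≤ C)
    (r : ℝ) : ContinuousOn (shiftAvg α f r) (Ioi 0) := by
  have hi := intervalIntegrable_of_bounded hf hC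
  have hF := intervalIntegral.continuous_primitive hi 0
  have e : ∀ ε, shiftAvg α f r ε = ε⁻¹ * ((∫ s in (0 : ℝ)..(r - α * ε), f s) -
      ∫ s in (0 : ℝ)..(r - (α + 1) * ε), f s) := fun ε => by
    rw [intervalIntegral.integral_interval_sub_left (hi _ _) (hi _ _), shiftAvg]
  have hc : Continuous fun ε : ℝ => (∫ s in (0 : ℝ)..(r - α * ε), f s) -
      ∫ s in (0 : ℝ)..(r - (α + 1) * ε), f s :=
    (hF.comp (by fun_prop : Continuous fun ε : ℝ => r - α * ε)).sub
      (hF.comp (by fun_prop : Continuous fun ε : ℝ => r - (α + 1) * ε))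
  refine ContinuousOn.congr ?_ fun ε _ => e ε
  exact (continuousOn_inv₀.mono fun x hx => ne_of_gt hx).mul hc.continuousOn

theorem measurable_shiftAvg (α : ℝ) {A : Type*} [MeasurableSpace A] {f : A → ℝ → ℝ} {r : A → ℝ}
    (hf : Measurable fun z : A × ℝ => f z.1 z.2) (hr : Measurable r) {ε : ℝ} (hε : ε ≠ 0) :
    Measurable fun a => shiftAvg α (f a) (r a) ε := by
  simp only [shiftAvg_eq α _ _ hε, intervalIntegral.integral_of_le (by linarith : α ≤ α + 1)]
  have : Measurable fun z : A × ℝ => f z.1 (r z.1 - ε * z.2) :=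
    hf.comp (by fun_prop : Measurable fun z : A × ℝ => (z.1, r z.1 - ε * z.2))
  exact this.stronglyMeasurable.integral_prod_right.measurable

/-- The filter of small positive rational numbers. -/
def ratRight : Filter ℚ := comap ((↑) : ℚ → ℝ) (𝓝[>] 0)

instance : ratRight.IsCountablyGenerated := by unfold ratRight; infer_instance

/-- A function continuous on `ε > 0` is determined by its rational values, and closed balls are
preserved under closure. Limits of window averages can thus be tested along countably many `ε`, so
the sets on which they exist are measurable. -/
theorem tendsto_iff_ratRight {g : ℝ → ℝ} (hg : ContinuousOn g (Ioi 0)) (c : ℝ) :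
    Tendsto g (𝓝[>] 0) (𝓝 c) ↔ Tendsto (fun q : ℚ => g q) ratRight (𝓝 c) := by
  refine ⟨fun h => h.comp tendsto_comap, fun h => ?_⟩
  rw [(Metric.nhds_basis_closedBall).tendsto_right_iff] at h ⊢
  intro η hη
  obtain ⟨t, ht, hts⟩ := mem_comap.1 (h η hη)
  obtain ⟨δ, hδ, hδt⟩ := mem_nhdsGT_iff_exists_Ioo_subset.1 ht
  refine mem_nhdsGT_iff_exists_Ioo_subset.2 ⟨δ, hδ, fun ε hε => ?_⟩
  have hclos : ε ∈ closure (Ioo 0 δ ∩ range ((↑) : ℚ → ℝ)) := by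
    have := Rat.denseRange_cast (𝕜 := ℝ) |>.open_subset_closure_inter isOpen_Ioo hε
    exact this
  have hcont : ContinuousWithinAt g (Ioo 0 δ ∩ range ((↑) : ℚ → ℝ)) ε :=
    (hg ε hε.1).mono fun x hx => hx.1.1
  have := hcont.mem_closure_image hclos
  have hsub : g '' (Ioo 0 δ ∩ range ((↑) : ℚ → ℝ)) ⊆ Metric.closedBall c η := by
    rintro _ ⟨_, ⟨hx, q, rfl⟩, rfl⟩
    exact hts (hδt hx)
  exact closure_minimal hsub Metric.isClosed_closedBall this

section MeasurableSets

variable {A : Type*} [MeasurableSpace A] {f : A → ℝ → ℝ} {r : A → ℝ}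

theorem measurable_shiftAvg_rat (α : ℝ) (hf : Measurable fun z : A × ℝ => f z.1 z.2)
    (hr : Measurable r) (q : ℚ) : Measurable fun a => shiftAvg α (f a) (r a) q := by
  by_cases hq : (q : ℝ) = 0
  · have : (fun a => shiftAvg α (f a) (r a) q) = fun _ => 0 := by ext a; simp [shiftAvg, hq]
    rw [this]; exact measurable_const
  · exact measurable_shiftAvg α hf hr hq

theorem continuousOn_shiftAvg_section (α : ℝ) (hf : Measurable fun z : A × ℝ => f z.1 z.2)
    (hb : ∀ a, ∃ C, ∀ s, |f a s| ≤ C) (a : A) : ContinuousOn (shiftAvg α (f a) (r a)) (Ioi 0) := by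
  obtain ⟨C, hC⟩ := hb a
  exact continuousOn_shiftAvg α (hf.comp measurable_prodMk_left) hC _

theorem measurableSet_tendsto_shiftAvg (α : ℝ) (hf : Measurable fun z : A × ℝ => f z.1 z.2)
    (hb : ∀ a, ∃ C, ∀ s, |f a s| ≤ C) (hr : Measurable r) {g : A → ℝ} (hg : Measurable g) :
    MeasurableSet {a | Tendsto (shiftAvg α (f a) (r a)) (𝓝[>] 0) (𝓝 (g a))} := by
  simp only [tendsto_iff_ratRight (continuousOn_shiftAvg_section α hf hb _)]
  exact measurableSet_tendsto_fun (measurable_shiftAvg_rat α hf hr) hg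

theorem measurableSet_exists_tendsto_shiftAvg (α : ℝ) (hf : Measurable fun z : A × ℝ => f z.1 z.2)
    (hb : ∀ a, ∃ C, ∀ s, |f a s| ≤ C) (hr : Measurable r) :
    MeasurableSet {a | ∃ c, Tendsto (shiftAvg α (f a) (r a)) (𝓝[>] 0) (𝓝 c)} := by
  simp only [tendsto_iff_ratRight (continuousOn_shiftAvg_section α hf hb _)]
  exact MeasureTheory.measurableSet_exists_tendsto (measurable_shiftAvg_rat α hf hr)

end MeasurableSets

/-- The windows are eventually inside any neighbourhood of `r`. -/
theorem eventually_window_subset (α r : ℝ) {U : Set ℝ} (hU : U ∈ 𝓝 r) :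
    ∀ᶠ ε in 𝓝[>] (0 : ℝ), 0 < ε ∧ Icc (r - (α + 1) * ε) (r - α * ε) ⊆ U := by
  obtain ⟨a, b, hab, hsub⟩ := mem_nhds_iff_exists_Ioo_subset.1 hU
  have t1 : Tendsto (fun ε : ℝ => r - (α + 1) * ε) (𝓝[>] 0) (𝓝 r) := by
    have : Continuous fun ε : ℝ => r - (α + 1) * ε := by fun_prop
    have h := this.tendsto 0
    simp only [mul_zero, sub_zero] at h
    exact h.mono_left nhdsWithin_le_nhds
  have t2 : Tendsto (fun ε : ℝ => r - α * ε) (𝓝[>] 0) (𝓝 r) := by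
    have : Continuous fun ε : ℝ => r - α * ε := by fun_prop
    have h := this.tendsto 0
    simp only [mul_zero, sub_zero] at h
    exact h.mono_left nhdsWithin_le_nhds
  filter_upwards [self_mem_nhdsWithin, t1.eventually (lt_mem_nhds hab.1),
    t2.eventually (gt_mem_nhds hab.2)] with ε hε h1 h2
  exact ⟨hε, fun x hx => hsub ⟨h1.trans_le hx.1, hx.2.trans_lt h2⟩⟩

theorem window_le (α r : ℝ) {ε : ℝ} (hε : 0 < ε) : r - (α + 1) * ε ≤ r - α * ε := by
  nlinarith

theorem shiftAvg_congr {α : ℝ} {f g : ℝ → ℝ} {U : Set ℝ} {r : ℝ} (hU : U ∈ 𝓝 r)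
    (hfg : ∀ᵐ s ∂volume.restrict U, f s = g s) :
    shiftAvg α f r =ᶠ[𝓝[>] 0] shiftAvg α g r := by
  filter_upwards [eventually_window_subset α r hU] with ε hε
  rw [shiftAvg, shiftAvg, intervalIntegral.integral_of_le (window_le α r hε.1),
    intervalIntegral.integral_of_le (window_le α r hε.1)]
  congr 1
  refine integral_congr_ae (ae_mono (Measure.restrict_mono ?_ le_rfl) hfg)
  exact Ioc_subset_Icc_self.trans hε.2

theorem tendsto_shiftAvg {α : ℝ} {f : ℝ → ℝ} (hf : Measurable f) {C : ℝ} (hC : ∀ s, |f s| ≤ C)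
    {r c : ℝ} (h : ∀ η > 0, ∃ U ∈ 𝓝 r, ∀ ε > 0, ∀ s ∈ U, s ∈ Ioo (r - (α + 1) * ε) (r - α * ε) → |f s - c| ≤ η) :
    Tendsto (shiftAvg α f r) (𝓝[>] 0) (𝓝 c) := by
  rw [(Metric.nhds_basis_closedBall).tendsto_right_iff]
  intro η hη
  obtain ⟨U, hU, hs⟩ := h η hη
  filter_upwards [eventually_window_subset α r hU] with ε hε
  rw [Metric.mem_closedBall, Real.dist_eq]
  have hw := window_le α r hε.1
  have e : shiftAvg α f r ε - c = ε⁻¹ * ∫ s in (r - (α + 1) * ε)..(r - α * ε), (f s - c) := by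
    rw [intervalIntegral.integral_sub (intervalIntegrable_of_bounded hf hC _ _)
      intervalIntegrable_const, intervalIntegral.integral_const, shiftAvg, smul_eq_mul]
    have := hε.1.ne'
    field_simp
    ring
  rw [e, abs_mul, abs_of_pos (inv_pos.2 hε.1)]
  have hle : ‖∫ s in (r - (α + 1) * ε)..(r - α * ε), (f s - c)‖ ≤
      η * |r - α * ε - (r - (α + 1) * ε)| := by
    refine intervalIntegral.norm_integral_le_of_norm_le_const_ae ?_
    -- Only the interior of the window is controlled. Its right endpoint, which for `α = 0` is `r`
    -- itself, is discarded as a null set.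
    have hne : ∀ᵐ s : ℝ, s ≠ r - α * ε := by
      simp [ae_iff, measure_singleton]
    filter_upwards [hne] with s hsne hmem
    rw [uIoc_of_le hw] at hmem
    exact hs ε hε.1 s (hε.2 ⟨hmem.1.le, hmem.2⟩) ⟨hmem.1, lt_of_le_of_ne hmem.2 hsne⟩
  calc ε⁻¹ * |∫ s in (r - (α + 1) * ε)..(r - α * ε), (f s - c)|
      ≤ ε⁻¹ * (η * |r - α * ε - (r - (α + 1) * ε)|) := by
        gcongr
        · exact inv_nonneg.2 hε.1.le
        · exact hle
    _ = η := by
        rw [show r - α * ε - (r - (α + 1) * ε) = ε by ring, abs_of_pos hε.1]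
        have := hε.1.ne'
        field_simp

theorem tendsto_shiftAvg_zero {f : ℝ → ℝ} (hf : Measurable f) {C : ℝ} (hC : ∀ s, |f s| ≤ C)
    {r c : ℝ} (h : Tendsto f (𝓝[<] r) (𝓝 c)) : Tendsto (shiftAvg 0 f r) (𝓝[>] 0) (𝓝 c) := by
  refine tendsto_shiftAvg hf hC fun η hη => ?_
  obtain ⟨U, hU, hs⟩ := mem_nhdsWithin_iff_exists_mem_nhds_inter.1
    (h (Metric.closedBall_mem_nhds c hη))
  refine ⟨U, hU, fun ε _ s hsU hsI => ?_⟩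
  have := hs ⟨hsU, by simpa using hsI.2⟩
  simpa [Real.dist_eq] using this

theorem tendsto_shiftAvg_neg_one {f : ℝ → ℝ} (hf : Measurable f) {C : ℝ} (hC : ∀ s, |f s| ≤ C)
    {r c : ℝ} (h : Tendsto f (𝓝[>] r) (𝓝 c)) : Tendsto (shiftAvg (-1) f r) (𝓝[>] 0) (𝓝 c) := by
  refine tendsto_shiftAvg hf hC fun η hη => ?_
  obtain ⟨U, hU, hs⟩ := mem_nhdsWithin_iff_exists_mem_nhds_inter.1
    (h (Metric.closedBall_mem_nhds c hη))
  refine ⟨U, hU, fun ε _ s hsU hsI => ?_⟩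
  have := hs ⟨hsU, by simpa using hsI.1⟩
  simpa [Real.dist_eq] using this

/-- A function differs from its left limits at countably many points at most. -/
theorem countable_setOf_leftLim_ne (f : ℝ → ℝ) :
    {r | ∃ l, Tendsto f (𝓝[<] r) (𝓝 l) ∧ l ≠ f r}.Countable := by
  have key : ∀ f : ℝ → ℝ, {r | ∃ l, Tendsto f (𝓝[<] r) (𝓝 l) ∧ f r < l}.Countable := by
    intro f
    -- At a point of `t p` the value lies below the level `p.2`, while all values just before it,
    -- back to `p.1`, lie above. Two such points contradict each other, so each set has at most one
    -- element.
    let t : ℚ × ℚ → Set ℝ := fun p => {r | (p.1 : ℝ) < r ∧ f r < p.2 ∧ ∀ y ∈ Ioo (p.1 : ℝ) r, (p.2 : ℝ) < f y}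
    have ht : ∀ p, (t p).Subsingleton := by
      intro p r hr r' hr'
      by_contra hne
      rcases lt_or_gt_of_ne hne with h | h
      · exact absurd (hr'.2.2 r ⟨hr.1, h⟩) (not_lt.2 hr.2.1.le)
      · exact absurd (hr.2.2 r' ⟨hr'.1, h⟩) (not_lt.2 hr'.2.1.le)
    refine (countable_iUnion fun p => (ht p).countable).mono ?_
    rintro r ⟨l, hl, hlt⟩
    obtain ⟨c, hc1, hc2⟩ := exists_rat_btwn hlt
    obtain ⟨a, ha, hsub⟩ := mem_nhdsLT_iff_exists_Ioo_subset.1 (hl.eventually (lt_mem_nhds hc2))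
    obtain ⟨a', ha1, ha2⟩ := exists_rat_btwn (mem_Iio.1 ha)
    exact mem_iUnion.2 ⟨(a', c), ha2, hc1, fun y hy => hsub ⟨ha1.trans hy.1, hy.2⟩⟩
  refine ((key f).union (key fun x => - f x)).mono ?_
  rintro r ⟨l, hl, hne⟩
  rcases lt_or_gt_of_ne hne with h | h
  · exact Or.inr ⟨-l, hl.neg, neg_lt_neg h⟩
  · exact Or.inl ⟨l, hl, h⟩

end CovMalliavin

/-! ### From averaged increments to the Skorohod integral -/

namespace CovMalliavin

variable {Ω : Type*} [MeasurableSpace Ω] {P : Measure Ω} {T : ℝ} {X : ℝ → Ω → ℝ}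
  {μ : SignedMeasure (ℝ × ℝ)} {h : ℝ × ℝ → ℝ} {Φ : Lp ℝ 2 (marginal μ) →L[ℝ] Lp ℝ 2 P}
  {lam : Measure ℝ}

theorem tendstoInMeasure_add {ι : Type*} {l : Filter ι} {f f' : ι → Ω → ℝ} {g g' : Ω → ℝ}
    (hf : TendstoInMeasure P f l g) (hf' : TendstoInMeasure P f' l g') :
    TendstoInMeasure P (fun i ω => f i ω + f' i ω) l fun ω => g ω + g' ω := by
  intro ε hε
  have hε2 : 0 < ε / 2 := ENNReal.div_pos hε.ne' (by norm_num)
  have := (hf _ hε2).add (hf' _ hε2)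
  rw [add_zero] at this
  refine tendsto_of_tendsto_of_tendsto_of_le_of_le tendsto_const_nhds this (fun _ => bot_le)
    fun i => (measure_mono fun ω hω => ?_).trans (measure_union_le _ _)
  simp only [mem_ofPred_eq, mem_union] at hω ⊢
  by_contra! hcon
  have : edist (f i ω + f' i ω) (g ω + g' ω) < ε := by
    calc _ ≤ edist (f i ω) (g ω) + edist (f' i ω) (g' ω) := edist_add_add_le _ _ _ _
      _ < ε / 2 + ε / 2 := ENNReal.add_lt_add hcon.1 hcon.2
      _ = ε := ENNReal.add_halves ε
  exact absurd hω (not_le.2 this)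

/-- Convergence of averaged increments to a Skorohod integral plus a trace term. -/
theorem IsDominated.exists_skorohod_tendsto [IsProbabilityMeasure P] [IsFiniteMeasure lam]
    {l : Filter ℝ} [l.IsCountablyGenerated] [NeBot l] {Y : ℝ → Ω → ℝ} {D : ℝ → ℝ → Ω → ℝ}
    {M Z : Ω → ℝ} {k : ℝ → ℝ → ℝ → ℝ} {W : ℝ → ℝ → Ω → ℝ} {u : Ω → ℝ → ℝ} {K L : Ω → ℝ × ℝ → ℝ}
    (hX : IsIntegrator P T X μ) (hh : IsPolarDensity μ h)
    (hΦ : IsWienerMap P T X μ h Φ) (hY : IsDominated P T X μ lam Y D M Z)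
    (hk : ∀ i, IsKernelFamily lam (k i)) (hW : ∀ i, IsWienerFamily lam P Φ (k i) (W i))
    (hum : Measurable fun z : Ω × ℝ => u z.1 z.2) (hub : ∀ ω r, |u ω r| ≤ M ω)
    (hu : ∀ᵐ z ∂(P.prod (marginal μ)),
      Tendsto (fun i => smear lam (k i) (fun s => Y s z.1) z.2) l (𝓝 (u z.1 z.2)))
    (hK : ∀ᵐ z ∂(P.prod ((marginal μ).prod (marginal μ))),
      Tendsto (fun i => smear lam (k i) (fun s => D z.2.1 s z.1) z.2.2) l (𝓝 (K z.1 z.2)))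
    (hLm : Measurable fun z : Ω × (ℝ × ℝ) => L z.1 z.2) (hLb : ∀ ω p, |L ω p| ≤ Z ω)
    (hL : ∀ᵐ z ∂(P.prod μ.variation),
      Tendsto (fun i => smear lam (k i) (fun s => D z.2.1 s z.1) z.2.2) l (𝓝 (L z.1 z.2))) :
    ∃ S : Ω → ℝ, IsSkorohodIntegral P T X μ (fun r ω => u ω r) S ∧
      TendstoInMeasure P (fun i ω => ∫ s, Y s ω * W i s ω ∂lam) l
        fun ω => S ω + ∫ p, L ω p * h p ∂μ.variation := by
  obtain ⟨S, hS, hlim⟩ := hY.exists_tendsto_mean hX hh hΦ hk hW hu hK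
  refine ⟨S, isSkorohodIntegral_of_deriv_wint hX hh hΦ hum hY.memLp hub hS
    (hY.integral_val_mul_limit hX hh hΦ hk hW hum hub hu hS hlim), ?_⟩
  have h1 := tendstoInMeasure_of_tendsto_eLpNorm two_ne_zero (fun i => (memLp_integral_of_memLp_prod
    (hY.memLp_divg hX hh hΦ (hk i) (hW i))).aestronglyMeasurable) hS.aestronglyMeasurable hlim
  refine (tendstoInMeasure_add h1 (hY.tendsto_trace hh hk hLm hLb hL)).congr_left fun i => ?_
  filter_upwards [hY.integral_divg hX hh hΦ (hk i) (hW i)] with ω hω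
  exact hω.symm

/-! ### Window weights and normalized increments -/

section Kernel

/-- The projection of the line onto `[0,T]`. -/
def clamp (T s : ℝ) : ℝ := max 0 (min s T)

theorem clamp_mem (hT : 0 ≤ T) (s : ℝ) : clamp T s ∈ Icc 0 T :=
  ⟨le_max_left _ _, max_le hT (min_le_right _ _)⟩

theorem clamp_of_mem {s : ℝ} (hs : s ∈ Icc 0 T) : clamp T s = s := by
  rw [clamp, min_eq_left hs.2, max_eq_right hs.1]

theorem monotone_clamp (T : ℝ) : Monotone (clamp T) := fun _ _ hab =>
  max_le_max le_rfl (min_le_min hab le_rfl)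

theorem continuous_clamp (T : ℝ) : Continuous (clamp T) := by unfold clamp; fun_prop

/-- The normalized window between the times `s + α ε` and `s + (α + 1) ε`. -/
noncomputable def shiftKernel (α T ε s r : ℝ) : ℝ :=
  if 0 < ε then ε⁻¹ * intervalFn (clamp T (s + α * ε)) (clamp T (s + (α + 1) * ε)) r else 0

/-- For `r` in `]0,T]` clamping the endpoints does not affect membership. Read as a function of `s`
the interval becomes a window at `r`, half-open on the opposite side. -/
theorem shiftKernel_of_mem {α ε s r : ℝ} (hε : 0 < ε) (hr : r ∈ Ioc 0 T) :
    shiftKernel α T ε s r =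
      ε⁻¹ * (Ico (r - (α + 1) * ε) (r - α * ε)).indicator (fun _ => (1 : ℝ)) s := by
  rw [shiftKernel, if_pos hε]
  congr 1
  have h1 : r ∈ Ioc (clamp T (s + α * ε)) (clamp T (s + (α + 1) * ε)) ↔
      s ∈ Ico (r - (α + 1) * ε) (r - α * ε) := by
    simp only [clamp, mem_Ioc, mem_Ico, max_lt_iff, min_lt_iff, le_max_iff, le_min_iff]
    constructor
    · rintro ⟨⟨_, h2⟩, h3⟩
      refine ⟨?_, ?_⟩
      · rcases h3 with h3 | h3
        · exact absurd hr.1 (not_lt.2 h3)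
        · linarith [h3.1]
      · rcases h2 with h2 | h2
        · linarith
        · exact absurd hr.2 (not_le.2 h2)
    · rintro ⟨h2, h3⟩
      exact ⟨⟨hr.1, Or.inl (by linarith)⟩, Or.inr ⟨by linarith, hr.2⟩⟩
  by_cases hs : s ∈ Ico (r - (α + 1) * ε) (r - α * ε)
  · rw [intervalFn, indicator_of_mem (h1.2 hs), indicator_of_mem hs]
  · rw [intervalFn, indicator_of_notMem (fun h => hs (h1.1 h)), indicator_of_notMem hs]

theorem shiftKernel_of_notMem (hT : 0 ≤ T) {α ε s r : ℝ} (hr : r ∉ Ioc 0 T) :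
    shiftKernel α T ε s r = 0 := by
  rw [shiftKernel]
  split_ifs
  · rw [intervalFn, indicator_of_notMem, mul_zero]
    exact fun h => hr ⟨(clamp_mem hT _).1.trans_lt h.1, h.2.trans (clamp_mem hT _).2⟩
  · rfl

theorem measurable_shiftKernel (α T ε : ℝ) :
    Measurable fun z : ℝ × ℝ => shiftKernel α T ε z.1 z.2 := by
  by_cases hε : 0 < ε
  · have hc := (continuous_clamp T).measurable
    have h1 : MeasurableSet {z : ℝ × ℝ | z.2 ∈ Ioc (clamp T (z.1 + α * ε)) (clamp T (z.1 + (α + 1) * ε))} :=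
      (measurableSet_lt (hc.comp (by fun_prop)) measurable_snd).inter
        (measurableSet_le measurable_snd (hc.comp (by fun_prop)))
    have : (fun z : ℝ × ℝ => shiftKernel α T ε z.1 z.2) = fun z => ε⁻¹ *
        {z : ℝ × ℝ | z.2 ∈ Ioc (clamp T (z.1 + α * ε)) (clamp T (z.1 + (α + 1) * ε))}.indicator
          (fun _ => (1 : ℝ)) z := by
      ext z
      simp only [shiftKernel, if_pos hε]
      rfl
    rw [this]
    exact (measurable_const.indicator h1).const_mul _
  · simp only [shiftKernel, if_neg hε]
    exact measurable_const

theorem isKernelFamily_shiftKernel (hT : 0 ≤ T) (α ε t : ℝ) :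
    IsKernelFamily (volume.restrict (Ioc 0 t)) (shiftKernel α T ε) := by
  have h01 : ∀ a b r, 0 ≤ intervalFn a b r := fun a b r => indicator_nonneg (fun _ _ => zero_le_one) _
  refine ⟨measurable_shiftKernel α T ε, fun s r => ?_, ⟨|ε⁻¹|, fun s r => ?_⟩, fun r => ?_⟩
  · rw [shiftKernel]
    split_ifs with hε
    · exact mul_nonneg (inv_nonneg.2 hε.le) (h01 _ _ _)
    · exact le_rfl
  · rw [shiftKernel]
    split_ifs with hε
    · rw [abs_of_pos (inv_pos.2 hε)]
      exact mul_le_of_le_one_right (inv_nonneg.2 hε.le) ((le_abs_self _).trans (abs_intervalFn_le _ _ _))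
    · exact abs_nonneg _
  · by_cases hε : 0 < ε
    swap
    · simp [shiftKernel, hε]
    by_cases hr : r ∈ Ioc 0 T
    swap
    · simp [shiftKernel_of_notMem hT hr]
    simp only [shiftKernel_of_mem hε hr]
    rw [integral_const_mul, integral_indicator measurableSet_Ico, Measure.restrict_restrict measurableSet_Ico]
    simp only [integral_const, smul_eq_mul, mul_one, measureReal_restrict_apply_univ]
    have : volume.real (Ico (r - (α + 1) * ε) (r - α * ε) ∩ Ioc 0 t) ≤ ε := by
      refine (measureReal_mono inter_subset_left (by simp)).trans (le_of_eq ?_)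
      rw [Real.volume_real_Ico_of_le (window_le α r hε)]
      ring
    calc ε⁻¹ * volume.real (Ico (r - (α + 1) * ε) (r - α * ε) ∩ Ioc 0 t) ≤ ε⁻¹ * ε := by gcongr
      _ = 1 := inv_mul_cancel₀ hε.ne'

/-- For `0 < r < t` the window eventually lies inside `]0,t]`; for `r > t` it eventually misses it,
as the next lemma records. Smearing therefore produces the cutoff `1_{r<t}` in the limit. -/
theorem smear_shiftKernel_eventuallyEq (α : ℝ) {t r : ℝ} (htT : t ≤ T) (hr : r ∈ Ioo 0 t) (f : ℝ → ℝ) :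
    (fun ε => smear (volume.restrict (Ioc 0 t)) (shiftKernel α T ε) f r) =ᶠ[𝓝[>] 0] shiftAvg α f r := by
  filter_upwards [eventually_window_subset α r (Ioo_mem_nhds hr.1 hr.2)] with ε hε
  have hrT : r ∈ Ioc 0 T := ⟨hr.1, hr.2.le.trans htT⟩
  have hsub : Ico (r - (α + 1) * ε) (r - α * ε) ⊆ Ioc 0 t := fun x hx =>
    Ioo_subset_Ioc_self (hε.2 (Ico_subset_Icc_self hx))
  simp only [smear, shiftKernel_of_mem hε.1 hrT]
  have e : ∀ s, f s * (ε⁻¹ * (Ico (r - (α + 1) * ε) (r - α * ε)).indicator (fun _ => (1 : ℝ)) s) =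
      ε⁻¹ * (Ico (r - (α + 1) * ε) (r - α * ε)).indicator f s := fun s => by
    by_cases hs : s ∈ Ico (r - (α + 1) * ε) (r - α * ε)
    · rw [indicator_of_mem hs, indicator_of_mem hs]; ring
    · rw [indicator_of_notMem hs, indicator_of_notMem hs]; ring
  simp only [e]
  rw [integral_const_mul, integral_indicator measurableSet_Ico, Measure.restrict_restrict measurableSet_Ico,
    inter_eq_left.2 hsub, integral_Ico_eq_integral_Ioo, ← integral_Ioc_eq_integral_Ioo,
    ← intervalIntegral.integral_of_le (window_le α r hε.1), shiftAvg]

theorem smear_shiftKernel_eventually_zero (hT : 0 ≤ T) (α : ℝ) {t r : ℝ} (hr : t < r) (f : ℝ → ℝ) :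
    (fun ε => smear (volume.restrict (Ioc 0 t)) (shiftKernel α T ε) f r) =ᶠ[𝓝[>] 0] fun _ => 0 := by
  filter_upwards [eventually_window_subset α r (Ioi_mem_nhds hr)] with ε hε
  refine (integral_congr_ae ?_).trans (integral_zero _ _)
  filter_upwards [ae_restrict_mem measurableSet_Ioc] with s hs
  by_cases hrT : r ∈ Ioc 0 T
  · rw [shiftKernel_of_mem hε.1 hrT, indicator_of_notMem, mul_zero, mul_zero]
    exact fun h => absurd (hε.2 (Ico_subset_Icc_self h)) (not_lt.2 hs.2)
  · rw [shiftKernel_of_notMem hT hrT, mul_zero]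

/-- The normalized increment of the process `V`. -/
noncomputable def shiftIncr (α : ℝ) (V : ℝ → Ω → ℝ) (ε s : ℝ) (ω : Ω) : ℝ :=
  if 0 < ε then ε⁻¹ * (V (s + (α + 1) * ε) ω - V (s + α * ε) ω) else 0

theorem isWienerFamily_shiftIncr (hT : 0 ≤ T) (hΦ : IsWienerMap P T X μ h Φ) {V : ℝ → Ω → ℝ}
    (hV : Measurable fun z : ℝ × Ω => V z.1 z.2) (hVX : ∀ s, V s =ᵐ[P] X (clamp T s)) (α ε : ℝ) :
    IsWienerFamily lam P Φ (shiftKernel α T ε) (shiftIncr α V ε) := by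
  by_cases hε : 0 < ε
  · refine ⟨?_, Eventually.of_forall fun s => ?_⟩
    · simp only [shiftIncr, if_pos hε]
      exact ((hV.comp (by fun_prop : Measurable fun z : ℝ × Ω => (z.1 + (α + 1) * ε, z.2))).sub
        (hV.comp (by fun_prop : Measurable fun z : ℝ × Ω => (z.1 + α * ε, z.2)))).const_mul _
    · have hab : clamp T (s + α * ε) ≤ clamp T (s + (α + 1) * ε) :=
        monotone_clamp T (by nlinarith)
      have e : shiftKernel α T ε s = fun x => ∑ _i : Fin 1, ε⁻¹ *
          intervalFn (clamp T (s + α * ε)) (clamp T (s + (α + 1) * ε)) x := by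
        ext x; simp [shiftKernel, hε]
      rw [e, wint_sum Finset.univ (fun _ : Fin 1 => ε⁻¹) fun _ => memLp_intervalFn μ _ _]
      simp only [Finset.univ_unique, Finset.sum_singleton]
      filter_upwards [hVX (s + α * ε), hVX (s + (α + 1) * ε),
        wint_intervalFn hΦ (clamp_mem hT _).1 hab (clamp_mem hT _).2,
        Lp.coeFn_smul ε⁻¹ (wint Φ (intervalFn (clamp T (s + α * ε)) (clamp T (s + (α + 1) * ε))))]
        with ω h1 h2 h3 h4
      rw [h4, Pi.smul_apply, h3, smul_eq_mul, shiftIncr, if_pos hε, h1, h2]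
  · refine ⟨?_, Eventually.of_forall fun s => ?_⟩
    · simp only [shiftIncr, if_neg hε]
      exact measurable_const
    -- For `ε ≤ 0` both the weight and the increment are zero by convention; the empty sum exhibits
    -- the zero function in the form covered by `wint_sum`.
    · have e : shiftKernel α T ε s = fun x => ∑ i : Fin 0, (0 : ℝ) * intervalFn 0 0 x := by
        ext x; simp [shiftKernel, hε]
      rw [e, wint_sum Finset.univ (fun _ : Fin 0 => (0 : ℝ)) fun _ => memLp_intervalFn μ 0 0]
      simp only [Finset.univ_eq_empty, Finset.sum_empty]
      filter_upwards [Lp.coeFn_zero ℝ 2 P] with ω hω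
      exact Eq.trans (by simp [shiftIncr, hε]) hω.symm

end Kernel

/-! ### Jointly measurable modifications -/

section Modification

theorem exists_measurableSet_of_ae {p : Ω → Prop} (hp : ∀ᵐ ω ∂P, p ω) :
    ∃ G, MeasurableSet G ∧ P Gᶜ = 0 ∧ ∀ ω ∈ G, p ω := by
  obtain ⟨N, hN, hNm, hN0⟩ := exists_measurable_superset_of_null (ae_iff.1 hp)
  refine ⟨Nᶜ, hNm.compl, by rwa [compl_compl], fun ω hω => ?_⟩
  by_contra hcon
  exact hω (hN hcon)

/-- The process `V`, stopped at the ends of `[0,T]` and set to zero outside `G`. -/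
noncomputable def modif {S : Type*} (T : ℝ) (G : Set S) (V : ℝ → S → ℝ) (s : ℝ) (ω : S) : ℝ :=
  G.indicator (V (clamp T s)) ω

theorem modif_of_mem {S : Type*} {G : Set S} {V : ℝ → S → ℝ} {s : ℝ} {ω : S} (hω : ω ∈ G) :
    modif T G V s ω = V (clamp T s) ω := indicator_of_mem hω _

theorem modif_of_notMem {S : Type*} {G : Set S} {V : ℝ → S → ℝ} {s : ℝ} {ω : S} (hω : ω ∉ G) :
    modif T G V s ω = 0 := indicator_of_notMem hω _

theorem tendsto_modif {S : Type*} (hT : 0 < T) {G : Set S} {V : ℝ → S → ℝ}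
    (hG : ∀ ω ∈ G, ∀ t ∈ Ico 0 T, Tendsto (fun s => V s ω) (𝓝[>] t) (𝓝 (V t ω))) (s : ℝ) (ω : S) :
    Tendsto (fun s => modif T G V s ω) (𝓝[>] s) (𝓝 (modif T G V s ω)) := by
  by_cases hω : ω ∈ G
  swap
  · simp only [modif_of_notMem hω]; exact tendsto_const_nhds
  simp only [modif_of_mem hω]
  rcases lt_or_ge s 0 with hs | hs
  · have e : ∀ x < 0, clamp T x = 0 := fun x hx => by
      rw [clamp, min_eq_left (by linarith), max_eq_left hx.le]
    rw [e s hs]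
    refine tendsto_const_nhds.congr' ?_
    filter_upwards [mem_nhdsWithin_of_mem_nhds (Iio_mem_nhds hs)] with x hx
    rw [e x hx]
  rcases lt_or_ge s T with hsT | hsT
  · rw [clamp_of_mem ⟨hs, hsT.le⟩]
    refine (hG ω hω s ⟨hs, hsT⟩).congr' ?_
    filter_upwards [Ioo_mem_nhdsGT hsT] with x hx
    rw [clamp_of_mem ⟨hs.trans hx.1.le, hx.2.le⟩]
  · have e : ∀ x, T ≤ x → clamp T x = T := fun x hx => by
      rw [clamp, min_eq_right hx, max_eq_right hT.le]
    rw [e s hsT]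
    refine tendsto_const_nhds.congr' ?_
    filter_upwards [self_mem_nhdsWithin] with x hx
    rw [e x (hsT.trans (mem_Ioi.1 hx).le)]

theorem measurable_of_tendsto_right {V : ℝ → Ω → ℝ} (hm : ∀ s, Measurable (V s))
    (hV : ∀ s ω, Tendsto (fun s => V s ω) (𝓝[>] s) (𝓝 (V s ω))) :
    Measurable fun z : ℝ × Ω => V z.1 z.2 := by
  -- Grid points approaching `s` from the right; the summand `1` after the floor keeps them strictly
  -- above `s`.
  let a : ℕ → ℝ → ℝ := fun n s => (⌊s * (n + 1)⌋ + 1) / (n + 1)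
  have hgt : ∀ n s, s < a n s := fun n s => by
    rw [lt_div_iff₀ (by positivity)]
    exact Int.lt_floor_add_one _
  have hle : ∀ n s, a n s ≤ s + 1 / (n + 1) := fun n s => by
    have hn : (0 : ℝ) < n + 1 := by positivity
    rw [div_le_iff₀ hn, add_mul, one_div, inv_mul_cancel₀ hn.ne']
    linarith [Int.floor_le (s * (n + 1 : ℝ))]
  have hlim : ∀ s, Tendsto (fun n => a n s) atTop (𝓝[>] s) := fun s => by
    refine tendsto_nhdsWithin_iff.2 ⟨?_, Eventually.of_forall fun n => hgt n s⟩
    refine tendsto_of_tendsto_of_tendsto_of_le_of_le tendsto_const_nhds ?_ (fun n => (hgt n s).le)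
      (fun n => hle n s)
    simpa using (tendsto_one_div_add_atTop_nhds_zero_nat (𝕜 := ℝ)).const_add s
  refine measurable_of_tendsto_metrizable (f := fun n (z : ℝ × Ω) => V (a n z.1) z.2) (fun n => ?_)
    (tendsto_pi_nhds.2 fun z => (hV z.1 z.2).comp (hlim z.1))
  have h1 : Measurable fun y : Ω × ℤ => V ((y.2 + 1) / (n + 1)) y.1 :=
    measurable_from_prod_countable_left fun j => hm ((j + 1) / (n + 1))
  have h2 : Measurable fun z : ℝ × Ω => (z.2, ⌊z.1 * (n + 1)⌋) :=
    measurable_snd.prodMk (Int.measurable_floor.comp (by fun_prop))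
  exact h1.comp h2

theorem measurable_modif_apply (hT : 0 ≤ T) {G : Set Ω} (hG : MeasurableSet G) {V : ℝ → Ω → ℝ}
    (hV : ∀ t ∈ Icc 0 T, Measurable (V t)) (s : ℝ) : Measurable (modif T G V s) :=
  (hV _ (clamp_mem hT s)).indicator hG

theorem modif_ae_eq {G : Set Ω} (hG0 : P Gᶜ = 0) (V : ℝ → Ω → ℝ) (s : ℝ) :
    modif T G V s =ᵐ[P] V (clamp T s) := by
  filter_upwards [measure_eq_zero_iff_ae_notMem.1 hG0] with ω hω
  exact modif_of_mem (not_not.1 hω)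

/-- A right continuous process with square integrable supremum has a jointly measurable modification
dominated by a square integrable random variable. -/
theorem exists_dominated_modif (hT : 0 < T) {Y : ℝ → Ω → ℝ} (hYm : ∀ t ∈ Icc 0 T, Measurable (Y t))
    {p : Ω → Prop} (hp : ∀ᵐ ω ∂P, p ω)
    (hrc : ∀ ω, p ω → ∀ t ∈ Ico 0 T, Tendsto (fun s => Y s ω) (𝓝[>] t) (𝓝 (Y t ω)))
    (ha : ∫⁻ ω, (⨆ t ∈ Icc 0 T, ‖Y t ω‖ₑ) ^ 2 ∂P < ∞) :
    ∃ (G : Set Ω) (M : Ω → ℝ), MeasurableSet G ∧ P Gᶜ = 0 ∧ (∀ ω ∈ G, p ω) ∧ MemLp M 2 P ∧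
      (Measurable fun z : ℝ × Ω => modif T G Y z.1 z.2) ∧ ∀ s ω, |modif T G Y s ω| ≤ M ω := by
  obtain ⟨G, hG, hG0, hGp⟩ := exists_measurableSet_of_ae hp
  have hmeas : ∀ s, Measurable (modif T G Y s) := measurable_modif_apply hT.le hG hYm
  -- The supremum over rational times is measurable, and right continuity makes it bound the values
  -- at all times.
  let M0 : Ω → ℝ≥0∞ := fun ω => ⨆ q : ℚ, ‖modif T G Y q ω‖ₑ
  have hM0 : Measurable M0 := .iSup fun q => (hmeas q).enorm
  have hle : ∀ ω, M0 ω ≤ ⨆ t ∈ Icc 0 T, ‖Y t ω‖ₑ := fun ω => iSup_le fun q => by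
    by_cases hω : ω ∈ G
    · rw [modif_of_mem hω]
      exact le_iSup₂_of_le (clamp T q) (clamp_mem hT.le _) le_rfl
    · rw [modif_of_notMem hω]; simp
  have hint : ∫⁻ ω, M0 ω ^ 2 ∂P < ∞ :=
    (lintegral_mono fun ω => pow_le_pow_left' (hle ω) 2).trans_lt ha
  have hfin : ∀ᵐ ω ∂P, M0 ω < ∞ := by
    filter_upwards [ae_lt_top (hM0.pow_const 2) hint.ne] with ω hω
    exact (ENNReal.pow_lt_top_iff.1 hω).resolve_right two_ne_zero
  have hsup : ∀ s ω, ‖modif T G Y s ω‖ₑ ≤ M0 ω := by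
    intro s ω
    have ht := (tendsto_modif hT (fun ω hω => hrc ω (hGp ω hω)) s ω).enorm
    have hfr : ∃ᶠ x in 𝓝[>] s, x ∈ range ((↑) : ℚ → ℝ) := by
      have hd := Rat.denseRange_cast (𝕜 := ℝ) |>.open_subset_closure_inter (isOpen_Ioi (a := s))
      have hs : s ∈ closure (Ioi s) := by rw [closure_Ioi]; exact mem_Ici.2 le_rfl
      have hs' := mem_closure_iff_frequently.1 (closure_minimal hd isClosed_closure hs)
      rw [frequently_nhdsWithin_iff]
      exact hs'.mono fun x hx => ⟨hx.2, hx.1⟩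
    refine le_of_tendsto_of_frequently ht (hfr.mono ?_)
    rintro _ ⟨q, rfl⟩
    exact le_iSup (fun q : ℚ => ‖modif T G Y q ω‖ₑ) q
  -- The good set is shrunk to where `M0` is finite: `toReal` sends `∞` to `0`, which would break
  -- the bound.
  have hG' : MeasurableSet (G ∩ {ω | M0 ω < ∞}) := hG.inter (measurableSet_lt hM0 measurable_const)
  refine ⟨G ∩ {ω | M0 ω < ∞}, fun ω => (M0 ω).toReal, hG', ?_,
    fun ω hω => hGp ω hω.1, ⟨hM0.ennreal_toReal.aestronglyMeasurable, ?_⟩, ?_, ?_⟩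
  · rw [compl_inter]
    exact measure_union_null hG0 hfin
  · rw [eLpNorm_lt_top_iff_lintegral_rpow_enorm_lt_top two_ne_zero ENNReal.ofNat_ne_top]
    refine (lintegral_mono fun ω => ?_).trans_lt hint
    simp only [ENNReal.toReal_ofNat, ENNReal.rpow_ofNat]
    gcongr
    rw [← ofReal_norm, Real.norm_of_nonneg ENNReal.toReal_nonneg]
    exact ENNReal.ofReal_toReal_le
  · exact measurable_of_tendsto_right (measurable_modif_apply hT.le hG' hYm)
      (tendsto_modif hT fun ω hω => hrc ω (hGp ω hω.1))
  · intro s ω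
    by_cases hω : ω ∈ G ∩ {ω | M0 ω < ∞}
    · rw [modif_of_mem hω, ← modif_of_mem (T := T) (V := Y) hω.1, ← Real.norm_eq_abs, ← toReal_enorm]
      exact ENNReal.toReal_mono (ne_of_lt hω.2) (hsup s ω)
    · rw [modif_of_notMem hω, abs_zero]
      exact ENNReal.toReal_nonneg

end Modification

/-! ### Independence of the choice of versions -/

section Congr

theorem absHSq_congr (hc : IsCovarianceMeasure P T X μ) {f g : ℝ → ℝ} (hfg : f =ᵐ[marginal μ] g) :
    absHSq μ f = absHSq μ g := by
  refine lintegral_congr_ae ?_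
  filter_upwards [hc.measurePreserving_fst.quasiMeasurePreserving.ae hfg,
    (measurePreserving_snd μ).quasiMeasurePreserving.ae hfg] with p h1 h2
  rw [h1, h2]

theorem IsAbsD12.congr (hc : IsCovarianceMeasure P T X μ) {F F' : Ω → ℝ} {DF DF' : ℝ → Ω → ℝ}
    (hF : IsAbsD12 P T X μ F DF) (hFF' : F =ᵐ[P] F')
    (hm : AEMeasurable (fun p : ℝ × Ω => DF' p.1 p.2) ((marginal μ).prod P))
    (hD : ∀ᵐ ω ∂P, ∀ᵐ q ∂(marginal μ), DF q ω = DF' q ω) : IsAbsD12 P T X μ F' DF' := by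
  obtain ⟨h1, -, h3, Fn, DFn, h4, h5, h6⟩ := hF
  refine ⟨h1.ae_eq hFF', hm, ?_, Fn, DFn, h4, ?_, ?_⟩
  · filter_upwards [h3, hD] with ω h3 hD
    rwa [← absHSq_congr hc hD]
  · refine h5.congr fun n => eLpNorm_congr_ae ?_
    filter_upwards [hFF'] with ω hω
    rw [hω]
  · refine h6.congr fun n => lintegral_congr_ae ?_
    filter_upwards [hD] with ω hω
    refine absHSq_congr hc ?_
    filter_upwards [hω] with q hq
    rw [hq]

theorem IsSkorohodIntegral.congr (hc : IsCovarianceMeasure P T X μ) (hh : IsPolarDensity μ h)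
    {u u' : ℝ → Ω → ℝ} {S : Ω → ℝ} (hu : IsSkorohodIntegral P T X μ u S)
    (hm : AEMeasurable (fun p : ℝ × Ω => u' p.1 p.2) ((marginal μ).prod P))
    (huu' : ∀ᵐ ω ∂P, ∀ᵐ r ∂(marginal μ), u r ω = u' r ω) : IsSkorohodIntegral P T X μ u' S := by
  have hsnd : ∀ᵐ ω ∂P, ∀ᵐ p ∂μ.variation, u p.2 ω = u' p.2 ω := huu'.mono fun ω hω =>
    (measurePreserving_snd μ).quasiMeasurePreserving.ae hω
  refine ⟨hm, lt_of_eq_of_lt (lintegral_congr_ae ?_) hu.finite, hu.memLp, hu.mean_zero,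
    fun F DF hF hfin => (hu.duality F DF hF (lt_of_eq_of_lt (lintegral_congr_ae ?_) hfin)).trans
      (integral_congr_ae ?_)⟩
  · filter_upwards [huu'] with ω hω
    exact absHSq_congr hc (hω.mono fun r hr => hr.symm)
  · filter_upwards [hsnd] with ω hω
    exact lintegral_congr_ae (hω.mono fun p hp => by simp only [hp])
  · filter_upwards [hsnd] with ω hω
    rw [hh.integral_eq, hh.integral_eq]
    exact integral_congr_ae (hω.mono fun p hp => by simp only [hp])

end Congr

end CovMalliavin

/-! ### The limit theorem for moving windows -/

namespace CovMalliavin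

variable {Ω : Type*} [MeasurableSpace Ω] {P : Measure Ω} {T : ℝ} {X : ℝ → Ω → ℝ}
  {μ : SignedMeasure (ℝ × ℝ)} {h : ℝ × ℝ → ℝ} {Φ : Lp ℝ 2 (marginal μ) →L[ℝ] Lp ℝ 2 P}

/-- Truncation of `x` at the level `z`. -/
noncomputable def trunc (z x : ℝ) : ℝ := max (-z) (min x z)

theorem abs_trunc_le {z : ℝ} (hz : 0 ≤ z) (x : ℝ) : |trunc z x| ≤ z :=
  abs_le.2 ⟨le_max_left _ _, max_le (by linarith) (min_le_right _ _)⟩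

theorem trunc_eq {z x : ℝ} (hx : |x| ≤ z) : trunc z x = x := by
  rw [abs_le] at hx
  rw [trunc, min_eq_left hx.2, max_eq_right hx.1]

theorem ae_prod_of_ae_ae {A B : Type*} [MeasurableSpace A] [MeasurableSpace B] {a : Measure A}
    {b : Measure B} [SFinite b] {p : A × B → Prop} (hp : MeasurableSet {x | p x})
    (h : ∀ᵐ x ∂a, ∀ᵐ y ∂b, p (x, y)) : ∀ᵐ z ∂(a.prod b), p z :=
  (Measure.ae_prod_iff_ae_ae hp).2 h

theorem ae_prod_swap {A B : Type*} [MeasurableSpace A] [MeasurableSpace B] {a : Measure A}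
    {b : Measure B} [SFinite a] [SFinite b] {p : A × B → Prop} (h : ∀ᵐ z ∂(a.prod b), p z) :
    ∀ᵐ z ∂(b.prod a), p (z.2, z.1) :=
  (Measure.measurePreserving_swap (μ := b) (ν := a)).quasiMeasurePreserving.ae h

theorem ae_prod_rotate {A B C : Type*} [MeasurableSpace A] [MeasurableSpace B] [MeasurableSpace C]
    {a : Measure A} {b : Measure B} {c : Measure C} [SFinite a] [SFinite b] [SFinite c]
    {p : A × B × C → Prop} (h : ∀ᵐ z ∂(a.prod (b.prod c)), p z) :
    ∀ᵐ z : C × (B × A) ∂(c.prod (b.prod a)), p (z.2.2, z.2.1, z.1) := by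
  have h1 := (measurePreserving_prodAssoc a b c).quasiMeasurePreserving.ae h
  have h2 := (Measure.measurePreserving_swap (μ := c) (ν := a.prod b)).quasiMeasurePreserving.ae h1
  exact ((MeasurePreserving.id c).prod
    (Measure.measurePreserving_swap (μ := b) (ν := a))).quasiMeasurePreserving.ae h2

theorem Icc_mem_nhds_of_mem {r : ℝ} (hr : r ∈ Ioo 0 T) : Icc 0 T ∈ 𝓝 r :=
  Icc_mem_nhds hr.1 hr.2

/-- With no atoms of `ν`, both the endpoint `T` and the cutoff time `t` can be avoided; at the
remaining points small windows stay inside `[0,T]` and on one side of `t`. -/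
theorem ae_marginal_Ioo [IsProbabilityMeasure P] (hX : IsIntegrator P T X μ) (hh : IsPolarDensity μ h)
    (hΦ : IsWienerMap P T X μ h Φ) (t : ℝ) : ∀ᵐ r ∂(marginal μ), r ∈ Ioo 0 T ∧ r ≠ t := by
  have h1 := measure_eq_zero_iff_ae_notMem.1 (marginal_singleton hX hh hΦ T)
  have h2 := measure_eq_zero_iff_ae_notMem.1 (marginal_singleton hX hh hΦ t)
  filter_upwards [hX.covariance.ae_marginal, h1, h2] with r hr hrT hrt
  exact ⟨⟨hr.1, lt_of_le_of_ne hr.2 hrT⟩, hrt⟩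

section Truncation

variable [SFinite P] {ν : Measure ℝ} [IsFiniteMeasure ν] {DY : ℝ → ℝ → Ω → ℝ} {Z : Ω → ℝ}

theorem measurable_trunc (hDY : Measurable fun p : ℝ × ℝ × Ω => DY p.1 p.2.1 p.2.2) (hZ : Measurable Z) :
    Measurable fun p : ℝ × ℝ × Ω => trunc (Z p.2.2) (DY p.1 p.2.1 p.2.2) := by
  have hZ' : Measurable fun p : ℝ × ℝ × Ω => Z p.2.2 := hZ.comp (by fun_prop)
  exact hZ'.neg.max (hDY.min hZ')

theorem measurableSet_trunc_eq (hDY : Measurable fun p : ℝ × ℝ × Ω => DY p.1 p.2.1 p.2.2)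
    (hZ : Measurable Z) : MeasurableSet {z : ℝ × (ℝ × Ω) |
      trunc (Z z.2.2) (DY z.2.1 z.1 z.2.2) = DY z.2.1 z.1 z.2.2} := by
  have hm : Measurable fun z : ℝ × (ℝ × Ω) => (z.2.1, z.1, z.2.2) := by fun_prop
  exact measurableSet_eq_fun ((measurable_trunc hDY hZ).comp hm) (hDY.comp hm)

/-- Domination for almost every parameter makes the truncation inactive. -/
theorem ae_trunc_eq {η : Measure ℝ} (hDY : Measurable fun p : ℝ × ℝ × Ω => DY p.1 p.2.1 p.2.2)
    (hZ : Measurable Z)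
    (hb : ∀ᵐ s ∂η, ∀ᵐ q ∂ν, ∀ᵐ ω ∂P, |DY q s ω| ≤ Z ω) :
    ∀ᵐ z ∂(η.prod (ν.prod P)), trunc (Z z.2.2) (DY z.2.1 z.1 z.2.2) = DY z.2.1 z.1 z.2.2 := by
  refine ae_prod_of_ae_ae (measurableSet_trunc_eq hDY hZ) (hb.mono fun s hs => ?_)
  refine ae_prod_of_ae_ae (measurable_prodMk_left (measurableSet_trunc_eq hDY hZ))
    (hs.mono fun q hq => hq.mono fun ω hω => trunc_eq hω)

end Truncation

/-- The integrals over moving windows converge to the Skorohod integral plus the trace term. -/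
theorem exists_skorohod_shift [IsProbabilityMeasure P] (hT : 0 < T) (hX : IsIntegrator P T X μ)
    (hh : IsPolarDensity μ h) (hΦ : IsWienerMap P T X μ h Φ)
    {Y : ℝ → Ω → ℝ} (hYmeas : ∀ t ∈ Icc 0 T, Measurable (Y t))
    (hYcadlag : ∀ᵐ ω ∂P, IsCadlagOn T fun t => Y t ω)
    (ha : ∫⁻ ω, (⨆ t ∈ Icc 0 T, ‖Y t ω‖ₑ) ^ 2 ∂P < ∞)
    {DY : ℝ → ℝ → Ω → ℝ} (hDY : Measurable fun p : ℝ × ℝ × Ω => DY p.1 p.2.1 p.2.2)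
    (hb_section : ∀ᵐ s ∂(volume.restrict (Icc 0 T)), IsAbsD12 P T X μ (Y s) fun t ω => DY t s ω)
    {Z₂ : Ω → ℝ} (hZ₂ : MemLp Z₂ 2 P)
    (hb_bound : ∀ᵐ s ∂(marginal μ + volume.restrict (Icc 0 T)),
      ∀ᵐ t ∂(marginal μ), ∀ᵐ ω ∂P, |DY t s ω| ≤ Z₂ ω) {α : ℝ}
    (hreg : ∀ x : ℝ → ℝ, Measurable x → (∃ C, ∀ s, |x s| ≤ C) → IsCadlagOn T x →
      ∀ᵐ r ∂(marginal μ), Tendsto (shiftAvg α x r) (𝓝[>] 0) (𝓝 (x r)))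
    (hex : ∀ᵐ p ∂μ.variation, ∀ᵐ ω ∂P,
      ∃ l : ℝ, Tendsto (shiftAvg α (fun s => DY p.1 s ω) p.2) (𝓝[>] 0) (𝓝 l))
    (hregD : ∀ s ∈ Ioo 0 T, ∀ᵐ q ∂(marginal μ), ∀ᵐ ω ∂P,
      Tendsto (shiftAvg α (fun r => DY q r ω) s) (𝓝[>] 0) (𝓝 (DY q s ω))) {t : ℝ} (ht : t ∈ Icc 0 T) :
    ∃ S : Ω → ℝ, IsSkorohodIntegralUpTo P T X μ Y t S ∧
      (∀ᵐ ω ∂P, IntegrableOn (fun p : ℝ × ℝ =>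
        limUnder (𝓝[>] 0) (shiftAvg α (fun s => DY p.1 s ω) p.2)) (Icc 0 T ×ˢ Icc 0 t) μ.variation) ∧
      TendstoInMeasure P (fun (ε : ℝ) ω => ∫ s in (0 : ℝ)..t,
        Y s ω * ((extend T (fun r => X r ω) (s + (α + 1) * ε) -
          extend T (fun r => X r ω) (s + α * ε)) / ε)) (𝓝[>] 0) (fun ω => S ω +
        ∫ᵛ p in Icc 0 T ×ˢ Icc 0 t,
          limUnder (𝓝[>] 0) (shiftAvg α (fun s => DY p.1 s ω) p.2) ∂•μ) := by
  have hc := hX.covariance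
  -- Modifications of the integrand and of the integrator.
  obtain ⟨G, M, hG, hG0, hGp, hM, hYm, hYM⟩ :=
    exists_dominated_modif hT hYmeas hYcadlag (fun ω hω => hω.1) ha
  obtain ⟨G', hG', hG0', hGp'⟩ := exists_measurableSet_of_ae hX.continuous
  have hGae := measure_eq_zero_iff_ae_notMem.1 hG0
  have hGae' := measure_eq_zero_iff_ae_notMem.1 hG0'
  set V := modif T G' X with hV
  have hVm : Measurable fun z : ℝ × Ω => V z.1 z.2 :=
    measurable_of_tendsto_right (measurable_modif_apply hT.le hG' hX.measurable)
      (tendsto_modif hT fun ω hω s hs => by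
        have hmem : Icc 0 T ∈ 𝓝[>] s :=
          mem_of_superset (Ioo_mem_nhdsGT hs.2) fun x hx => ⟨hs.1.trans hx.1.le, hx.2.le⟩
        have hcω : ContinuousOn (fun t => X t ω) (Icc 0 T) := hGp' ω hω
        have hsm : s ∈ Icc 0 T := ⟨hs.1, hs.2.le⟩
        exact ((hcω s hsm).mono_of_mem_nhdsWithin hmem).tendsto)
  set y := modif T G Y with hy
  -- Truncation of the derivative.
  set Z : Ω → ℝ := fun ω => |hZ₂.aestronglyMeasurable.mk Z₂ ω| with hZdef
  have hZm : Measurable Z := hZ₂.aestronglyMeasurable.stronglyMeasurable_mk.measurable.abs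
  have hZ0 : ∀ ω, 0 ≤ Z ω := fun ω => abs_nonneg _
  have hZ : MemLp Z 2 P := (hZ₂.ae_eq hZ₂.aestronglyMeasurable.ae_eq_mk).norm
  have hbound : ∀ᵐ s ∂(marginal μ + volume.restrict (Icc 0 T)),
      ∀ᵐ q ∂(marginal μ), ∀ᵐ ω ∂P, |DY q s ω| ≤ Z ω :=
    hb_bound.mono fun s hs => hs.mono fun q hq => by
      filter_upwards [hq, hZ₂.aestronglyMeasurable.ae_eq_mk] with ω h1 h2
      exact h1.trans (by rw [h2]; exact le_abs_self _)
  rw [ae_add_measure_iff] at hbound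
  -- Truncation makes the domination hold everywhere. Agreement with `DY` is needed in two senses:
  -- for Lebesgue-almost every time, to leave window averages unchanged, and for `ν`-almost every
  -- time, to identify the values reached in the limit.
  set D : ℝ → ℝ → Ω → ℝ := fun q s ω => trunc (Z ω) (DY q s ω) with hD
  have hDm : Measurable fun p : ℝ × ℝ × Ω => D p.1 p.2.1 p.2.2 := measurable_trunc hDY hZm
  have hDZ : ∀ q s ω, |D q s ω| ≤ Z ω := fun q s ω => abs_trunc_le (hZ0 ω) _
  have eqν : ∀ᵐ s ∂(marginal μ), ∀ᵐ z ∂((marginal μ).prod P), D z.1 s z.2 = DY z.1 s z.2 :=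
    Measure.ae_ae_of_ae_prod (ae_trunc_eq hDY hZm hbound.1)
  have eqvol := ae_trunc_eq hDY hZm hbound.2
  have eqs : ∀ᵐ s ∂(volume.restrict (Icc 0 T)), ∀ᵐ z ∂((marginal μ).prod P), D z.1 s z.2 = DY z.1 s z.2 :=
    Measure.ae_ae_of_ae_prod eqvol
  have eqz : ∀ᵐ z ∂((marginal μ).prod P), ∀ᵐ s ∂(volume.restrict (Icc 0 T)), D z.1 s z.2 = DY z.1 s z.2 :=
    Measure.ae_ae_of_ae_prod (ae_prod_swap eqvol)
  have hlam : ∀ {p : ℝ → Prop}, (∀ᵐ s ∂(volume.restrict (Icc 0 T)), p s) →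
      ∀ᵐ s ∂(volume.restrict (Ioc 0 t)), p s := fun hp =>
    ae_mono (Measure.restrict_mono (Ioc_subset_Icc_self.trans (Icc_subset_Icc_right ht.2)) le_rfl) hp
  have hdom : IsDominated P T X μ (volume.restrict (Ioc 0 t)) y D M Z := by
    refine ⟨hYm, hDm, hM, hZ, hYM, hDZ, ?_⟩
    filter_upwards [hlam hb_section, hlam eqs, ae_restrict_mem measurableSet_Ioc] with s h1 h2 h3
    refine h1.congr hc ?_ (hDm.comp (by fun_prop : Measurable fun z : ℝ × Ω => (z.1, s, z.2))).aemeasurable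
      ((Measure.ae_ae_of_ae_prod (ae_prod_swap h2)).mono fun ω hω => hω.mono fun q hq => hq.symm)
    have := modif_ae_eq (T := T) hG0 Y s
    rw [clamp_of_mem ⟨h3.1.le, h3.2.trans ht.2⟩] at this
    exact this.symm
  have hIoo := ae_marginal_Ioo hX hh hΦ t
  have hsmear : ∀ (f : ℝ → ℝ) (c : ℝ) {r : ℝ}, r ∈ Ioo 0 T ∧ r ≠ t →
      (r < t → Tendsto (shiftAvg α f r) (𝓝[>] 0) (𝓝 c)) →
      Tendsto (fun ε => smear (volume.restrict (Ioc 0 t)) (shiftKernel α T ε) f r) (𝓝[>] 0)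
        (𝓝 ((Iio t).indicator (fun _ => c) r)) := by
    intro f c r hr hlim
    rcases lt_or_gt_of_ne hr.2 with h1 | h1
    · rw [indicator_of_mem (mem_Iio.2 h1)]
      exact (hlim h1).congr' (smear_shiftKernel_eventuallyEq α ht.2 ⟨hr.1.1, h1⟩ f).symm
    · rw [indicator_of_notMem (fun hx => lt_asymm h1 (mem_Iio.1 hx))]
      exact tendsto_const_nhds.congr' (smear_shiftKernel_eventually_zero hT.le α h1 f).symm
  -- The limit of the averaged integrand.
  set u : Ω → ℝ → ℝ := fun ω r => (Iio t).indicator (fun _ => y r ω) r with hu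
  have hum : Measurable fun z : Ω × ℝ => u z.1 z.2 := by
    have : Measurable ({z : Ω × ℝ | z.2 < t}.indicator fun z => y z.2 z.1) :=
      (hYm.comp measurable_swap).indicator (measurableSet_lt measurable_snd measurable_const)
    exact this
  have hub : ∀ ω r, |u ω r| ≤ M ω := fun ω r => by
    by_cases hr : r ∈ Iio t
    · simp only [hu, indicator_of_mem hr]; exact hYM r ω
    · simp only [hu, indicator_of_notMem hr, abs_zero]; exact (abs_nonneg _).trans (hYM r ω)
  have hycadlag : ∀ ω, IsCadlagOn T fun s => y s ω := by
    intro ω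
    refine ⟨fun s _ => tendsto_modif hT (fun ω hω => (hGp ω hω).1) s ω, fun s hs => ?_⟩
    by_cases hω : ω ∈ G
    · obtain ⟨l, hl⟩ := (hGp ω hω).2 s hs
      refine ⟨l, hl.congr' ?_⟩
      filter_upwards [Ioo_mem_nhdsLT hs.1] with x hx
      rw [hy, modif_of_mem hω, clamp_of_mem ⟨hx.1.le, hx.2.le.trans hs.2⟩]
    · refine ⟨0, ?_⟩
      simp only [hy, modif_of_notMem hω]
      exact tendsto_const_nhds
  have hulim : ∀ᵐ z ∂(P.prod (marginal μ)), Tendsto (fun ε =>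
      smear (volume.restrict (Ioc 0 t)) (shiftKernel α T ε) (fun s => y s z.1) z.2) (𝓝[>] 0)
      (𝓝 (u z.1 z.2)) := by
    have hms := measurableSet_tendsto_shiftAvg α (A := Ω × ℝ) (f := fun z s => y s z.1)
      (hYm.comp (by fun_prop : Measurable fun z : (Ω × ℝ) × ℝ => (z.2, z.1.1)))
      (fun z => ⟨M z.1, fun s => hYM s z.1⟩) measurable_snd (hYm.comp measurable_swap)
    have h1 := ae_prod_of_ae_ae (a := P) (b := marginal μ) hms (Eventually.of_forall fun ω =>
      hreg (fun s => y s ω) (hYm.comp measurable_prodMk_right) ⟨M ω, fun s => hYM s ω⟩ (hycadlag ω))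
    filter_upwards [h1, Measure.quasiMeasurePreserving_snd.ae hIoo] with z hz hr
    exact hsmear _ _ hr fun _ => hz
  -- The limit of the averaged derivative.
  have hshift : ∀ᵐ q ∂(marginal μ), ∀ᵐ ω ∂P, ∀ r ∈ Ioo 0 T,
      shiftAvg α (fun s => DY q s ω) r =ᶠ[𝓝[>] 0] shiftAvg α (fun s => D q s ω) r :=
    (Measure.ae_ae_of_ae_prod eqz).mono fun q hq => hq.mono fun ω hω r hr =>
      shiftAvg_congr (Icc_mem_nhds_of_mem hr) (hω.mono fun s hs => hs.symm)
  set K : Ω → ℝ × ℝ → ℝ := fun ω p => (Iio t).indicator (fun _ => D p.1 p.2 ω) p.2 with hKdef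
  have hK : ∀ᵐ z ∂(P.prod ((marginal μ).prod (marginal μ))), Tendsto (fun ε =>
      smear (volume.restrict (Ioc 0 t)) (shiftKernel α T ε) (fun s => D z.2.1 s z.1) z.2.2) (𝓝[>] 0)
      (𝓝 (K z.1 z.2)) := by
    have hms := measurableSet_tendsto_shiftAvg α (A := ℝ × ℝ × Ω) (f := fun z s => D z.2.1 s z.2.2)
      (hDm.comp (by fun_prop : Measurable fun z : (ℝ × ℝ × Ω) × ℝ => (z.1.2.1, z.2, z.1.2.2)))
      (fun z => ⟨Z z.2.2, fun s => hDZ _ s _⟩) measurable_fst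
      (hDm.comp (by fun_prop : Measurable fun z : ℝ × ℝ × Ω => (z.2.1, z.1, z.2.2)))
    -- The second half of the trace hypothesis holds at each fixed `r`. Measurability of the
    -- convergence set turns it into a statement for almost all triples.
    have h1 : ∀ᵐ z ∂((marginal μ).prod ((marginal μ).prod P)),
        Tendsto (shiftAvg α (fun s => D z.2.1 s z.2.2) z.1) (𝓝[>] 0) (𝓝 (D z.2.1 z.1 z.2.2)) := by
      refine ae_prod_of_ae_ae hms ?_
      filter_upwards [hIoo, eqν] with r hr hrD
      refine ae_prod_of_ae_ae (measurable_prodMk_left hms) ?_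
      filter_upwards [hregD r hr.1, hshift, Measure.ae_ae_of_ae_prod hrD] with q h1 h2 h3
      filter_upwards [h1, h2, h3] with ω h1 h2 h3
      rw [h3]
      exact h1.congr' (h2 r hr.1)
    filter_upwards [ae_prod_rotate h1, Measure.quasiMeasurePreserving_snd.ae
      (Measure.quasiMeasurePreserving_snd.ae hIoo)] with z hz hr
    exact hsmear _ _ hr fun _ => hz
  -- The trace.
  have hmsL := measurableSet_exists_tendsto_shiftAvg α (A := (ℝ × ℝ) × Ω) (f := fun z s => D z.1.1 s z.2)
      (r := fun z => z.1.2)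
      (hDm.comp (by fun_prop : Measurable fun z : ((ℝ × ℝ) × Ω) × ℝ => (z.1.1.1, z.2, z.1.2)))
      (fun z => ⟨Z z.2, fun s => hDZ _ s _⟩) (by fun_prop)
  have hshift2 : ∀ᵐ p ∂μ.variation, ∀ᵐ ω ∂P, 
      shiftAvg α (fun s => DY p.1 s ω) p.2 =ᶠ[𝓝[>] 0] shiftAvg α (fun s => D p.1 s ω) p.2 := by
    filter_upwards [hc.measurePreserving_fst.quasiMeasurePreserving.ae hshift,
      (measurePreserving_snd μ).quasiMeasurePreserving.ae hIoo] with p h1 h2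
    filter_upwards [h1] with ω h1
    exact h1 p.2 h2.1
  have hexD : ∀ᵐ z ∂(P.prod μ.variation), ∃ c,
      Tendsto (shiftAvg α (fun s => D z.2.1 s z.1) z.2.2) (𝓝[>] 0) (𝓝 c) := by
    refine ae_prod_swap (p := fun z : (ℝ × ℝ) × Ω => ∃ c,
      Tendsto (shiftAvg α (fun s => D z.1.1 s z.2) z.1.2) (𝓝[>] 0) (𝓝 c)) (ae_prod_of_ae_ae hmsL ?_)
    filter_upwards [hex, hshift2] with p h1 h2
    filter_upwards [h1, h2] with ω h1 h2
    exact h1.imp fun c hc => hc.congr' h2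
  have hmε : ∀ ε : ℝ, Measurable fun z : Ω × (ℝ × ℝ) => shiftAvg α (fun s => D z.2.1 s z.1) z.2.2 ε := by
    intro ε
    by_cases hε : ε = 0
    · simp only [shiftAvg, hε, inv_zero, zero_mul]; exact measurable_const
    · exact measurable_shiftAvg α (f := fun (z : Ω × (ℝ × ℝ)) s => D z.2.1 s z.1)
        (hDm.comp (by fun_prop : Measurable fun z : (Ω × (ℝ × ℝ)) × ℝ => (z.1.2.1, z.2, z.1.1)))
        (by fun_prop) hε
  -- Here the first half of the trace hypothesis is used. It concerns `|μ|`, which may be singular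
  -- to `ν ⊗ ν`, so the trace need not be given by the values of `D`.
  obtain ⟨L0, hL0m, hL0⟩ := measurable_limit_of_tendsto_metrizable_ae
    (fun ε => (hmε ε).aemeasurable) hexD
  have hL0b : ∀ᵐ z ∂(P.prod μ.variation), |L0 z| ≤ Z z.1 := by
    filter_upwards [hL0] with z hz
    refine le_of_tendsto hz.abs ?_
    filter_upwards [self_mem_nhdsWithin] with ε hε
    exact abs_shiftAvg_le (fun s => hDZ _ s _) _ (ne_of_gt hε)
  set L : Ω → ℝ × ℝ → ℝ := fun ω p => (Iio t).indicator (fun _ => trunc (Z ω) (L0 (ω, p))) p.2 with hLdef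
  have hLm : Measurable fun z : Ω × (ℝ × ℝ) => L z.1 z.2 := by
    have h1 : Measurable fun z : Ω × (ℝ × ℝ) => trunc (Z z.1) (L0 z) := by
      have hZ' : Measurable fun z : Ω × (ℝ × ℝ) => Z z.1 := hZm.comp measurable_fst
      exact hZ'.neg.max (hL0m.min hZ')
    have h2 : MeasurableSet {z : Ω × (ℝ × ℝ) | z.2.2 < t} :=
      measurableSet_lt (by fun_prop) measurable_const
    exact h1.indicator h2
  have hLb : ∀ ω p, |L ω p| ≤ Z ω := fun ω p => by
    by_cases hr : p.2 ∈ Iio t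
    · simp only [hLdef, indicator_of_mem hr]; exact abs_trunc_le (hZ0 ω) _
    · simp only [hLdef, indicator_of_notMem hr, abs_zero]; exact hZ0 ω
  have hIoo2 : ∀ᵐ p ∂μ.variation, p.2 ∈ Ioo 0 T ∧ p.2 ≠ t :=
    (measurePreserving_snd μ).quasiMeasurePreserving.ae hIoo
  have hL : ∀ᵐ z ∂(P.prod μ.variation), Tendsto (fun ε =>
      smear (volume.restrict (Ioc 0 t)) (shiftKernel α T ε) (fun s => D z.2.1 s z.1) z.2.2) (𝓝[>] 0)
      (𝓝 (L z.1 z.2)) := by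
    filter_upwards [hL0, hL0b, Measure.quasiMeasurePreserving_snd.ae hIoo2] with z h1 h2 h3
    refine hsmear _ _ h3 fun _ => ?_
    rw [trunc_eq h2]
    exact h1
  -- Almost everywhere the truncated measurable limit is the actual window limit of `DY`, so
  -- `limUnder` has its intended meaning there.
  have htrace : ∀ᵐ ω ∂P, ∀ᵐ p ∂μ.variation, (Icc 0 T ×ˢ Icc 0 t).indicator (fun p : ℝ × ℝ =>
      limUnder (𝓝[>] 0) (shiftAvg α (fun s => DY p.1 s ω) p.2)) p = L ω p := by
    have hz : ∀ᵐ z ∂(P.prod μ.variation), ∀ᵐ s ∂(volume.restrict (Icc 0 T)),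
        D z.2.1 s z.1 = DY z.2.1 s z.1 := ae_prod_fst hc (ae_prod_swap eqz)
    filter_upwards [Measure.ae_ae_of_ae_prod hz, Measure.ae_ae_of_ae_prod hL0,
      Measure.ae_ae_of_ae_prod hL0b] with ω h1 h2 h3
    filter_upwards [h1, h2, h3, hIoo2, hc.measurePreserving_fst.quasiMeasurePreserving.ae hIoo]
      with p h1 h2 h3 h4 h5
    rcases lt_or_gt_of_ne h4.2 with hp | hp
    · have hmem : p ∈ Icc 0 T ×ˢ Icc 0 t := ⟨⟨h5.1.1.le, h5.1.2.le⟩, h4.1.1.le, hp.le⟩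
      rw [indicator_of_mem hmem, hLdef]
      simp only [indicator_of_mem (mem_Iio.2 hp)]
      rw [trunc_eq h3]
      exact (h2.congr' (shiftAvg_congr (Icc_mem_nhds_of_mem h4.1) h1)).limUnder_eq
    · rw [indicator_of_notMem (fun hx => absurd hx.2.2 (not_le.2 hp)), hLdef]
      simp only [indicator_of_notMem (fun hx => lt_asymm hp (mem_Iio.1 hx))]
  -- Conclusion.
  obtain ⟨S, hS, hlim⟩ := hdom.exists_skorohod_tendsto (l := 𝓝[>] (0 : ℝ)) hX hh hΦ
    (fun ε => isKernelFamily_shiftKernel hT.le α ε t)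
    (fun ε => isWienerFamily_shiftIncr hT.le hΦ hVm (fun s => modif_ae_eq hG0' X s) α ε)
    hum hub hulim hK hLm hLb hL
  have hset : MeasurableSet (Icc (0 : ℝ) T ×ˢ Icc (0 : ℝ) t) := measurableSet_Icc.prod measurableSet_Icc
  refine ⟨S, hS.congr hc hh ?_ ?_, ?_, hlim.congr' ?_ ?_⟩
  · refine (hum.comp measurable_swap).aemeasurable.congr ?_
    filter_upwards [Measure.quasiMeasurePreserving_fst.ae hIoo,
      Measure.quasiMeasurePreserving_snd.ae hGae] with z h1 h2
    simp only [Function.comp_def, Prod.swap, hu]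
    rcases lt_or_gt_of_ne h1.2 with hp | hp
    · rw [indicator_of_mem (mem_Iio.2 hp), indicator_of_mem (show z.1 ∈ Icc 0 t from ⟨h1.1.1.le, hp.le⟩),
        hy, modif_of_mem (not_not.1 h2), clamp_of_mem ⟨h1.1.1.le, h1.1.2.le⟩]
    · rw [indicator_of_notMem (fun hx => lt_asymm hp (mem_Iio.1 hx)),
        indicator_of_notMem (fun hx => absurd hx.2 (not_le.2 hp))]
  · filter_upwards [hGae] with ω h2
    filter_upwards [hIoo] with r h1
    simp only [hu]
    rcases lt_or_gt_of_ne h1.2 with hp | hp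
    · rw [indicator_of_mem (mem_Iio.2 hp), indicator_of_mem (show r ∈ Icc 0 t from ⟨h1.1.1.le, hp.le⟩),
        hy, modif_of_mem (not_not.1 h2), clamp_of_mem ⟨h1.1.1.le, h1.1.2.le⟩]
    · rw [indicator_of_notMem (fun hx => lt_asymm hp (mem_Iio.1 hx)),
        indicator_of_notMem (fun hx => absurd hx.2 (not_le.2 hp))]
  · filter_upwards [htrace] with ω hω
    rw [← integrable_indicator_iff hset]
    refine Integrable.congr ?_ (hω.mono fun p hp => hp.symm)
    exact Integrable.of_bound (hLm.comp measurable_prodMk_left).aestronglyMeasurable (Z ω)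
      (Eventually.of_forall fun p => hLb ω p)
  · filter_upwards [self_mem_nhdsWithin] with ε hε
    filter_upwards [hGae, hGae'] with ω h1 h2
    rw [intervalIntegral.integral_of_le ht.1]
    refine setIntegral_congr_fun measurableSet_Ioc fun s hs => ?_
    have hε' : 0 < ε := hε
    simp only [shiftIncr, if_pos hε', hy, hV, modif_of_mem (not_not.1 h1), modif_of_mem (not_not.1 h2)]
    rw [clamp_of_mem ⟨hs.1.le, hs.2.trans ht.2⟩, div_eq_inv_mul]
    rfl
  · filter_upwards [htrace] with ω hω
    rw [← VectorMeasure.integral_indicator hset, hh.integral_eq]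
    congr 1
    exact integral_congr_ae (hω.mono fun p hp => by simp only [hp])

end CovMalliavin

/-! ### The forward and backward formulas -/

theorem theoremt5p7 {Ω : Type*} [MeasurableSpace Ω] (P : Measure Ω) [IsProbabilityMeasure P]
    (T : ℝ) (hT : 0 < T) (X : ℝ → Ω → ℝ) (μ : SignedMeasure (ℝ × ℝ))
    (hX : CovMalliavin.IsIntegrator P T X μ)
    (Y : ℝ → Ω → ℝ) (hYmeas : ∀ t ∈ Icc 0 T, Measurable (Y t))
    (hYcadlag : ∀ᵐ ω ∂P, CovMalliavin.IsCadlagOn T (fun t => Y t ω))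
    -- a) the supremum of `|Y|` is square integrable
    (ha : ∫⁻ ω, (⨆ t ∈ Icc 0 T, ‖Y t ω‖ₑ) ^ 2 ∂P < ∞)
    -- b) Malliavin differentiability, and domination of the derivative
    (DY : ℝ → ℝ → Ω → ℝ)
    (hb : CovMalliavin.IsAbsD12Process P T X μ Y DY)
    (hb_section : ∀ᵐ s ∂(volume.restrict (Icc 0 T)),
      CovMalliavin.IsAbsD12 P T X μ (Y s) (fun t ω => DY t s ω))
    (Z₂ : Ω → ℝ) (hZ₂ : MemLp Z₂ 2 P)
    (hb_bound : ∀ᵐ s ∂(CovMalliavin.marginal μ + volume.restrict (Icc 0 T)),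
      ∀ᵐ t ∂(CovMalliavin.marginal μ), ∀ᵐ ω ∂P, |DY t s ω| ≤ Z₂ ω) :
    -- c) implies the forward formula
    (CovMalliavin.HasLeftTraces P T μ DY →
      ∀ t ∈ Icc 0 T, ∃ S : Ω → ℝ, CovMalliavin.IsSkorohodIntegralUpTo P T X μ Y t S ∧
        (∀ᵐ ω ∂P, IntegrableOn
          (fun p : ℝ × ℝ => CovMalliavin.leftTrace (fun s => DY p.1 s ω) p.2)
          (Icc 0 T ×ˢ Icc 0 t) μ.variation) ∧
        CovMalliavin.IsForwardIntegral P T X Y t (fun ω => S ω +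
          ∫ᵛ p in Icc 0 T ×ˢ Icc 0 t,
            CovMalliavin.leftTrace (fun s => DY p.1 s ω) p.2 ∂•μ)) ∧
    -- c') implies the backward formula
    (CovMalliavin.HasRightTraces P T μ DY →
      ∀ t ∈ Icc 0 T, ∃ S : Ω → ℝ, CovMalliavin.IsSkorohodIntegralUpTo P T X μ Y t S ∧
        (∀ᵐ ω ∂P, IntegrableOn
          (fun p : ℝ × ℝ => CovMalliavin.rightTrace (fun s => DY p.1 s ω) p.2)
          (Icc 0 T ×ˢ Icc 0 t) μ.variation) ∧
        CovMalliavin.IsBackwardIntegral P T X Y t (fun ω => S ω +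
          ∫ᵛ p in Icc 0 T ×ˢ Icc 0 t,
            CovMalliavin.rightTrace (fun s => DY p.1 s ω) p.2 ∂•μ)) := by

  obtain ⟨h, hm, h1, h2, h3⟩ := CovMalliavin.exists_polar_density μ
  have hh : CovMalliavin.IsPolarDensity μ h := ⟨hm, h1, h2, h3⟩
  obtain ⟨Φ, hΦ⟩ := CovMalliavin.exists_isWienerMap hT hX hh
  have hIoo := CovMalliavin.ae_marginal_Ioo hX hh hΦ T
  constructor
  · intro hc t ht
    -- For `α = 0` the increments are `X_{s+ε} - X_s` and the windows `[r - ε, r]`. Their averages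
    -- tend to left limits, and these differ from the values of a cadlag path only on a countable,
    -- hence `ν`-null, set.
    have key := CovMalliavin.exists_skorohod_shift hT hX hh hΦ hYmeas hYcadlag ha hb.measurable_deriv
      hb_section hZ₂ hb_bound (α := 0) ?_ ?_ ?_ ht
    · simp only [CovMalliavin.shiftAvg_zero, zero_add, one_mul, zero_mul, add_zero] at key
      exact key
    · rintro x hx ⟨C, hC⟩ hxc
      have : NullSingletonClass (CovMalliavin.marginal μ) :=
        ⟨fun c => CovMalliavin.marginal_singleton hX hh hΦ c⟩
      filter_upwards [hIoo, measure_eq_zero_iff_ae_notMem.1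
        ((CovMalliavin.countable_setOf_leftLim_ne x).measure_zero (CovMalliavin.marginal μ))]
        with r hr hne
      obtain ⟨l, hl⟩ := hxc.2 r ⟨hr.1.1, hr.1.2.le⟩
      have hlr : l = x r := by
        by_contra hcon
        exact hne ⟨l, hl, hcon⟩
      exact CovMalliavin.tendsto_shiftAvg_zero hx hC (hlr ▸ hl)
    · simpa only [CovMalliavin.shiftAvg_zero] using hc.exists_limit
    · intro s hs
      simpa only [CovMalliavin.shiftAvg_zero] using hc.regular s ⟨hs.1, hs.2.le⟩
  · intro hc t ht
    -- For `α = -1` the increments are `X_s - X_{s-ε}` and the windows `[r, r + ε]`; right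
    -- continuity gives the limit of the averages directly.
    have key := CovMalliavin.exists_skorohod_shift hT hX hh hΦ hYmeas hYcadlag ha hb.measurable_deriv
      hb_section hZ₂ hb_bound (α := -1) ?_ ?_ ?_ ht
    · simp only [CovMalliavin.shiftAvg_neg_one, neg_add_cancel, zero_mul, add_zero, neg_one_mul,
        ← sub_eq_add_neg] at key
      exact key
    · rintro x hx ⟨C, hC⟩ hxc
      filter_upwards [hIoo] with r hr
      exact CovMalliavin.tendsto_shiftAvg_neg_one hx hC (hxc.1 r ⟨hr.1.1.le, hr.1.2⟩)
    · simpa only [CovMalliavin.shiftAvg_neg_one] using hc.exists_limit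
    · intro s hs
      simpa only [CovMalliavin.shiftAvg_neg_one] using hc.regular s ⟨hs.1.le, hs.2⟩
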